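/- **Theorem 3.4.** *Conventions.* All rings are commutative with $1$. For a ring $B$ let $B^{red}=B/\mathrm{nil}(B)$, let $\overline B$ be the integral closure of $B^{red}$ in its total ring of fractions, and call $\nu_B:B\to B^{red}\hookrightarrow\overline B$ the normalization of $B$. For an integer $i\ge 0$ put $B^{>i}=B/\mathfrak p^{>i}$, where $\mathfrak p^{>i}$ is the intersection of all minimal primes $\mathfrak p$ of $B$ with $\dim B/\mathfrak p>i$ (so $\mathfrak p^{>i}=B$ if there are none). $B$ is normal if all its local rings are integrally closed domains, and it is normal at a prime if the local ring there is an integrally closed domain. A non-normal point $p\in\operatorname{Spec}B$ is an isolated non-normal singularity if it has an open neighbourhood $U$ such that $B$ is normal at all points of $U\smallsetminus\{p\}$. For a local ring $(B,\mathfrak m)$ over a field $k$ put $$\delta_k(B)=\dim_k\overline B/B^{red}-\dim_k H^0_{\mathfrak m}(B),\qquad H^0_{\mathfrak m}(B)=\{x\in B: \mathfrak m^n x=0\text{ for some }n\},$$ and for an arbitrary $k$-algebra $B$ put $\delta_k(B)=\sum_{\mathfrak m}\delta_k(B_{\mathfrak m})$, the sum over all maximal ideals of $B$ (normal points of positive dimension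 contribute $0$; isolated points contribute even if they are normal; $\delta_k(0)=0$). It is called finite if all the dimensions that occur are finite and for all but finitely many $\mathfrak m$ both vector spaces $\overline{B_{\mathfrak m}}/(B_{\mathfrak m})^{red}$ and $H^0_{\mathfrak m}(B_{\mathfrak m})$ are zero. A morphism $m:\widetilde X\to X$ is a *fiberwise normalization* of $f:X\to S$ if $m$ is finite, $\widetilde f=f\circ m$ is flat, the non-empty fibers of $\widetilde f$ are normal, and for every $t\in f(X)$ the map of fibers $\widetilde f^{-1}(t)\to f^{-1}(t)$ is birational, i.e. a bijection between the generic points of the irreducible components that induces isomorphisms of the local rings at these points. *Statement.* Let $A$ be a principal ideal domain, $R$ a Nagata ring (Noetherian, and for every prime $\mathfrak p$ the integral closure of $R/\mathfrak p$ in any finite extension of its fraction field is finite over $R/\mathfrak p$), and $A\to R$ a flat ring map. Let $S=\operatorname{Spec}A$, $X=\operatorname{Spec}R$, $X^{>1}=\operatorname{Spec}R^{>1}$, let $f:X\to S$ and $f^{>1}:X^{>1}\to S$ be the induced morphisms, $\nu:R\to\overline R$ the normalization and $\nu^{>1}:R\to R^{>1}\to\overline{R^{>1}}$. For $t\in S$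 let $k(t)$ be its residue field and $X_t=\operatorname{Spec}(R\otimes_A k(t))$, and write $\delta_{k(t)}(X_t)=\delta_{k(t)}(R\otimes_A k(t))$. Assume that * $\operatorname{Coker}(\nu)$ and $\operatorname{Ker}(\nu^{>1})$ are finitely generated $A$-modules; * for each $t\in f(X)$ the fiber $X_t$ has only finitely many non-normal points, all of them are isolated non-normal singularities, and their residue fields are finite over $k(t)$; * $\operatorname{Spec}\overline{R^{>1}}$ has dimension at least $2$ at each closed point lying over a closed point of $S$, in the sense that every maximal ideal of $\overline{R^{>1}}$ whose preimage in $A$ is non-zero has height $\ge 2$ (this holds automatically if, for instance, $R$ is of finite type over $A$). Then $\delta_{k(t)}(X_t)$ is finite for every $t\in S$, and: 1. If $f$ admits a fiberwise normalization, then $t\mapsto\delta_{k(t)}(X_t)$ is constant on $S$. 2. $t\mapsto\delta_{k(t)}(X_t)$ is constant on $S$ if and only if $f^{>1}$ admits a fiberwise normalization. 3. If $A$ is not a field and $X$ has no $1$-dimensional irreducible component, then $f$ admits a fiberwise normalization if and only if $t\mapsto\delta_{k(t)}(X_t)$ is constant on $S$. -/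

import Mathlib

open scoped TensorProduct

namespace DeltaInv

universe u v

/-! ### Normalization, normal rings, Nagata rings -/

/-- The normalization of a commutative ring `R`: the integral closure of the reduction
`R / nil(R)` in its total ring of fractions (`FractionRing` is the localization at all
non-zero-divisors).  The structure map `R → R / nil(R) → Normalization R` is
`algebraMap R (Normalization R)`. -/
abbrev Normalization (R : Type u) [CommRing R] : Type u :=
  integralClosure (R ⧸ nilradical R) (FractionRing (R ⧸ nilradical R))

/-- The cokernel of the normalization map `R → Normalization R`. -/
abbrev NormalizationCoker (R : Type u) [CommRing R] : Type u :=
  Normalization R ⧸ LinearMap.range (Algebra.linearMap R (Normalization R))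

/-- `R` is normal at the prime `p`: the local ring `R_p` is an integrally closed domain. -/
def IsNormalAt {R : Type u} [CommRing R] (p : PrimeSpectrum R) : Prop :=
  IsDomain (Localization.AtPrime p.asIdeal) ∧
    IsIntegrallyClosed (Localization.AtPrime p.asIdeal)

/-- A normal ring: all local rings are integrally closed domains (the zero ring is normal). -/
def IsNormalRing (R : Type u) [CommRing R] : Prop :=
  ∀ p : PrimeSpectrum R, IsNormalAt p

/-- The non-normal locus of `Spec R`. -/
def nonNormalLocus (R : Type u) [CommRing R] : Set (PrimeSpectrum R) :=
  {p | ¬ IsNormalAt p}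

/-- The isolated non-normal singularity condition at `p` (normal points satisfy it if they have a
neighbourhood of normal points): some open neighbourhood of `p`
consists, apart from possibly `p` itself, of normal points. -/
def IsIsolatedNonNormal {R : Type u} [CommRing R] (p : PrimeSpectrum R) : Prop :=
  ∃ U : Set (PrimeSpectrum R), IsOpen U ∧ p ∈ U ∧ ∀ q ∈ U, q ≠ p → IsNormalAt q

/-- `Spec R`, for a `k`-algebra `R`, is normal outside finitely many isolated non-normal
singularities, whose residue fields are finite over `k`. -/
def FinitelyManyINNS (k : Type u) (R : Type v) [Field k] [CommRing R] [Algebra k R] : Prop :=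
  (nonNormalLocus R).Finite ∧
    ∀ p ∈ nonNormalLocus R, IsIsolatedNonNormal p ∧ Module.Finite k p.asIdeal.ResidueField

/-- An N-2 (Japanese) domain: the integral closure in every finite extension of the field of
fractions is module-finite. -/
def IsN2 (D : Type u) [CommRing D] [IsDomain D] : Prop :=
  ∀ (L : Type u) [Field L] [Algebra (FractionRing D) L] [Algebra D L]
    [IsScalarTower D (FractionRing D) L] [FiniteDimensional (FractionRing D) L],
    Module.Finite D (integralClosure D L)

/-- A Nagata ring: Noetherian, and `R / p` is N-2 for every prime `p`. -/
def IsNagata (R : Type u) [CommRing R] : Prop :=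
  IsNoetherianRing R ∧ ∀ p : PrimeSpectrum R, IsN2 (R ⧸ p.asIdeal)

/-! ### The part of dimension greater than `i` -/

/-- The intersection of the minimal primes `p` of `R` with `dim R / p > i` (the whole ring if
there are none). -/
def idealGT (i : ℕ) (R : Type u) [CommRing R] : Ideal R :=
  sInf {p | p ∈ minimalPrimes R ∧ (i : WithBot ℕ∞) < ringKrullDim (R ⧸ p)}

/-- `R^{>i}`; its spectrum is the union of the irreducible components of `Spec R` of dimension
`> i`, with the reduced structure. -/
abbrev PartGT (i : ℕ) (R : Type u) [CommRing R] : Type u := R ⧸ idealGT i R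

/-! ### The delta invariant -/

/-- The zeroth local cohomology `H⁰_m(R)` of `R` at the ideal `m`: the elements killed by a power
of `m`. -/
def localCohomologyZero {R : Type u} [CommRing R] (m : Ideal R) : Ideal R where
  carrier := {x | ∃ n : ℕ, ∀ a ∈ m ^ n, a * x = 0}
  zero_mem' := ⟨0, fun a _ => mul_zero a⟩
  add_mem' := by
    rintro x y ⟨n, hn⟩ ⟨l, hl⟩
    refine ⟨max n l, fun a ha => ?_⟩
    rw [mul_add, hn a (Ideal.pow_le_pow_right (le_max_left n l) ha),
      hl a (Ideal.pow_le_pow_right (le_max_right n l) ha), add_zero]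
  smul_mem' := by
    rintro c x ⟨n, hn⟩
    refine ⟨n, fun a ha => ?_⟩
    rw [smul_eq_mul, mul_left_comm, hn a ha, mul_zero]

/-- The epsilon invariant `ε_k(R) = dim_k H⁰_m(R)` of a local `k`-algebra. -/
noncomputable def localEpsilon (k : Type u) (R : Type v) [Field k] [CommRing R] [IsLocalRing R]
    [Algebra k R] : ℕ :=
  Module.finrank k (localCohomologyZero (IsLocalRing.maximalIdeal R))

/-- The delta invariant `δ_k(R) = dim_k (R̄ / R^red) - ε_k(R)` of a local `k`-algebra (meaningful
when both dimensions are finite). -/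
noncomputable def localDelta (k : Type u) (R : Type v) [Field k] [CommRing R] [IsLocalRing R]
    [Algebra k R] : ℤ :=
  (Module.finrank k (NormalizationCoker R) : ℤ) - (localEpsilon k R : ℤ)

/-- `δ_k(R)` is defined and finite: both dimensions in the definition of the local delta
invariants at the closed points are finite, and they vanish at all but finitely many closed
points. -/
def DeltaFinite (k : Type u) (R : Type v) [Field k] [CommRing R] [Algebra k R] : Prop :=
  (∀ m : MaximalSpectrum R,
    Module.Finite k (NormalizationCoker (Localization.AtPrime m.asIdeal)) ∧
    Module.Finite k (localCohomologyZero
      (IsLocalRing.maximalIdeal (Localization.AtPrime m.asIdeal)))) ∧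
  {m : MaximalSpectrum R |
    ¬ (Subsingleton (NormalizationCoker (Localization.AtPrime m.asIdeal)) ∧
      Subsingleton (localCohomologyZero
        (IsLocalRing.maximalIdeal (Localization.AtPrime m.asIdeal))))}.Finite

/-- The (total) delta invariant of a `k`-algebra: the sum of the local delta invariants.  A closed
point contributes only if it is non-normal or an isolated point of `Spec R`: at a normal closed
point of positive dimension both `R̄ / R^red` and `H⁰` vanish. -/
noncomputable def delta (k : Type u) (R : Type v) [Field k] [CommRing R] [Algebra k R] : ℤ :=
  ∑ᶠ m : MaximalSpectrum R, localDelta k (Localization.AtPrime m.asIdeal)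

/-! ### Fibres and fiberwise normalization -/

/-- The fibre ring `R(t) = k(t) ⊗ R` over a point `t` of `Spec A`. -/
abbrev FibreRing {A : Type u} [CommRing A] (t : PrimeSpectrum A) (R : Type v) [CommRing R]
    [Algebra A R] : Type (max u v) :=
  t.asIdeal.Fiber R

/-- The map induced on the fibres over `t` by an `A`-algebra homomorphism. -/
noncomputable def fibreMap {A : Type u} [CommRing A] (t : PrimeSpectrum A) {R S : Type v}
    [CommRing R] [CommRing S] [Algebra A R] [Algebra A S] (φ : R →ₐ[A] S) :
    FibreRing t R →+* FibreRing t S :=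
  (Algebra.TensorProduct.map (AlgHom.id A t.asIdeal.ResidueField) φ).toRingHom

/-- `Spec φ` is birational: it is a bijection between the generic points of the irreducible
components, and induces isomorphisms of the local rings at these points. -/
def IsBirational {R : Type u} {S : Type v} [CommRing R] [CommRing S] (φ : R →+* S) : Prop :=
  Set.BijOn (Ideal.comap φ) (minimalPrimes S) (minimalPrimes R) ∧
  ∀ q : PrimeSpectrum S, q.asIdeal ∈ minimalPrimes S →
    Function.Bijective (Localization.localRingHom (q.asIdeal.comap φ) q.asIdeal φ rfl)

/-- `Spec φ` is a fiberwise normalization of `Spec R → Spec A`: it is finite, `Spec S` is flat over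
`Spec A` with normal fibres, and for every `t` in the image of `Spec R` the map of fibres
over `t` is birational. -/
def IsFiberwiseNormalization {A : Type u} [CommRing A] {R S : Type v}
    [CommRing R] [CommRing S] [Algebra A R] [Algebra A S] (φ : R →ₐ[A] S) : Prop :=
  φ.toRingHom.Finite ∧
  Module.Flat A S ∧
  (∀ t : PrimeSpectrum A, IsNormalRing (FibreRing t S)) ∧
  ∀ t ∈ Set.range (PrimeSpectrum.comap (algebraMap A R)), IsBirational (fibreMap t φ)

/-- `Spec R → Spec A` admits a fiberwise normalization.  As a fiberwise normalization is finite,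
its source is affine, so only ring maps `R → S` have to be considered. -/
def AdmitsFiberwiseNormalization (A : Type u) (R : Type v) [CommRing A] [CommRing R]
    [Algebra A R] : Prop :=
  ∃ (S : Type v) (_ : CommRing S) (_ : Algebra A S) (φ : R →ₐ[A] S), IsFiberwiseNormalization φ

/-- The function `t ↦ δ_{k(t)}(X_t)` on `Spec A`, where `X = Spec R` (it is `0` where the fibre
is empty). -/
noncomputable def fibreDelta (A : Type u) (R : Type v) [CommRing A] [CommRing R] [Algebra A R]
    (t : PrimeSpectrum A) : ℤ :=
  delta t.asIdeal.ResidueField (FibreRing t R)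

end DeltaInv

open scoped TensorProduct nonZeroDivisors

namespace DeltaInv

universe w

/-! ### Normal rings -/

section Normal

variable {D : Type u} {E : Type v} [CommRing D] [CommRing E]

/-! Let `N` be the normalization of `R^{>1}` and `φ : R → N` the canonical map. It is finite because
`R` is Nagata, its kernel and cokernel are finite over `A`, and `R` and `N` are flat over `A`.
Everything comes from comparing the fibres `B = R(t)` and `E = N(t)`.

Euler characteristic (`exists_euler_eq`). Lift generators of `Coker φ` to a map `A^n → N`. Then `R ×
A^n → N` is surjective, and its kernel `P` is finitely generated and torsion-free, hence free. After
base change to any field, `dim Coker - dim Ker` of `φ` is therefore the constant `c = n - rank P`.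

Depth (`SocleFree`). No nonzero element of `E` is killed by a maximal ideal. On a closed fibre this
holds because `N`, being normal of dimension at least two at the relevant points, has depth at least
two there, and dividing by a generator of the prime of `A` costs only one. On the generic fibre it
holds because a Noetherian domain of dimension greater than one containing a principal ideal domain
has a nonzero prime over the generic point.

Delta (`IsNormalization.exists_delta_eq`). Positive depth makes the kernel of `B → E` the local
cohomology of `B`, and makes the normalization `Ē` of `E` the normalization of `B` away from
isolated points. Hence `δ(B) = c + d(t)` with `d(t) = dim Ē/E ≥ 0`, and `d(t) = 0` exactly if `E` is
normal. The generic fibre of `N` is a localization of a normal ring, so `d` vanishes there, and `δ`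
is constant if and only if all fibres of `N` are normal.

Fiberwise normalizations. If all fibres of `N` are normal, then `N` is a fiberwise normalization of
`R^{>1}`; birationality on the fibres again follows from positive depth. It is one of `R` as well
once `p^{>1}` is nilpotent, which the hypotheses of the third part ensure. Conversely, a fiberwise
normalization of a flat morphism is a normalization (`IsFiberwiseNormalization.isNormalization`).
One of `R^{>1}` is thus isomorphic to `N`, and one of `R` has `N` as its quotient by an idempotent;
in both cases the fibres of `N` inherit normality. -/

lemma isDomain_and_isIntegrallyClosed_of_ringEquiv {D : Type u} {E : Type v} [CommRing D]
    [CommRing E] (e : D ≃+* E) (h : IsDomain D ∧ IsIntegrallyClosed D) :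
    IsDomain E ∧ IsIntegrallyClosed E := by
  obtain ⟨h1, h2⟩ := h
  exact ⟨MulEquiv.isDomain D e.symm.toMulEquiv, IsIntegrallyClosed.of_equiv e⟩

lemma IsNormalAt.of_ringEquiv {p : PrimeSpectrum D} {q : PrimeSpectrum E}
    (e : Localization.AtPrime p.asIdeal ≃+* Localization.AtPrime q.asIdeal) (h : IsNormalAt p) :
    IsNormalAt q :=
  isDomain_and_isIntegrallyClosed_of_ringEquiv e h

/-- Normality can be tested on the localizations at the contracted primes if these are the
localizations of the target. -/
lemma IsNormalRing.of_localRingHom_bijective (f : D →+* E) (hD : IsNormalRing D)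
    (h : ∀ q : PrimeSpectrum E, Function.Bijective
      (Localization.localRingHom (q.asIdeal.comap f) q.asIdeal f rfl)) : IsNormalRing E := by
  intro q
  have hb := h q
  generalize Localization.localRingHom (q.asIdeal.comap f) q.asIdeal f rfl = g at hb
  exact isDomain_and_isIntegrallyClosed_of_ringEquiv (RingEquiv.ofBijective g hb)
    (hD ⟨q.asIdeal.comap f, inferInstance⟩)

/-- An elementwise criterion for the map of local rings to be bijective. -/
lemma localRingHom_bijective (f : D →+* E) (q : Ideal E) [q.IsPrime]
    (hinj : ∀ x, f x = 0 → ∃ u, f u ∉ q ∧ u * x = 0)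
    (hsurj : ∀ y, ∃ u, f u ∉ q ∧ ∃ x, f u * y = f x)
    (hker : ∀ w y, w ∉ q → w * y = 0 → ∃ u, f u ∉ q ∧ f u * y = 0) :
    Function.Bijective (Localization.localRingHom (q.comap f) q f rfl) := by
  constructor
  · rw [injective_iff_map_eq_zero]
    intro z hz
    obtain ⟨x, s, rfl⟩ := IsLocalization.exists_mk'_eq (q.comap f).primeCompl z
    rw [Localization.localRingHom_mk', IsLocalization.mk'_eq_zero_iff] at hz
    obtain ⟨⟨w, hw⟩, h⟩ := hz
    obtain ⟨u, hu, h⟩ := hker w _ hw h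
    rw [← map_mul] at h
    obtain ⟨u', hu', h'⟩ := hinj _ h
    rw [IsLocalization.mk'_eq_zero_iff]
    refine ⟨⟨u' * u, ?_⟩, by simpa [mul_assoc] using h'⟩
    simpa [Ideal.primeCompl] using (‹q.IsPrime›.mul_notMem hu' hu)
  · intro z
    obtain ⟨y, ⟨s, hs⟩, rfl⟩ := IsLocalization.exists_mk'_eq q.primeCompl z
    obtain ⟨u, hu, x, hx⟩ := hsurj y
    obtain ⟨u', hu', x', hx'⟩ := hsurj s
    have hx'q : f x' ∉ q := by rw [← hx']; exact ‹q.IsPrime›.mul_notMem hu' hs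
    refine ⟨IsLocalization.mk' _ (u' * x)
      (⟨u * x', by simpa [Ideal.primeCompl] using ‹q.IsPrime›.mul_notMem hu hx'q⟩ :
        (q.comap f).primeCompl), ?_⟩
    rw [Localization.localRingHom_mk', IsLocalization.mk'_eq_iff_eq]
    simp only [map_mul, ← hx, ← hx']
    ring_nf

lemma IsNormalAt.eq_zero_or_eq_zero {p : PrimeSpectrum D} (hp : IsNormalAt p) {x y : D}
    (h : x * y = 0) : (∃ s ∉ p.asIdeal, s * x = 0) ∨ ∃ s ∉ p.asIdeal, s * y = 0 := by
  have := hp.1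
  have h2 : algebraMap D (Localization.AtPrime p.asIdeal) x * algebraMap D _ y = 0 := by
    rw [← map_mul, h, map_zero]
  rcases mul_eq_zero.1 h2 with h2 | h2
  · obtain ⟨⟨m, hm⟩, h3⟩ := (IsLocalization.map_eq_zero_iff p.asIdeal.primeCompl _ _).1 h2
    exact .inl ⟨m, hm, h3⟩
  · obtain ⟨⟨m, hm⟩, h3⟩ := (IsLocalization.map_eq_zero_iff p.asIdeal.primeCompl _ _).1 h2
    exact .inr ⟨m, hm, h3⟩

/-- If a fraction over a normal local ring is integral, it belongs to the local ring. -/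
lemma IsNormalAt.exists_mul_eq {p : PrimeSpectrum D} (hp : IsNormalAt p) {a b : D}
    (hb : ∀ s ∉ p.asIdeal, s * b ≠ 0) {F : Polynomial D} (hF : F.Monic)
    (h : (F.scaleRoots b).eval a = 0) : ∃ s ∉ p.asIdeal, ∃ c, s * a = b * c := by
  obtain ⟨_, _⟩ := hp
  set L := Localization.AtPrime p.asIdeal
  let K := FractionRing L
  have hbL : algebraMap D L b ≠ 0 := by
    intro h0
    obtain ⟨⟨m, hm⟩, h3⟩ := (IsLocalization.map_eq_zero_iff p.asIdeal.primeCompl _ _).1 h0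
    exact hb m hm h3
  have hbK : algebraMap D K b ≠ 0 := by
    rw [IsScalarTower.algebraMap_apply D L K]
    simpa using hbL
  have hint : IsIntegral L (algebraMap D K a / algebraMap D K b) := by
    refine IsIntegral.tower_top (R := D) ⟨F, hF, ?_⟩
    -- `(F.scaleRoots b).eval a` is `b ^ F.natDegree` times `F (a / b)`: the hypothesis is an
    -- integral equation for `a / b` with cleared denominators.
    have h1 := congrArg (algebraMap D K) h
    rw [map_zero, ← Polynomial.eval₂_hom] at h1
    have h2 := Polynomial.scaleRoots_eval₂_mul (p := F) (algebraMap D K)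
      (algebraMap D K a / algebraMap D K b) b
    rw [mul_div_cancel₀ _ hbK, h1] at h2
    exact (mul_eq_zero.1 h2.symm).resolve_left (pow_ne_zero _ hbK)
  obtain ⟨y, hy⟩ := IsIntegrallyClosed.algebraMap_eq_of_integral hint
  obtain ⟨c, ⟨s, hs⟩, rfl⟩ := IsLocalization.exists_mk'_eq p.asIdeal.primeCompl y
  rw [eq_div_iff hbK, IsScalarTower.algebraMap_apply D L K, IsScalarTower.algebraMap_apply D L K,
    ← map_mul] at hy
  have hy := IsFractionRing.injective L K hy
  have h3 : algebraMap D L (b * c) = algebraMap D L (s * a) := by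
    have h5 := IsLocalization.mk'_spec'_mk L c s hs
    rw [map_mul, map_mul, ← hy, ← h5]
    ring
  obtain ⟨⟨m, hm⟩, h4⟩ := (IsLocalization.eq_iff_exists p.asIdeal.primeCompl L).1 h3
  refine ⟨m * s, p.2.mul_notMem hm hs, m * c, ?_⟩
  simp only at h4
  linear_combination -h4

/-- A property of elements that holds locally at all primes holds. -/
lemma mem_of_forall_prime {I : Ideal D} (h : ∀ p : PrimeSpectrum D, ∃ s ∉ p.asIdeal, s ∈ I)
    (x : D) :
    x ∈ I := by
  suffices I = ⊤ by simp [this]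
  by_contra hI
  obtain ⟨m, hm, hIm⟩ := Ideal.exists_le_maximal I hI
  obtain ⟨s, hs, hsI⟩ := h ⟨m, hm.isPrime⟩
  exact hs (hIm hsI)

lemma IsNormalRing.isReduced (hD : IsNormalRing D) : IsReduced D := by
  refine (isReduced_iff_pow_one_lt 2 (by norm_num)).2 fun x hx => ?_
  have := mem_of_forall_prime (I := LinearMap.ker (LinearMap.toSpanSingleton D D x)) ?_ 1
  · simpa using this
  · intro p
    rw [sq] at hx
    rcases (hD p).eq_zero_or_eq_zero hx with ⟨s, hs, h⟩ | ⟨s, hs, h⟩ <;>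
    exact ⟨s, hs, by simpa using h⟩

/-- A normal ring is integrally closed in its total ring of fractions. -/
lemma IsNormalRing.isIntegrallyClosed (hD : IsNormalRing D) : IsIntegrallyClosed D := by
  rw [isIntegrallyClosed_iff (FractionRing D)]
  intro x hx
  obtain ⟨a, ⟨b, hb⟩, rfl⟩ := IsLocalization.exists_mk'_eq D⁰ x
  obtain ⟨F, hF, h⟩ := hx
  have h1 : (F.scaleRoots b).eval a = 0 := by
    apply IsFractionRing.injective D (FractionRing D)
    rw [map_zero, ← Polynomial.eval₂_hom]
    have h2 := Polynomial.scaleRoots_eval₂_mul (p := F) (algebraMap D (FractionRing D))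
      (IsLocalization.mk' _ a ⟨b, hb⟩) b
    rwa [IsLocalization.mk'_spec'_mk, h, mul_zero] at h2
  have := mem_of_forall_prime (I := (Ideal.span {b}).colon {a}) ?_ 1
  · rw [Submodule.mem_colon_singleton, one_smul, Ideal.mem_span_singleton'] at this
    obtain ⟨c, hc⟩ := this
    exact ⟨c, by rw [IsLocalization.eq_mk'_iff_mul_eq, ← map_mul, hc]⟩
  · intro p
    obtain ⟨s, hs, c, hc⟩ := (hD p).exists_mul_eq (a := a) (b := b) (fun s hs h0 => hs (by
      rw [(mul_right_mem_nonZeroDivisors_eq_zero_iff hb).1 h0]; exact p.asIdeal.zero_mem)) hF h1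
    refine ⟨s, hs, ?_⟩
    rw [Submodule.mem_colon_singleton, smul_eq_mul, hc]
    exact Ideal.mul_mem_right _ _ (Ideal.mem_span_singleton_self b)

/-- Quotients of normal rings by idempotents are normal. -/
lemma IsNormalRing.of_surjective (hD : IsNormalRing D) (f : D →+* E)
    (hf : Function.Surjective f) {e : D} (he : e * e = e) (hfe : RingHom.ker f = Ideal.span {e}) :
    IsNormalRing E := by
  have hfe0 : f e = 0 := by
    rw [← RingHom.mem_ker, hfe]; exact Ideal.mem_span_singleton_self e
  refine hD.of_localRingHom_bijective f fun q => localRingHom_bijective f _ ?_ ?_ ?_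
  · intro x hx
    rw [← RingHom.mem_ker, hfe, Ideal.mem_span_singleton'] at hx
    obtain ⟨a, rfl⟩ := hx
    refine ⟨1 - e, ?_, by linear_combination (-a) * he⟩
    rw [map_sub, hfe0, map_one, sub_zero]
    exact q.asIdeal.ne_top_iff_one.1 q.2.ne_top
  · intro y
    obtain ⟨x, rfl⟩ := hf y
    exact ⟨1, by simpa using q.asIdeal.ne_top_iff_one.1 q.2.ne_top, x, by simp⟩
  · intro w y hw h
    obtain ⟨u, rfl⟩ := hf w
    exact ⟨u, hw, h⟩

lemma IsNormalRing.of_ringEquiv (hD : IsNormalRing D) (f : D ≃+* E) : IsNormalRing E :=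
  hD.of_surjective f.toRingHom f.surjective (e := 0) (by simp) (by
    rw [Ideal.span_singleton_eq_bot.2 rfl]
    exact (RingHom.injective_iff_ker_eq_bot _).1 f.injective)

lemma IsNormalRing.of_isLocalization (hD : IsNormalRing D) (M : Submonoid D) [Algebra D E]
    [IsLocalization M E] : IsNormalRing E := by
  have hM : ∀ (q : PrimeSpectrum E) (m : M), algebraMap D E m ∉ q.asIdeal := fun q m hm =>
    q.2.ne_top (Ideal.eq_top_of_isUnit_mem _ hm (IsLocalization.map_units E m))
  refine hD.of_localRingHom_bijective (algebraMap D E) fun q => localRingHom_bijective _ _ ?_ ?_ ?_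
  · intro x hx
    obtain ⟨m, hm⟩ := (IsLocalization.map_eq_zero_iff M E x).1 hx
    exact ⟨m, hM q m, hm⟩
  · intro y
    obtain ⟨⟨x, m⟩, h⟩ := IsLocalization.surj M y
    exact ⟨m, hM q m, x, by rw [mul_comm]; exact h⟩
  · intro w y hw h
    obtain ⟨⟨u, m⟩, hu⟩ := IsLocalization.surj M w
    simp only at hu
    exact ⟨u, by rw [← hu]; exact q.2.mul_notMem hw (hM q m), by
      rw [← hu, mul_right_comm, h, zero_mul]⟩

/-- A ring integrally closed in its total ring of fractions, with enough idempotents, is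
normal. -/
lemma isNormalRing_of_idempotents [IsIntegrallyClosed D]
    (h : ∀ x : D, ∃ e, e * e = e ∧ e * x = x ∧ x + (1 - e) ∈ D⁰) : IsNormalRing D := by
  intro p
  have key : ∀ x e : D, e * e = e → e * x = x → e ∈ p.asIdeal → ∃ s ∉ p.asIdeal, s * x = 0 := by
    intro x e _ hx hep
    refine ⟨1 - e, fun h1 => p.2.ne_top ((Ideal.eq_top_iff_one _).2 ?_), by
      linear_combination -hx⟩
    simpa using add_mem h1 hep
  set L := Localization.AtPrime p.asIdeal
  have hz : ∀ x : D, algebraMap D L x = 0 ↔ ∃ s ∉ p.asIdeal, s * x = 0 := by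
    intro x
    rw [IsLocalization.map_eq_zero_iff p.asIdeal.primeCompl L]
    exact ⟨fun ⟨⟨s, hs⟩, h⟩ => ⟨s, hs, h⟩, fun ⟨s, hs, h⟩ => ⟨⟨s, hs⟩, h⟩⟩
  have hdom : IsDomain L := by
    have : NoZeroDivisors L := by
      refine ⟨fun {x y} hxy => ?_⟩
      obtain ⟨a, s, rfl⟩ := IsLocalization.exists_mk'_eq p.asIdeal.primeCompl x
      obtain ⟨b, t, rfl⟩ := IsLocalization.exists_mk'_eq p.asIdeal.primeCompl y
      rw [← IsLocalization.mk'_mul, IsLocalization.mk'_eq_zero_iff] at hxy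
      obtain ⟨⟨u, hu⟩, hu0⟩ := hxy
      simp only at hu0
      obtain ⟨e, he, hea, hnz⟩ := h a
      rw [IsLocalization.mk'_eq_zero_iff, IsLocalization.mk'_eq_zero_iff]
      by_cases hep : e ∈ p.asIdeal
      · obtain ⟨s, hs, h⟩ := key a e he hea hep
        exact .inl ⟨⟨s, hs⟩, h⟩
      · refine .inr ⟨⟨e * u, p.2.mul_notMem hep hu⟩, ?_⟩
        -- `e * u` kills `b`, because `(a + (1 - e)) * (e * u * b)` reduces to `u * (a * b) = 0` and
        -- the first factor is regular.
        refine (mul_left_mem_nonZeroDivisors_eq_zero_iff hnz).1 ?_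
        simp only
        linear_combination e * hu0 - u * b * he
    exact NoZeroDivisors.to_isDomain L
  refine ⟨hdom, ?_⟩
  let K := FractionRing L
  rw [isIntegrallyClosed_iff K]
  intro x hx
  obtain ⟨a', b', hb', rfl⟩ := IsFractionRing.div_surjective (A := L) x
  obtain ⟨⟨⟨a, b⟩, c⟩, hab⟩ : ∃ q : (D × D) × p.asIdeal.primeCompl,
      algebraMap D L q.2 * a' = algebraMap D L q.1.1 ∧
        algebraMap D L q.2 * b' = algebraMap D L q.1.2 := by
    obtain ⟨a, s, rfl⟩ := IsLocalization.exists_mk'_eq p.asIdeal.primeCompl a'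
    obtain ⟨b, t, rfl⟩ := IsLocalization.exists_mk'_eq p.asIdeal.primeCompl b'
    refine ⟨⟨⟨t * a, s * b⟩, s * t⟩, ?_, ?_⟩
    · simp only [Submonoid.coe_mul, map_mul]
      rw [mul_comm (algebraMap D L s), mul_assoc, IsLocalization.mk'_spec']
    · simp only [Submonoid.coe_mul, map_mul]
      rw [mul_assoc, IsLocalization.mk'_spec']
  simp only at hab
  have hc0 : algebraMap D L c ≠ 0 := (IsLocalization.map_units L c).ne_zero
  have hb'0 : b' ≠ 0 := nonZeroDivisors.ne_zero hb'
  have hbL : algebraMap D L b ≠ 0 := by rw [← hab.2]; exact mul_ne_zero hc0 hb'0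
  obtain ⟨e, he, heb, hnz⟩ := h b
  have hep : e ∉ p.asIdeal := fun hep => hbL ((hz b).2 (key b e he heb hep))
  -- The denominator `b` may be a zero divisor in `D`. Adding `1 - e` makes it regular and does not
  -- change its image in `L`, since `1 - e` is killed by `e ∉ p`.
  set β := b + (1 - e) with hβ
  have hbβ : algebraMap D L β = algebraMap D L b := by
    rw [← sub_eq_zero, ← map_sub]
    exact (hz _).2 ⟨e, hep, by rw [hβ]; linear_combination -he⟩
  have hxab : algebraMap L K a' / algebraMap L K b' = algebraMap D K a / algebraMap D K β := by
    rw [IsScalarTower.algebraMap_apply D L K, IsScalarTower.algebraMap_apply D L K, hbβ, ← hab.1,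
      ← hab.2, map_mul, map_mul, mul_div_mul_left]
    simpa using hc0
  have hβK : algebraMap D K β ≠ 0 := by
    rw [IsScalarTower.algebraMap_apply D L K, hbβ]; simpa using hbL
  rw [hxab] at hx ⊢
  obtain ⟨⟨m, hm⟩, F, hF, hroot⟩ :=
    hx.exists_multiple_integral_of_isLocalization p.asIdeal.primeCompl _
  simp only [Submonoid.mk_smul, Algebra.smul_def] at hroot
  have h1 : algebraMap D K ((F.scaleRoots β).eval (m * a)) = 0 := by
    rw [← Polynomial.eval₂_hom]
    have h2 := Polynomial.scaleRoots_eval₂_mul (p := F) (algebraMap D K)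
      (algebraMap D K m * (algebraMap D K a / algebraMap D K β)) β
    rw [hroot, mul_zero] at h2
    rwa [mul_left_comm, mul_div_cancel₀ _ hβK, ← map_mul] at h2
  rw [IsScalarTower.algebraMap_apply D L K, FaithfulSMul.algebraMap_eq_zero_iff, hz] at h1
  obtain ⟨w, hw, h1⟩ := h1
  -- the fraction `w * m * a / β` is integral over `D`
  have hdeg : F.natDegree ≠ 0 := by
    intro h0
    rw [hF.natDegree_eq_zero.1 h0] at hroot
    simp at hroot
  -- The equation for `m * a / β` holds in `D` only after multiplication by `w`. Scaling the roots
  -- by `w` multiplies the value by `w ^ F.natDegree`, which contains a factor `w` as the degree is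
  -- positive.
  have h3 : ((F.scaleRoots w).scaleRoots β).eval (w * (m * a)) = 0 := by
    have : (F.scaleRoots w).scaleRoots β = (F.scaleRoots β).scaleRoots w := by
      rw [← Polynomial.scaleRoots_mul, ← Polynomial.scaleRoots_mul, mul_comm]
    rw [this, Polynomial.scaleRoots_eval_mul, Polynomial.natDegree_scaleRoots]
    obtain ⟨n, hn⟩ := Nat.exists_eq_succ_of_ne_zero hdeg
    rw [hn, pow_succ, mul_assoc, h1, mul_zero]
  have hint : IsIntegral D (IsLocalization.mk' (FractionRing D) (w * (m * a)) ⟨β, hnz⟩) := by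
    refine ⟨F.scaleRoots w, (Polynomial.monic_scaleRoots_iff w).2 hF, ?_⟩
    have h2 := Polynomial.scaleRoots_eval₂_mul (p := F.scaleRoots w) (algebraMap D (FractionRing D))
      (IsLocalization.mk' (FractionRing D) (w * (m * a)) ⟨β, hnz⟩) β
    rw [IsLocalization.mk'_spec'_mk, Polynomial.eval₂_hom, h3, map_zero] at h2
    have hu : IsUnit (algebraMap D (FractionRing D) β) :=
      IsLocalization.map_units (FractionRing D) ⟨β, hnz⟩
    exact ((hu.pow _).mul_right_eq_zero).1 h2.symm
  obtain ⟨d, hd⟩ := IsIntegrallyClosed.algebraMap_eq_of_integral hint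
  rw [IsLocalization.eq_mk'_iff_mul_eq, ← map_mul] at hd
  have hd := IsFractionRing.injective D (FractionRing D) hd
  simp only at hd
  have hwmp : w * m ∈ p.asIdeal.primeCompl := p.2.mul_notMem hw hm
  refine ⟨IsLocalization.mk' L d (⟨w * m, hwmp⟩ : p.asIdeal.primeCompl), ?_⟩
  have hwm : algebraMap L K (algebraMap D L (w * m)) ≠ 0 := by
    have := (IsLocalization.map_units L (⟨w * m, hwmp⟩ : p.asIdeal.primeCompl)).ne_zero
    simpa using this
  rw [eq_div_iff hβK]
  apply mul_left_cancel₀ hwm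
  rw [← mul_assoc, ← map_mul, IsLocalization.mk'_spec'_mk, IsScalarTower.algebraMap_apply D L K,
    IsScalarTower.algebraMap_apply D L K, ← map_mul, ← map_mul, ← map_mul, ← map_mul, hd, mul_assoc]

end Normal

/-! ### Prime avoidance and regular elements -/

section NonZeroDivisors

variable {B : Type u} [CommRing B]

lemma exists_ne_zero_of_mem_associatedPrimes [IsNoetherianRing B] {p : Ideal B}
    (hp : p ∈ associatedPrimes B B) : ∃ z, ∀ x, x ∈ p ↔ x * z = 0 := by
  obtain ⟨_, z, rfl⟩ := isAssociatedPrime_iff.1 hp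
  exact ⟨z, fun x => by simp [Submodule.mem_colon_singleton]⟩

/-- In a Noetherian ring, an ideal with zero annihilator contains a non-zero-divisor. -/
lemma exists_mem_nonZeroDivisors [IsNoetherianRing B] {J : Ideal B}
    (hJ : ∀ z, (∀ x ∈ J, x * z = 0) → z = 0) : ∃ d ∈ J, d ∈ B⁰ := by
  by_contra! h
  have h1 : (J : Set B) ⊆ ⋃ p ∈ associatedPrimes B B, (p : Set B) := by
    rw [biUnion_associatedPrimes_eq_compl_nonZeroDivisors]
    exact fun x hx => h x hx
  obtain ⟨p, hp, hJp⟩ := (Ideal.subset_union_prime_finite (associatedPrimes.finite B B) (f := id)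
    ⊤ ⊤ (fun p hp _ _ => hp.isPrime)).1 h1
  obtain ⟨z, hz⟩ := exists_ne_zero_of_mem_associatedPrimes hp
  refine hp.isPrime.ne_top ((Ideal.eq_top_iff_one p).2 ((hz 1).2 ?_))
  rw [one_mul]
  exact hJ z fun x hx => (hz x).1 (hJp hx)

/-- In a reduced Noetherian ring every ideal is complemented up to a non-zero-divisor. -/
lemma exists_add_mem_nonZeroDivisors [IsNoetherianRing B] [IsReduced B] (I : Ideal B) :
    ∃ u ∈ I, ∃ v, (∀ x ∈ I, x * v = 0) ∧ u + v ∈ B⁰ := by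
  let J : Ideal B := I.annihilator
  have hJ : ∀ x, x ∈ J ↔ ∀ y ∈ I, y * x = 0 := fun x => by
    simp [J, Submodule.mem_annihilator, mul_comm]
  -- An element killing both `I` and its annihilator lies in that annihilator, so its square is
  -- zero.
  obtain ⟨d, hd, hnz⟩ := exists_mem_nonZeroDivisors (J := I ⊔ J) (by
    intro z hz
    have h1 : z ∈ J := (hJ z).2 fun x hx => hz x (Ideal.mem_sup_left hx)
    exact IsReduced.eq_zero z ⟨2, by rw [sq]; exact hz z (Ideal.mem_sup_right h1)⟩)
  obtain ⟨u, hu, v, hv, rfl⟩ := Submodule.mem_sup.1 hd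
  exact ⟨u, hu, v, (hJ v).1 hv, hnz⟩

end NonZeroDivisors

/-! ### Normalization: normality, uniqueness, irreducible components -/

section Normalization

/-- The integral closure in the total ring of fractions has the same total ring of fractions. -/
instance isFractionRing_integralClosure (B : Type u) (Q : Type v) [CommRing B] [CommRing Q]
    [Algebra B Q] [IsFractionRing B Q] : IsFractionRing (integralClosure B Q) Q := by
  have hnz : ∀ b ∈ B⁰, algebraMap B (integralClosure B Q) b ∈ (integralClosure B Q)⁰ := by
    intro b hb
    rw [mem_nonZeroDivisors_iff_right]
    intro z hz
    have h1 : (z : Q) * algebraMap B Q b = 0 := congrArg Subtype.val hz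
    exact Subtype.ext (((IsLocalization.map_units Q ⟨b, hb⟩).mul_left_eq_zero).1 h1)
  constructor
  refine ⟨?_, ?_, ?_⟩
  · rintro ⟨d, hd⟩
    obtain ⟨⟨a, b, hb⟩, h⟩ := IsLocalization.surj B⁰ (d : Q)
    simp only at h
    have ha : a ∈ B⁰ := by
      rw [mem_nonZeroDivisors_iff_right]
      intro z hz
      have h1 : algebraMap B (integralClosure B Q) z * d = 0 := by
        ext
        change algebraMap B Q z * (d : Q) = 0
        rw [← (IsLocalization.map_units Q ⟨b, hb⟩).mul_left_eq_zero, mul_assoc, h, ← map_mul, hz,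
          map_zero]
      have h2 := (mul_right_mem_nonZeroDivisors_eq_zero_iff hd).1 h1
      apply IsFractionRing.injective B Q
      rw [map_zero]
      exact congrArg Subtype.val h2
    have h3 := IsLocalization.map_units Q (⟨a, ha⟩ : B⁰)
    rw [← h] at h3
    exact isUnit_of_mul_isUnit_left h3
  · intro z
    obtain ⟨⟨a, b, hb⟩, h⟩ := IsLocalization.surj B⁰ z
    exact ⟨⟨algebraMap B _ a, algebraMap B _ b, hnz b hb⟩, h⟩
  · intro x y h
    exact ⟨1, by rw [Subtype.ext h]⟩

/-- The idempotents required by `isNormalRing_of_idempotents` are available: for `x = a / b` choose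
`v` with `a * v = 0` and `c * a + v` regular. Then `e = c * a / (c * a + v)` is idempotent, hence
integral, and is the indicator function of the components on which `x` does not vanish. -/
lemma isNormalRing_normalization (B : Type u) [CommRing B] [IsNoetherianRing B] :
    IsNormalRing (Normalization B) := by
  set B' := B ⧸ nilradical B
  set Q := FractionRing B'
  have : IsReduced B' := (Ideal.isRadical_iff_quotient_reduced _).1 (Ideal.radical_isRadical _)
  have : IsIntegrallyClosed (Normalization B) :=
    (isIntegrallyClosed_iff_isIntegrallyClosedIn Q).2 inferInstance
  apply isNormalRing_of_idempotents
  intro x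
  obtain ⟨⟨a, b, hb⟩, h⟩ := IsLocalization.surj B'⁰ (x : Q)
  simp only at h
  have hbu := IsLocalization.map_units Q (⟨b, hb⟩ : B'⁰)
  obtain ⟨u, hu, v, hv, hnz⟩ := exists_add_mem_nonZeroDivisors (Ideal.span {a})
  obtain ⟨c, rfl⟩ := Ideal.mem_span_singleton'.1 hu
  have hav : a * v = 0 := hv a (Ideal.mem_span_singleton_self a)
  have hwu := IsLocalization.map_units Q (⟨_, hnz⟩ : B'⁰)
  set e : Q := IsLocalization.mk' Q (c * a) (⟨_, hnz⟩ : B'⁰) with he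
  have hew : e * algebraMap B' Q (c * a + v) = algebraMap B' Q (c * a) :=
    IsLocalization.mk'_spec _ _ _
  have hav' : algebraMap B' Q a * algebraMap B' Q v = 0 := by rw [← map_mul, hav, map_zero]
  have hee : e * e = e := by
    apply hwu.mul_right_cancel
    apply hwu.mul_right_cancel
    have : e * e * algebraMap B' Q (c * a + v) * algebraMap B' Q (c * a + v) =
      (e * algebraMap B' Q (c * a + v)) * (e * algebraMap B' Q (c * a + v)) := by ring
    change e * e * algebraMap B' Q (c * a + v) * algebraMap B' Q (c * a + v) =
      e * algebraMap B' Q (c * a + v) * algebraMap B' Q (c * a + v)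
    rw [this, hew, map_add, mul_add, map_mul]
    linear_combination - (algebraMap B' Q c) * hav'
  have hex : e * x = x := by
    apply hwu.mul_right_cancel
    apply hbu.mul_right_cancel
    change e * x * algebraMap B' Q (c * a + v) * algebraMap B' Q b =
      x * algebraMap B' Q (c * a + v) * algebraMap B' Q b
    have h1 : e * x * algebraMap B' Q (c * a + v) * algebraMap B' Q b =
      (e * algebraMap B' Q (c * a + v)) * (x * algebraMap B' Q b) := by ring
    have h2 : x * algebraMap B' Q (c * a + v) * algebraMap B' Q b =
      algebraMap B' Q (c * a + v) * (x * algebraMap B' Q b) := by ring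
    rw [h1, h2, hew, h, map_add]
    linear_combination - hav'
  have hint : IsIntegral B' e := by
    refine ⟨Polynomial.X ^ 2 - Polynomial.X, by monicity!, ?_⟩
    simp [sq, hee]
  refine ⟨⟨e, hint⟩, Subtype.ext hee, Subtype.ext hex, ?_⟩
  rw [mem_nonZeroDivisors_iff_right]
  intro z hz
  have hz' : (z : Q) * (x + (1 - e)) = 0 := congrArg Subtype.val hz
  have hzx : (z : Q) * x = 0 := by
    linear_combination e * hz' - (z : Q) * hex + z * hee
  have hza : (z : Q) * algebraMap B' Q a = 0 := by
    rw [← h, ← mul_assoc, hzx, zero_mul]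
  have hze : (z : Q) * e = 0 := by
    rw [← hwu.mul_left_eq_zero]
    change (z : Q) * e * algebraMap B' Q (c * a + v) = 0
    rw [mul_assoc, hew, map_mul, mul_left_comm, hza, mul_zero]
  ext
  change (z : Q) = 0
  linear_combination hz' - hzx + hze

/-- The elements whose residue classes in the reduction are non-zero-divisors. -/
def redRegular (R : Type u) [CommRing R] : Submonoid R :=
  (R ⧸ nilradical R)⁰.comap (Ideal.Quotient.mk (nilradical R))

lemma mem_redRegular_iff {R : Type u} [CommRing R] {b : R} :
    b ∈ redRegular R ↔ ∀ x, x * b ∈ nilradical R → x ∈ nilradical R := by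
  simp only [redRegular, Submonoid.mem_comap, mem_nonZeroDivisors_iff_right,
    Ideal.Quotient.mk_surjective.forall (f := Ideal.Quotient.mk (nilradical R)), ← map_mul,
    Ideal.Quotient.eq_zero_iff_mem (I := nilradical R)]

lemma mem_redRegular_iff_of_isReduced {R : Type u} [CommRing R] [IsReduced R] {b : R} :
    b ∈ redRegular R ↔ b ∈ R⁰ := by
  rw [mem_redRegular_iff, mem_nonZeroDivisors_iff_right, nilradical_eq_zero]
  rfl

lemma isReduced_quotient_nilradical (R : Type u) [CommRing R] : IsReduced (R ⧸ nilradical R) :=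
  (Ideal.isRadical_iff_quotient_reduced _).1 (Ideal.radical_isRadical _)

/-- `N` is a normalization of `R`, characterized without choosing a total ring of fractions. -/
structure IsNormalization (R : Type u) (N : Type v) [CommRing R] [CommRing N] [Algebra R N] :
    Prop where
  isIntegral : Algebra.IsIntegral R N
  isIntegrallyClosed : IsIntegrallyClosed N
  algebraMap_eq_zero_iff : ∀ x, algebraMap R N x = 0 ↔ x ∈ nilradical R
  algebraMap_mem : ∀ b ∈ redRegular R, algebraMap R N b ∈ N⁰
  exists_mul_eq : ∀ s : N, ∃ b ∈ redRegular R, ∃ r, algebraMap R N b * s = algebraMap R N r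

lemma isNormalization_normalization (R : Type u) [CommRing R] :
    IsNormalization R (Normalization R) := by
  set Q := FractionRing (R ⧸ nilradical R)
  have h1 : Algebra.IsIntegral R (R ⧸ nilradical R) :=
    Algebra.IsIntegral.of_surjective (Algebra.ofId R _) Ideal.Quotient.mk_surjective
  refine ⟨Algebra.IsIntegral.trans (R ⧸ nilradical R),
    (isIntegrallyClosed_iff_isIntegrallyClosedIn Q).2 inferInstance, fun x => ?_, fun b hb => ?_,
    fun y => ?_⟩
  · rw [← Ideal.Quotient.eq_zero_iff_mem,
      ← map_eq_zero_iff _ (IsFractionRing.injective (R ⧸ nilradical R) Q)]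
    exact Subtype.ext_iff
  · rw [mem_nonZeroDivisors_iff_right]
    intro z hz
    have h1 : (z : Q) * algebraMap _ _ (Ideal.Quotient.mk (nilradical R) b) = 0 :=
      congrArg Subtype.val hz
    exact Subtype.ext (((IsLocalization.map_units _ (⟨_, hb⟩ :
      (R ⧸ nilradical R)⁰)).mul_left_eq_zero).1 h1)
  · obtain ⟨⟨a, d, hd⟩, h⟩ := IsLocalization.surj (R ⧸ nilradical R)⁰ (y : Q)
    obtain ⟨a, rfl⟩ := Ideal.Quotient.mk_surjective a
    obtain ⟨d, rfl⟩ := Ideal.Quotient.mk_surjective d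
    exact ⟨d, hd, a, Subtype.ext (by rw [mul_comm]; exact h)⟩

/-- Recognition of the normalization. -/
lemma IsNormalization.nonempty_algEquiv {B : Type u} {S : Type v} [CommRing B] [CommRing S]
    [Algebra B S] (h : IsNormalization B S) : Nonempty (Normalization B ≃ₐ[B] S) := by
  obtain ⟨_, _, hker', hnz, hfrac⟩ := h
  have hker : RingHom.ker (algebraMap B S) = nilradical B := by
    ext x
    rw [RingHom.mem_ker, hker']
  let : Algebra (B ⧸ nilradical B) S :=
    (Ideal.Quotient.lift (nilradical B) (algebraMap B S) fun x hx => by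
      rwa [← hker] at hx).toAlgebra
  have : IsScalarTower B (B ⧸ nilradical B) S := .of_algebraMap_eq fun x => rfl
  have hinj : Function.Injective (algebraMap (B ⧸ nilradical B) S) := by
    rw [injective_iff_map_eq_zero]
    intro x hx
    obtain ⟨x, rfl⟩ := Ideal.Quotient.mk_surjective x
    rw [Ideal.Quotient.eq_zero_iff_mem, ← hker]
    exact hx
  -- Numerators and denominators of fractions over `S` can be moved into `B`, so both rings have the
  -- same total ring of fractions; there `S` is the integral closure of the reduction of `B`.
  have : IsFractionRing (B ⧸ nilradical B) (FractionRing S) := by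
    constructor
    refine ⟨?_, ?_, ?_⟩
    · rintro ⟨b, hb⟩
      obtain ⟨b, rfl⟩ := Ideal.Quotient.mk_surjective b
      exact IsLocalization.map_units (FractionRing S) (⟨_, hnz b hb⟩ : S⁰)
    · intro z
      obtain ⟨⟨s, t, ht⟩, h⟩ := IsLocalization.surj S⁰ z
      obtain ⟨b, hb, r, hr⟩ := hfrac s
      obtain ⟨b', hb', r', hr'⟩ := hfrac t
      simp only at h
      have ht' : algebraMap B S (b * r') ∈ S⁰ := by
        rw [map_mul, ← hr']
        exact mul_mem (hnz b hb) (mul_mem (hnz b' hb') ht)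
      refine ⟨⟨Ideal.Quotient.mk _ (b' * r), ⟨Ideal.Quotient.mk _ (b * r'), ?_⟩⟩, ?_⟩
      · rw [mem_nonZeroDivisors_iff_right]
        intro x hx
        apply hinj
        have h1 := congrArg (algebraMap (B ⧸ nilradical B) S) hx
        rw [map_mul, map_zero] at h1
        rw [map_zero]
        exact (mul_right_mem_nonZeroDivisors_eq_zero_iff ht').1 h1
      · change z * algebraMap S (FractionRing S) (algebraMap B S (b * r')) =
          algebraMap S (FractionRing S) (algebraMap B S (b' * r))
        rw [map_mul (algebraMap B S), map_mul (algebraMap B S), ← hr, ← hr']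
        have : z * algebraMap S (FractionRing S) (algebraMap B S b * (algebraMap B S b' * t)) =
          algebraMap S (FractionRing S) (algebraMap B S b * algebraMap B S b') *
            (z * algebraMap S (FractionRing S) t) := by
          simp only [map_mul]; ring
        rw [this, h, ← map_mul]
        congr 1
        ring
    · intro x y h
      exact ⟨1, by rw [hinj (IsFractionRing.injective S (FractionRing S) h)]⟩
  have : IsIntegralClosure S (B ⧸ nilradical B) (FractionRing S) := by
    have : Algebra.IsIntegral (B ⧸ nilradical B) S := Algebra.IsIntegral.tower_top B
    refine ⟨IsFractionRing.injective S _, fun {x} => ⟨fun hx => ?_, ?_⟩⟩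
    · exact IsIntegrallyClosed.algebraMap_eq_of_integral hx.tower_top
    · rintro ⟨y, rfl⟩
      exact (Algebra.IsIntegral.isIntegral y).map
        (IsScalarTower.toAlgHom (B ⧸ nilradical B) S (FractionRing S))
  let e0 : FractionRing (B ⧸ nilradical B) ≃ₐ[B ⧸ nilradical B] FractionRing S :=
    IsLocalization.algEquiv (B ⧸ nilradical B)⁰ _ _
  let e1 := e0.mapIntegralClosure
  let e2 : integralClosure (B ⧸ nilradical B) (FractionRing S) ≃ₐ[B ⧸ nilradical B] S :=
    IsIntegralClosure.equiv (B ⧸ nilradical B) _ (FractionRing S) S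
  exact ⟨(e1.trans e2).restrictScalars B⟩

lemma IsNormalization.isNormalRing {B : Type u} {S : Type v} [CommRing B] [CommRing S]
    [Algebra B S] [IsNoetherianRing B] (h : IsNormalization B S) : IsNormalRing S := by
  obtain ⟨e⟩ := h.nonempty_algEquiv
  exact (isNormalRing_normalization B).of_ringEquiv e.toRingEquiv

/-- An idempotent of the normalization cutting out a union of irreducible components. -/
lemma IsNormalization.exists_idempotent {R : Type u} {N : Type v} [CommRing R] [CommRing N]
    [Algebra R N] [IsNoetherianRing R] (hN : IsNormalization R N) {I : Ideal R} (hI : I.IsRadical)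
    (hnz : ∀ d ∈ redRegular R, Ideal.Quotient.mk I d ∈ (R ⧸ I)⁰) :
    ∃ ε : N, ε * ε = ε ∧ (∀ x, algebraMap R N x ∈ Ideal.span {ε} ↔ x ∈ I) ∧
      ∀ β, Ideal.Quotient.mk I β ∈ (R ⧸ I)⁰ → ∀ y, y * algebraMap R N β ∈
        Ideal.span {ε} → y ∈ Ideal.span {ε} := by
  have hred := isReduced_quotient_nilradical R
  have hNred : IsReduced N := hN.isNormalRing.isReduced
  have hnilI : nilradical R ≤ I := by
    rw [nilradical, hI.radical_le_iff]; exact bot_le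
  obtain ⟨u', hu', v', hv', huv'⟩ :=
    exists_add_mem_nonZeroDivisors (I.map (Ideal.Quotient.mk (nilradical R)))
  obtain ⟨u, hu, rfl⟩ := (Ideal.mem_map_iff_of_surjective _ Ideal.Quotient.mk_surjective).1 hu'
  obtain ⟨v, rfl⟩ := Ideal.Quotient.mk_surjective v'
  have hv : ∀ x ∈ I, x * v ∈ nilradical R := fun x hx => by
    rw [← Ideal.Quotient.eq_zero_iff_mem, map_mul]
    exact hv' _ (Ideal.mem_map_of_mem _ hx)
  rw [← map_add] at huv'
  have huv' : u + v ∈ redRegular R := huv'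
  have hw := hN.algebraMap_mem _ huv'
  set f := algebraMap R N with hf
  have hfuv : f u * f v = 0 := by
    rw [← map_mul, hf, hN.algebraMap_eq_zero_iff]; exact hv u hu
  -- The idempotent is `u / (u + v)`: here `u ∈ I`, while `v` kills `I` up to nilpotents, so `u * v
  -- = 0` in `N`. It is integral, hence in `N`; it is `0` over the components in `V(I)` and `1` over
  -- the others.
  obtain ⟨ε, hε⟩ : ∃ ε : N, f (u + v) * ε = f u := by
    have := hN.isIntegrallyClosed
    set Q := FractionRing N
    set e : Q := IsLocalization.mk' Q (f u) (⟨_, hw⟩ : N⁰) with he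
    have hwu : IsUnit (algebraMap N Q (f (u + v))) := IsLocalization.map_units Q (⟨_, hw⟩ : N⁰)
    have hew : algebraMap N Q (f (u + v)) * e = algebraMap N Q (f u) :=
      IsLocalization.mk'_spec'_mk Q (f u) _ hw
    have hee : e * e = e := by
      apply hwu.mul_left_cancel
      apply hwu.mul_left_cancel
      have h1 : algebraMap N Q (f u) * algebraMap N Q (f v) = 0 := by rw [← map_mul, hfuv, map_zero]
      rw [show algebraMap N Q (f (u + v)) * (algebraMap N Q (f (u + v)) * (e * e)) =
        (algebraMap N Q (f (u + v)) * e) * (algebraMap N Q (f (u + v)) * e) by ring, hew, map_add,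
        map_add]
      linear_combination -h1
    have hint : IsIntegral N e :=
      ⟨Polynomial.X ^ 2 - Polynomial.X, by monicity!, by simp [sq, hee]⟩
    obtain ⟨ε, hε⟩ := IsIntegrallyClosed.algebraMap_eq_of_integral hint
    refine ⟨ε, IsFractionRing.injective N Q ?_⟩
    rw [map_mul, hε, hew]
  have hcancel : ∀ y, f (u + v) * y = 0 → y = 0 := fun y hy =>
    (mul_left_mem_nonZeroDivisors_eq_zero_iff hw).1 hy
  have hεε : ε * ε = ε := by
    rw [← sub_eq_zero]
    apply hcancel
    apply hcancel
    rw [show f (u + v) * (f (u + v) * (ε * ε - ε)) = (f (u + v) * ε) * (f (u + v) * ε)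
      - f (u + v) * (f (u + v) * ε) by ring, hε, map_add]
    linear_combination - hfuv
  have hmem : ∀ y : N, y ∈ Ideal.span {ε} ↔ y * f v = 0 := by
    intro y
    have hev : f (u + v) * (1 - ε) = f v := by
      rw [mul_sub, hε, map_add]; ring
    rw [Ideal.mem_span_singleton', ← hev]
    constructor
    · rintro ⟨c, rfl⟩
      linear_combination -c * f (u + v) * hεε
    · intro h
      rw [mul_left_comm] at h
      exact ⟨y, by linear_combination - hcancel _ h⟩
  refine ⟨ε, hεε, fun x => ?_, fun β hβ y hy => ?_⟩
  · rw [hmem, ← map_mul, hf, hN.algebraMap_eq_zero_iff]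
    refine ⟨fun h => ?_, hv x⟩
    rw [← Ideal.Quotient.eq_zero_iff_mem]
    refine (mul_right_mem_nonZeroDivisors_eq_zero_iff (hnz _ huv')).1 ?_
    rw [← map_mul, Ideal.Quotient.eq_zero_iff_mem, mul_add]
    exact add_mem (Ideal.mul_mem_left _ _ hu) (hnilI h)
  · obtain ⟨d, hd, a, h⟩ := hN.exists_mul_eq y
    rw [hmem] at hy ⊢
    have h1 : a * v * β ∈ nilradical R := by
      rw [← hN.algebraMap_eq_zero_iff, map_mul, map_mul, ← h]
      linear_combination algebraMap R N d * hy
    have h2 : a * v ∈ I := by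
      rw [← Ideal.Quotient.eq_zero_iff_mem]
      refine (mul_right_mem_nonZeroDivisors_eq_zero_iff hβ).1 ?_
      rw [← map_mul, Ideal.Quotient.eq_zero_iff_mem]
      exact hnilI h1
    have h3 : (f a * f v) = 0 := by
      refine IsReduced.eq_zero _ ⟨2, ?_⟩
      have h4 := (hN.algebraMap_eq_zero_iff _).2 (hv _ h2)
      rw [map_mul, map_mul] at h4
      linear_combination f a * h4
    rw [← h] at h3
    refine (mul_left_mem_nonZeroDivisors_eq_zero_iff (hN.algebraMap_mem _ hd)).1 ?_
    linear_combination h3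

/-- Passing to a union of irreducible components, the normalization is divided by an
idempotent. -/
lemma IsNormalization.exists_quotient_algHom {R : Type u} {N : Type v} {N' : Type w} [CommRing R]
    [IsNoetherianRing R] [CommRing N] [Algebra R N] [CommRing N'] {I : Ideal R} [Algebra R N']
    [Algebra (R ⧸ I) N'] [IsScalarTower R (R ⧸ I) N']
    (hN : IsNormalization R N) (hN' : IsNormalization (R ⧸ I) N') (hI : I.IsRadical)
    (hnz : ∀ d ∈ redRegular R, Ideal.Quotient.mk I d ∈ (R ⧸ I)⁰) :
    ∃ (ρ : N →ₐ[R] N') (e : N),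
      Function.Surjective ρ ∧ e * e = e ∧ RingHom.ker ρ = Ideal.span {e} := by
  obtain ⟨ε, hεε, hIε, hβ⟩ := hN.exists_idempotent hI hnz
  -- The quotient of `N` by `ε` is kept as an abstract ring `S`. It will turn out to be a
  -- normalization of `R ⧸ I`, so that uniqueness identifies it with `N'`.
  obtain ⟨S, _, _, π, hπ, hπε⟩ : ∃ (S : Type v) (_ : CommRing S) (_ : Algebra R S)
      (π : N →ₐ[R] S), Function.Surjective π ∧ RingHom.ker π = Ideal.span {ε} :=
    ⟨_, inferInstance, inferInstance, Ideal.Quotient.mkₐ R (Ideal.span {ε}),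
      Ideal.Quotient.mk_surjective, Ideal.Quotient.mkₐ_ker R (Ideal.span {ε})⟩
  have hπ0 : ∀ y, π y = 0 ↔ y ∈ Ideal.span {ε} := fun y => by rw [← hπε, RingHom.mem_ker]
  let lft : R ⧸ I →+* S := Ideal.Quotient.lift I (algebraMap R S) fun x hx => by
    rw [← π.commutes, hπ0, hIε]
    exact hx
  let : Algebra (R ⧸ I) S := lft.toAlgebra
  have hlft : ∀ x, algebraMap (R ⧸ I) S (Ideal.Quotient.mk I x) =
    π (algebraMap R N x) := fun x => (π.commutes x).symm
  have : IsScalarTower R (R ⧸ I) S := .of_algebraMap_eq fun x => rfl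
  have : Algebra.IsIntegral R S :=
    have := hN.isIntegral
    Algebra.IsIntegral.of_surjective π hπ
  have : IsReduced (R ⧸ I) := (Ideal.isRadical_iff_quotient_reduced I).1 hI
  have hS : IsNormalization (R ⧸ I) S := by
    refine ⟨Algebra.IsIntegral.tower_top R, IsNormalRing.isIntegrallyClosed
      (hN.isNormalRing.of_surjective π.toRingHom hπ hεε hπε), fun x => ?_,
      fun b hb => ?_, fun s => ?_⟩
    · obtain ⟨x, rfl⟩ := Ideal.Quotient.mk_surjective x
      rw [nilradical_eq_zero, Ideal.zero_eq_bot, Ideal.mem_bot, Ideal.Quotient.eq_zero_iff_mem,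
        hlft, hπ0, hIε]
    · rw [mem_redRegular_iff_of_isReduced] at hb
      obtain ⟨β, rfl⟩ := Ideal.Quotient.mk_surjective b
      rw [mem_nonZeroDivisors_iff_right]
      intro s hs
      obtain ⟨y, rfl⟩ := hπ s
      rw [hlft, ← map_mul, hπ0] at hs
      rw [hπ0]
      exact hβ β hb y hs
    · obtain ⟨y, rfl⟩ := hπ s
      obtain ⟨d, hd, a, h⟩ := hN.exists_mul_eq y
      refine ⟨Ideal.Quotient.mk I d, mem_redRegular_iff_of_isReduced.2 (hnz d hd),
        Ideal.Quotient.mk I a, ?_⟩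
      rw [hlft, hlft, ← map_mul, h]
  obtain ⟨φ⟩ := hS.nonempty_algEquiv
  obtain ⟨ψ⟩ := hN'.nonempty_algEquiv
  let φ' : S ≃ₐ[R] N' := (φ.symm.trans ψ).restrictScalars R
  refine ⟨(φ' : S →ₐ[R] N').comp π, ε, φ'.surjective.comp hπ, hεε, ?_⟩
  rw [← hπε]
  ext y
  rw [RingHom.mem_ker, RingHom.mem_ker]
  exact φ'.map_eq_zero_iff

end Normalization

/-! ### Finite-dimensional modules as sums of their localizations -/

section LocalSum

/-- Additivity of dimension along a short exact sequence, with finiteness. -/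
lemma finite_and_finrank_of_exact {k : Type*} [Field k] {V₁ V₂ V₃ : Type*} [AddCommGroup V₁]
    [AddCommGroup V₂] [AddCommGroup V₃] [Module k V₁] [Module k V₂] [Module k V₃]
    {f : V₁ →ₗ[k] V₂} {g : V₂ →ₗ[k] V₃} (hf : Function.Injective f) (hfg : Function.Exact f g)
    (hg : Function.Surjective g) [Module.Finite k V₁] [Module.Finite k V₃] :
    Module.Finite k V₂ ∧ Module.finrank k V₂ = Module.finrank k V₁ + Module.finrank k V₃ := by
  have hfin : Module.Finite k V₂ := by
    have h1 : (LinearMap.ker g).FG := by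
      rw [LinearMap.exact_iff.1 hfg]
      exact Module.Finite.iff_fg.1 (inferInstance : Module.Finite k (LinearMap.range f))
    refine ⟨Submodule.fg_of_fg_map_of_fg_inf_ker g ?_ ?_⟩
    · rw [Submodule.map_top, LinearMap.range_eq_top.2 hg]
      exact Module.Finite.fg_top
    · simpa using h1
  refine ⟨hfin, ?_⟩
  rw [← LinearMap.finrank_range_add_finrank_ker g, LinearMap.exact_iff.1 hfg,
    LinearMap.finrank_range_of_inj hf, LinearMap.range_eq_top.2 hg, finrank_top, add_comm]

variable (k : Type u) {B : Type v} [Field k] [CommRing B] [Algebra k B]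

/-- The statement that a finite-dimensional module is the direct sum of its localizations, on the
level of dimensions. -/
structure LocalSum (M : Type w) [AddCommGroup M] [Module k M] [Module B M] [IsScalarTower k B M] :
    Prop where
  finite : ∀ m : MaximalSpectrum B, Module.Finite k (Localization.AtPrime m.asIdeal ⊗[B] M)
  finite_support : {m : MaximalSpectrum B |
    ¬ Subsingleton (Localization.AtPrime m.asIdeal ⊗[B] M)}.Finite
  finsum_eq : ∑ᶠ m : MaximalSpectrum B,
    Module.finrank k (Localization.AtPrime m.asIdeal ⊗[B] M) = Module.finrank k M

variable {k}

/-- Localizations are flat, so the local dimensions are additive along the sequence, as is the total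
dimension. -/
lemma LocalSum.of_exact {M₁ M₂ M₃ : Type w} [AddCommGroup M₁] [AddCommGroup M₂] [AddCommGroup M₃]
    [Module k M₁] [Module k M₂] [Module k M₃] [Module B M₁] [Module B M₂] [Module B M₃]
    [IsScalarTower k B M₁] [IsScalarTower k B M₂] [IsScalarTower k B M₃]
    [Module.Finite k M₁] [Module.Finite k M₃]
    {f : M₁ →ₗ[B] M₂} {g : M₂ →ₗ[B] M₃} (hf : Function.Injective f) (hfg : Function.Exact f g)
    (hg : Function.Surjective g) (h₁ : LocalSum k (B := B) M₁) (h₃ : LocalSum k (B := B) M₃) :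
    LocalSum k (B := B) M₂ := by
  have key : ∀ m : MaximalSpectrum B,
      Module.Finite k (Localization.AtPrime m.asIdeal ⊗[B] M₂) ∧
      Module.finrank k (Localization.AtPrime m.asIdeal ⊗[B] M₂) =
        Module.finrank k (Localization.AtPrime m.asIdeal ⊗[B] M₁) +
        Module.finrank k (Localization.AtPrime m.asIdeal ⊗[B] M₃) := by
    intro m
    have := h₁.finite m
    have := h₃.finite m
    exact finite_and_finrank_of_exact
      (f := (f.baseChange (Localization.AtPrime m.asIdeal)).restrictScalars k)
      (g := (g.baseChange (Localization.AtPrime m.asIdeal)).restrictScalars k)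
      (Module.Flat.lTensor_preserves_injective_linearMap f hf)
      (Module.Flat.lTensor_exact _ hfg) (LinearMap.lTensor_surjective _ hg)
  have hs : ∀ (m : MaximalSpectrum B) {M : Type w} [AddCommGroup M] [Module k M] [Module B M]
      [IsScalarTower k B M], LocalSum k (B := B) M →
      Module.finrank k (Localization.AtPrime m.asIdeal ⊗[B] M) ≠ 0 →
      ¬ Subsingleton (Localization.AtPrime m.asIdeal ⊗[B] M) := by
    intro m M _ _ _ _ hM h h'
    exact h (Module.finrank_zero_of_subsingleton)
  refine ⟨fun m => (key m).1, ?_, ?_⟩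
  · refine (h₁.finite_support.union h₃.finite_support).subset fun m hm => ?_
    by_contra h
    simp only [Set.mem_union, Set.mem_ofPred_eq, not_or, not_not] at h
    have := h.1
    have := h.2
    have := (key m).1
    refine hm (Module.finrank_zero_iff (R := k).1 ?_)
    rw [(key m).2, Module.finrank_zero_of_subsingleton, Module.finrank_zero_of_subsingleton]
  · rw [finsum_congr fun m => (key m).2, finsum_add_distrib, h₁.finsum_eq, h₃.finsum_eq]
    · exact (finite_and_finrank_of_exact (f := f.restrictScalars k) (g := g.restrictScalars k)
        hf hfg hg).2.symm
    · exact h₁.finite_support.subset fun m hm => hs m h₁ hm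
    · exact h₃.finite_support.subset fun m hm => hs m h₃ hm

/-- A simple module is `B ⧸ m₀`. Away from `m₀` some element of `m₀` becomes invertible and kills
it; at `m₀` all denominators already act invertibly. -/
lemma LocalSum.of_simple {M : Type w} [AddCommGroup M]
    [Module k M] [Module B M] [IsScalarTower k B M] [IsSimpleModule B M] [Module.Finite k M] :
    LocalSum k (B := B) M := by
  obtain ⟨m₀, hm₀, ⟨e⟩⟩ := isSimpleModule_iff_quot_maximal.1 (inferInstance : IsSimpleModule B M)
  have hm₀M : ∀ a ∈ m₀, ∀ x : M, a • x = 0 := fun a ha x => by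
    apply e.injective
    rw [map_smul, map_zero]
    obtain ⟨y, hy⟩ := Ideal.Quotient.mk_surjective (e x)
    rw [← hy, Algebra.smul_def, Ideal.Quotient.algebraMap_eq, ← map_mul,
      Ideal.Quotient.eq_zero_iff_mem]
    exact Ideal.mul_mem_right _ _ ha
  have hsub : ∀ m : MaximalSpectrum B, m ≠ ⟨m₀, hm₀⟩ →
      Subsingleton (Localization.AtPrime m.asIdeal ⊗[B] M) := by
    intro m hm
    rw [IsLocalizedModule.subsingleton_iff m.asIdeal.primeCompl
      (TensorProduct.mk B (Localization.AtPrime m.asIdeal) M 1)]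
    obtain ⟨a, ha, ham⟩ : ∃ a ∈ m₀, a ∉ m.asIdeal := by
      by_contra! h
      exact hm (MaximalSpectrum.ext (hm₀.eq_of_le m.isMaximal.ne_top h).symm)
    exact fun x => ⟨a, ham, hm₀M a ha x⟩
  have hbij : ∀ m : MaximalSpectrum B, m = ⟨m₀, hm₀⟩ → Function.Bijective
      ((TensorProduct.mk B (Localization.AtPrime m.asIdeal) M 1).restrictScalars k) := by
    rintro _ rfl
    have hinv : ∀ s ∉ m₀, ∃ t, ∀ x : M, (t * s) • x = x := by
      intro s hs
      obtain ⟨t, i, hi, h⟩ := hm₀.exists_inv hs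
      refine ⟨t, fun x => ?_⟩
      have := congrArg (· • x) h
      simpa [add_smul, hm₀M i hi] using this
    constructor
    · rw [injective_iff_map_eq_zero]
      intro x hx
      obtain ⟨⟨s, hs⟩, h⟩ := (IsLocalizedModule.eq_zero_iff m₀.primeCompl
        (TensorProduct.mk B (Localization.AtPrime m₀) M 1)).1 hx
      obtain ⟨t, ht⟩ := hinv s hs
      rw [← ht x, mul_smul]
      exact (congrArg (t • ·) h).trans (smul_zero t)
    · intro y
      obtain ⟨⟨x, ⟨s, hs⟩⟩, h⟩ := IsLocalizedModule.surj m₀.primeCompl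
        (TensorProduct.mk B (Localization.AtPrime m₀) M 1) y
      obtain ⟨t, ht⟩ := hinv s hs
      refine ⟨t • x, IsLocalizedModule.smul_injective
        (TensorProduct.mk B (Localization.AtPrime m₀) M 1) (⟨s, hs⟩ : m₀.primeCompl) ?_⟩
      simp only at h ⊢
      rw [h, Submonoid.mk_smul]
      change s • (TensorProduct.mk B (Localization.AtPrime m₀) M 1) (t • x) = _
      rw [← map_smul, smul_smul, mul_comm, ht]
  refine ⟨fun m => ?_, ?_, ?_⟩
  · by_cases hm : m = ⟨m₀, hm₀⟩
    · exact Module.Finite.of_surjective _ (hbij m hm).2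
    · have := hsub m hm
      infer_instance
  · exact (Set.finite_singleton (⟨m₀, hm₀⟩ : MaximalSpectrum B)).subset fun m hm => by
      by_contra h
      exact hm (hsub m h)
  · rw [finsum_eq_single _ (⟨m₀, hm₀⟩ : MaximalSpectrum B)]
    · exact (LinearEquiv.ofBijective _ (hbij _ rfl)).finrank_eq.symm
    · intro m hm
      have := hsub m hm
      exact Module.finrank_zero_of_subsingleton

/-- Induction on the dimension, splitting off a simple submodule, which exists because a
finite-dimensional module is Artinian. -/
lemma localSum_of_finite {M : Type w} [AddCommGroup M]
    [Module k M] [Module B M] [IsScalarTower k B M] [Module.Finite k M] :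
    LocalSum k (B := B) M := by
  induction h : Module.finrank k M using Nat.strong_induction_on generalizing M with
  | _ n ih =>
  by_cases hM : Subsingleton M
  · refine ⟨fun m => inferInstance, ?_, ?_⟩
    · convert Set.finite_empty
      ext m
      simp only [Set.mem_ofPred_eq, Set.mem_empty_iff_false, iff_false, not_not]
      infer_instance
    · rw [Module.finrank_zero_of_subsingleton, ← finsum_zero (α := MaximalSpectrum B)]
      exact finsum_congr fun m => Module.finrank_zero_of_subsingleton
  · have := not_subsingleton_iff_nontrivial.1 hM
    have : IsArtinian B M := isArtinian_of_tower k inferInstance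
    obtain ⟨S, hS⟩ := IsAtomic.exists_atom (Submodule B M)
    have := isSimpleModule_iff_isAtom.2 hS
    have h1 : Module.Finite k S :=
      Module.Finite.of_injective (S.subtype.restrictScalars k) S.subtype_injective
    have h2 : Module.Finite k (M ⧸ S) :=
      Module.Finite.of_surjective (S.mkQ.restrictScalars k) S.mkQ_surjective
    refine LocalSum.of_exact (f := S.subtype) (g := S.mkQ) S.subtype_injective
      (LinearMap.exact_subtype_mkQ S) S.mkQ_surjective LocalSum.of_simple (ih _ ?_ rfl)
    have h3 := (finite_and_finrank_of_exact (f := S.subtype.restrictScalars k)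
      (g := S.mkQ.restrictScalars k) S.subtype_injective
      (LinearMap.exact_subtype_mkQ S) S.mkQ_surjective).2
    have : Nontrivial S := IsSimpleModule.nontrivial B S
    have : 0 < Module.finrank k S := Module.finrank_pos
    omega

end LocalSum

/-! ### The local delta invariant through a finite modification -/

section LocalDelta

open IsLocalRing

/-- A finite-dimensional module over a local algebra is killed by a power of the maximal ideal. -/
lemma exists_pow_maximalIdeal_smul_eq_zero (k : Type*) {O M : Type*} [Field k] [CommRing O]
    [IsLocalRing O] [Algebra k O] [AddCommGroup M] [Module k M] [Module O M] [IsScalarTower k O M]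
    [Module.Finite k M] [IsNoetherianRing O] : ∃ n, ∀ a ∈ maximalIdeal O ^ n,
    ∀ x : M, a • x = 0 := by
  have : IsArtinian O M := isArtinian_of_tower k inferInstance
  have : Module.Finite O M := Module.Finite.of_restrictScalars_finite k O M
  obtain ⟨n, hn⟩ := IsArtinian.monotone_stabilizes
    (R := O) (M := M) ⟨fun n => OrderDual.toDual (maximalIdeal O ^ n • ⊤ : Submodule O M),
      fun a b hab => Submodule.smul_mono_left (Ideal.pow_le_pow_right hab)⟩
  have h1 : (maximalIdeal O ^ n • ⊤ : Submodule O M) = maximalIdeal O ^ (n + 1) • ⊤ :=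
    hn (n + 1) (Nat.le_succ n)
  have h2 : (maximalIdeal O ^ n • ⊤ : Submodule O M) = ⊥ := by
    refine Submodule.eq_bot_of_le_smul_of_le_jacobson_bot (maximalIdeal O) _
      (IsNoetherian.noetherian _) ?_ (maximalIdeal_le_jacobson _)
    rw [← Submodule.mul_smul, ← pow_succ']
    exact h1.le
  refine ⟨n, fun a ha x => ?_⟩
  have h3 := Submodule.smul_mem_smul ha (Submodule.mem_top (x := x))
  rwa [h2, Submodule.mem_bot] at h3

/-- If no nonzero element is killed by an ideal, then none is killed by a power of it. -/
lemma eq_zero_of_pow_smul_eq_zero {O M : Type*} [CommRing O] [AddCommGroup M] [Module O M]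
    {m : Ideal O} (h : ∀ y : M, (∀ a ∈ m, a • y = 0) → y = 0) (n : ℕ) :
    ∀ y : M, (∀ a ∈ m ^ n, a • y = 0) → y = 0 := by
  induction n with
  | zero => exact fun y hy => by simpa using hy 1 (by simp)
  | succ n ih =>
    intro y hy
    refine ih y fun a ha => h _ fun b hb => ?_
    rw [smul_smul]
    exact hy _ (by rw [pow_succ']; exact Ideal.mul_mem_mul hb ha)

/-- If the maximal ideal is nilpotent, it is the nilradical. The reduction is then a field, where
the denominators are already invertible. This treats the isolated points. -/
lemma subsingleton_normalizationCoker_of_isNilpotent {O : Type v} [CommRing O] [IsLocalRing O]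
    {n : ℕ} (hn : maximalIdeal O ^ n = ⊥) :
    Subsingleton (NormalizationCoker O) := by
  have hnil : nilradical O = maximalIdeal O := by
    refine le_antisymm (le_maximalIdeal ?_) fun x hx => ⟨n, ?_⟩
    · intro h
      have : IsNilpotent (1 : O) := by rw [← mem_nilradical, h]; trivial
      exact not_isNilpotent_one this
    · rw [Ideal.zero_eq_bot, ← hn]
      exact Ideal.pow_mem_pow hx n
  refine Submodule.Quotient.subsingleton_iff.2 (LinearMap.range_eq_top.2 fun y => ?_)
  have hN := isNormalization_normalization O
  obtain ⟨b, hb, r, h⟩ := hN.exists_mul_eq y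
  have hbu : IsUnit b := by
    by_contra hbu
    have hb' : b ∈ nilradical O := by rw [hnil]; exact (mem_maximalIdeal b).2 hbu
    have := mem_redRegular_iff.1 hb 1 (by simpa using hb')
    rw [hnil] at this
    exact (maximalIdeal.isMaximal O).ne_top ((Ideal.eq_top_iff_one _).2 this)
  obtain ⟨b', hb'⟩ := hbu.exists_left_inv
  refine ⟨b' * r, ?_⟩
  rw [Algebra.linearMap_apply, map_mul, ← h, ← mul_assoc, ← map_mul, hb', map_one, one_mul]

/-- The local comparison: a finite modification by a normal ring of positive depth computes the
invariants in the definition of the local delta invariant. -/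
lemma local_comparison {k : Type*} {O : Type v} {D : Type w} [Field k] [CommRing O]
    [IsLocalRing O] [IsNoetherianRing O] [Algebra k O] [CommRing D] [Algebra O D] [Algebra k D]
    [IsScalarTower k O D] [Algebra.IsIntegral O D] [IsReduced D] [IsIntegrallyClosed D]
    (hsoc : ∀ y : D, (∀ a ∈ maximalIdeal O, a • y = 0) → y = 0)
    [Module.Finite k (LinearMap.ker (Algebra.linearMap O D))]
    [Module.Finite k (D ⧸ LinearMap.range (Algebra.linearMap O D))] :
    localCohomologyZero (maximalIdeal O) = LinearMap.ker (Algebra.linearMap O D) ∧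
    Nonempty (NormalizationCoker O ≃ₗ[O] D ⧸ LinearMap.range (Algebra.linearMap O D)) := by
  obtain ⟨n₁, hn₁⟩ := exists_pow_maximalIdeal_smul_eq_zero k (O := O)
    (M := LinearMap.ker (Algebra.linearMap O D))
  obtain ⟨n₂, hn₂⟩ := exists_pow_maximalIdeal_smul_eq_zero k (O := O)
    (M := D ⧸ LinearMap.range (Algebra.linearMap O D))
  have hsoc' := eq_zero_of_pow_smul_eq_zero hsoc
  -- The image in `D` of an element killed by a power of the maximal ideal is again killed by it,
  -- hence zero by the socle condition; the finite-dimensional kernel is itself killed by such a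
  -- power.
  have hker : localCohomologyZero (maximalIdeal O) = LinearMap.ker (Algebra.linearMap O D) := by
    refine le_antisymm ?_ ?_
    · rintro x ⟨n, hn⟩
      refine hsoc' n _ fun a ha => ?_
      rw [← map_smul, smul_eq_mul, hn a ha, map_zero]
    · intro x hx
      exact ⟨n₁, fun a ha => congrArg Subtype.val (hn₁ a ha ⟨x, hx⟩)⟩
  refine ⟨hker, ?_⟩
  have hcok : ∀ a ∈ maximalIdeal O ^ n₂, ∀ y : D, ∃ r, a • y = algebraMap O D r := by
    intro a ha y
    have h1 := hn₂ a ha (Submodule.Quotient.mk y)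
    rw [← Submodule.Quotient.mk_smul, Submodule.Quotient.mk_eq_zero] at h1
    obtain ⟨r, hr⟩ := h1
    exact ⟨r, hr.symm⟩
  -- At an isolated point the socle condition forces `D = 0`, and both cokernels vanish. At all
  -- other points `D` is the normalization of `O`.
  by_cases hnilp : ∃ n, maximalIdeal O ^ n = ⊥
  · obtain ⟨n, hn⟩ := hnilp
    have h1 := subsingleton_normalizationCoker_of_isNilpotent hn
    have : Subsingleton D := ⟨fun x y => by
      rw [hsoc' n x, hsoc' n y] <;>
      · intro a ha
        rw [hn, Ideal.mem_bot] at ha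
        rw [ha, zero_smul]⟩
    exact ⟨0, 0, fun _ => Subsingleton.elim _ _, fun _ => Subsingleton.elim _ _⟩
  have hpow : ∀ n, maximalIdeal O ^ n ≠ ⊥ := not_exists.1 hnilp
  have hkernil : ∀ x, algebraMap O D x = 0 ↔ x ∈ nilradical O := by
    refine fun x => ⟨fun hx => ?_, fun ⟨n, hn⟩ => ?_⟩
    · have hx : x ∈ localCohomologyZero (maximalIdeal O) := by rw [hker]; exact hx
      obtain ⟨n, hn⟩ := hx
      have hxm : x ∈ maximalIdeal O := by
        rw [mem_maximalIdeal]
        -- A unit killed by a power of the maximal ideal would make that power zero. So `x` is a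
        -- non-unit killed by such a power, and is nilpotent.
        intro hu
        refine hpow n ((Submodule.eq_bot_iff _).2 fun a ha => ?_)
        exact hu.mul_left_eq_zero.1 (hn a ha)
      refine ⟨n + 1, ?_⟩
      rw [pow_succ]
      exact hn _ (Ideal.pow_mem_pow hxm n)
    · refine IsReduced.eq_zero _ ⟨n, ?_⟩
      rw [← map_pow, hn, map_zero]
  have hN : IsNormalization O D := by
    refine ⟨inferInstance, inferInstance, hkernil, fun b hb => ?_, fun s => ?_⟩
    · rw [mem_nonZeroDivisors_iff_right]
      intro y hy
      refine hsoc' n₂ y fun a ha => ?_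
      obtain ⟨r, hr⟩ := hcok a ha y
      rw [hr, hkernil]
      refine mem_redRegular_iff.1 hb r ?_
      rw [← hkernil, map_mul, ← hr, smul_mul_assoc, hy, smul_zero]
    -- Denominators come from the maximal ideal: by the socle condition on `D` it has zero
    -- annihilator in the reduction, so it contains a regular element `c`, and `c ^ n₂` carries `D`
    -- into the image of `O`.
    · obtain ⟨c', hc', hcnz⟩ := exists_mem_nonZeroDivisors
        (J := (maximalIdeal O).map (Ideal.Quotient.mk (nilradical O))) (by
          intro z hz
          obtain ⟨z, rfl⟩ := Ideal.Quotient.mk_surjective z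
          rw [Ideal.Quotient.eq_zero_iff_mem, ← hkernil]
          refine hsoc _ fun a ha => ?_
          rw [Algebra.smul_def, ← map_mul, hkernil, ← Ideal.Quotient.eq_zero_iff_mem, map_mul]
          exact hz _ (Ideal.mem_map_of_mem _ ha))
      obtain ⟨c, hc, rfl⟩ := (Ideal.mem_map_iff_of_surjective _
        Ideal.Quotient.mk_surjective).1 hc'
      obtain ⟨r, hr⟩ := hcok (c ^ n₂) (Ideal.pow_mem_pow hc n₂) s
      exact ⟨c ^ n₂, pow_mem (S := redRegular O) hcnz n₂, r, by rw [← hr, Algebra.smul_def]⟩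
  obtain ⟨e⟩ := hN.nonempty_algEquiv
  refine ⟨Submodule.Quotient.equiv _ _ e.toLinearEquiv ?_⟩
  rw [LinearMap.range_eq_map, ← Submodule.map_comp, LinearMap.range_eq_map]
  congr 1
  ext
  simp

end LocalDelta

/-! ### The total delta invariant through a finite modification -/

section GlobalDelta

open IsLocalRing

variable {k : Type u} {B : Type v} {D : Type w} [Field k] [CommRing B] [Algebra k B]
  [CommRing D] [Algebra B D] [Algebra k D] [IsScalarTower k B D]

attribute [local instance] Algebra.TensorProduct.rightAlgebra

lemma IsNormalRing.tensor_localization (hD : IsNormalRing D) (M : Submonoid B) :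
    IsNormalRing (Localization M ⊗[B] D) :=
  hD.of_isLocalization (Algebra.algebraMapSubmonoid D M)

/-- The kernel and the cokernel of the structure map commute with localization. -/
lemma nonempty_localization_ker_coker_equiv (M : Submonoid B) :
    Nonempty (Localization M ⊗[B] LinearMap.ker (Algebra.linearMap B D) ≃ₗ[Localization M]
      LinearMap.ker (Algebra.linearMap (Localization M) (Localization M ⊗[B] D))) ∧
    Nonempty (Localization M ⊗[B] (D ⧸ LinearMap.range (Algebra.linearMap B D)) ≃ₗ[Localization M]
      (Localization M ⊗[B] D) ⧸
        LinearMap.range (Algebra.linearMap (Localization M) (Localization M ⊗[B] D))) := by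
  set φ := Algebra.linearMap B D
  set O := Localization M
  let r : O ⊗[B] B ≃ₗ[O] O := TensorProduct.AlgebraTensorModule.rid B O O
  have hj : Algebra.linearMap O (O ⊗[B] D) = φ.baseChange O ∘ₗ r.symm.toLinearMap := by
    ext
    simp [r, φ, Algebra.TensorProduct.one_def]
  have hi : Function.Injective ((LinearMap.ker φ).subtype.baseChange O) :=
    Module.Flat.lTensor_preserves_injective_linearMap _ (LinearMap.ker φ).subtype_injective
  have hex : Function.Exact ((LinearMap.ker φ).subtype.baseChange O) (φ.baseChange O) :=
    Module.Flat.lTensor_exact O (LinearMap.exact_subtype_ker_map φ)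
  have hex' : Function.Exact (φ.baseChange O) ((LinearMap.range φ).mkQ.baseChange O) :=
    Module.Flat.lTensor_exact O (LinearMap.exact_map_mkQ_range φ)
  have hp : Function.Surjective ((LinearMap.range φ).mkQ.baseChange O) :=
    LinearMap.lTensor_surjective _ (Submodule.mkQ_surjective _)
  refine ⟨⟨(LinearEquiv.ofInjective (r.toLinearMap ∘ₗ (LinearMap.ker φ).subtype.baseChange O)
      (r.injective.comp hi)).trans (LinearEquiv.ofEq _ _ ?_)⟩,
    ⟨(LinearMap.quotKerEquivOfSurjective _ hp).symm.trans (Submodule.quotEquivOfEq _ _ ?_)⟩⟩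
  · rw [hj]
    ext x
    rw [LinearMap.mem_ker, LinearMap.comp_apply, ← LinearMap.mem_ker, LinearMap.exact_iff.1 hex]
    constructor
    · rintro ⟨y, rfl⟩
      exact ⟨y, by simp⟩
    · rintro ⟨y, hy⟩
      refine ⟨y, ?_⟩
      exact r.symm.injective ((r.symm_apply_apply _).trans hy)
  · rw [LinearMap.exact_iff.1 hex', hj, LinearMap.range_comp_of_range_eq_top]
    exact LinearEquiv.range _

/-- A finite modification by a normal ring of positive depth computes the delta invariant. -/
theorem deltaFinite_and_delta_eq [IsNoetherianRing B] [Algebra.IsIntegral B D]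
    (hD : IsNormalRing D)
    (hsoc : ∀ m : Ideal B, m.IsMaximal → ∀ y : D, (∀ a ∈ m, a • y = 0) → y = 0)
    [Module.Finite k (LinearMap.ker (Algebra.linearMap B D))]
    [Module.Finite k (D ⧸ LinearMap.range (Algebra.linearMap B D))] :
    DeltaFinite k B ∧ delta k B = Module.finrank k (D ⧸ LinearMap.range (Algebra.linearMap B D)) -
      (Module.finrank k (LinearMap.ker (Algebra.linearMap B D)) : ℤ) := by
  have hS₁ := localSum_of_finite (k := k) (B := B) (M := LinearMap.ker (Algebra.linearMap B D))
  have hS₂ := localSum_of_finite (k := k) (B := B)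
    (M := D ⧸ LinearMap.range (Algebra.linearMap B D))
  have key : ∀ m : MaximalSpectrum B,
      Nonempty (localCohomologyZero (maximalIdeal (Localization.AtPrime m.asIdeal)) ≃ₗ[k]
        Localization.AtPrime m.asIdeal ⊗[B] LinearMap.ker (Algebra.linearMap B D)) ∧
      Nonempty (NormalizationCoker (Localization.AtPrime m.asIdeal) ≃ₗ[k]
        Localization.AtPrime m.asIdeal ⊗[B] (D ⧸ LinearMap.range (Algebra.linearMap B D))) := by
    classical
    intro m
    obtain ⟨⟨e₁⟩, ⟨e₂⟩⟩ := nonempty_localization_ker_coker_equiv (D := D) m.asIdeal.primeCompl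
    have hn := hD.tensor_localization m.asIdeal.primeCompl
    set O := Localization.AtPrime m.asIdeal
    have := hn.isReduced
    have := hn.isIntegrallyClosed
    have := hS₁.finite m
    have := hS₂.finite m
    have : Module.Finite k (LinearMap.ker (Algebra.linearMap O (O ⊗[B] D))) :=
      Module.Finite.equiv (e₁.restrictScalars k)
    have : Module.Finite k ((O ⊗[B] D) ⧸ LinearMap.range (Algebra.linearMap O (O ⊗[B] D))) :=
      Module.Finite.equiv (e₂.restrictScalars k)
    -- The socle condition localizes because the maximal ideal is finitely generated: the product of
    -- the denominators belonging to the generators serves for the whole ideal.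
    have hsocO : ∀ y : O ⊗[B] D, (∀ a ∈ maximalIdeal O, a • y = 0) → y = 0 := by
      intro y hy
      obtain ⟨⟨d, s⟩, hs⟩ := IsLocalizedModule.surj m.asIdeal.primeCompl
        (TensorProduct.mk B O D 1) y
      simp only at hs
      obtain ⟨t, ht⟩ : ∃ t : m.asIdeal.primeCompl, ∀ a ∈ m.asIdeal, a • ((t : B) • d) = 0 := by
        obtain ⟨F, hF⟩ := (IsNoetherian.noetherian m.asIdeal : m.asIdeal.FG)
        have h1 : ∀ a ∈ F, ∃ t : m.asIdeal.primeCompl, (t : B) • (a • d) = 0 := by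
          intro a ha
          have ham : a ∈ m.asIdeal := by rw [← hF]; exact Ideal.subset_span ha
          have h2 : TensorProduct.mk B O D 1 (a • d) = 0 := by
            rw [map_smul, ← hs, smul_comm, ← algebraMap_smul O a y, hy _
              ((IsLocalization.AtPrime.to_map_mem_maximal_iff O m.asIdeal a).2 ham), smul_zero]
          obtain ⟨t, ht⟩ := (IsLocalizedModule.eq_zero_iff m.asIdeal.primeCompl _).1 h2
          exact ⟨t, ht⟩
        choose! t ht using h1
        refine ⟨∏ a ∈ F, t a, fun a ha => ?_⟩
        rw [← hF] at ha
        induction ha using Submodule.span_induction with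
        | mem a ha =>
          rw [smul_smul, mul_comm, ← smul_smul]
          rw [← Finset.mul_prod_erase F t ha, mul_comm, Submonoid.coe_mul, mul_smul, ht a ha,
            smul_zero]
        | zero => rw [zero_smul]
        | add a b _ _ ha hb => rw [add_smul, ha, hb, add_zero]
        | smul c a _ ha => rw [smul_assoc, ha, smul_zero]
      have htd := hsoc m.asIdeal m.isMaximal _ ht
      have h3 : TensorProduct.mk B O D 1 d = 0 :=
        (IsLocalizedModule.eq_zero_iff m.asIdeal.primeCompl _).2 ⟨t, htd⟩
      rw [h3] at hs
      exact IsLocalizedModule.smul_injective (TensorProduct.mk B O D 1) s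
        (hs.trans (smul_zero s).symm)
    obtain ⟨h1, ⟨e₃⟩⟩ := local_comparison (k := k) (O := O) (D := O ⊗[B] D) hsocO
    rw [h1]
    exact ⟨⟨(e₁.restrictScalars k).symm⟩, ⟨(e₃.trans e₂.symm).restrictScalars k⟩⟩
  choose e₁ e₂ using key
  refine ⟨⟨fun m => ?_, ?_⟩, ?_⟩
  · obtain ⟨e₁⟩ := e₁ m
    obtain ⟨e₂⟩ := e₂ m
    have := hS₁.finite m
    have := hS₂.finite m
    exact ⟨Module.Finite.equiv e₂.symm, Module.Finite.equiv e₁.symm⟩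
  · refine (hS₁.finite_support.union hS₂.finite_support).subset fun m hm => ?_
    by_contra h
    simp only [Set.mem_union, Set.mem_ofPred_eq, not_or, not_not] at h
    obtain ⟨e₁⟩ := e₁ m
    obtain ⟨e₂⟩ := e₂ m
    exact hm ⟨e₂.toEquiv.subsingleton_congr.2 h.2, e₁.toEquiv.subsingleton_congr.2 h.1⟩
  · rw [← hS₁.finsum_eq, ← hS₂.finsum_eq, delta]
    have hcast : ∀ (f : MaximalSpectrum B → ℕ), f.HasFiniteSupport →
        ((∑ᶠ m, f m : ℕ) : ℤ) = ∑ᶠ m, (f m : ℤ) := fun f hf =>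
      AddMonoidHom.map_finsum (Nat.castAddMonoidHom ℤ) hf
    have hf₁ : (fun m : MaximalSpectrum B => Module.finrank k (Localization.AtPrime m.asIdeal ⊗[B]
        LinearMap.ker (Algebra.linearMap B D))).HasFiniteSupport :=
      hS₁.finite_support.subset fun m hm h => hm Module.finrank_zero_of_subsingleton
    have hf₂ : (fun m : MaximalSpectrum B => Module.finrank k (Localization.AtPrime m.asIdeal ⊗[B]
        (D ⧸ LinearMap.range (Algebra.linearMap B D)))).HasFiniteSupport :=
      hS₂.finite_support.subset fun m hm h => hm Module.finrank_zero_of_subsingleton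
    rw [hcast _ hf₁, hcast _ hf₂, ← finsum_sub_distrib]
    · refine finsum_congr fun m => ?_
      obtain ⟨e₁⟩ := e₁ m
      obtain ⟨e₂⟩ := e₂ m
      rw [localDelta, localEpsilon, e₁.finrank_eq, e₂.finrank_eq]
    · exact hf₂.subset fun m hm h => hm (by simp only [h, Nat.cast_zero])
    · exact hf₁.subset fun m hm h => hm (by simp only [h, Nat.cast_zero])

end GlobalDelta

/-! ### Invariance of the Euler characteristic under base change -/

section EulerCharacteristic

/-- Kernel and cokernel do not change under a pullback-pushout square. -/
lemma euler_of_bicartesian {k M N P F : Type*} [Field k] [AddCommGroup M] [AddCommGroup N]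
    [AddCommGroup P] [AddCommGroup F] [Module k M] [Module k N] [Module k P] [Module k F]
    [Module.Finite k P] [Module.Finite k F] (f : M →ₗ[k] N) (g : F →ₗ[k] N) (p : P →ₗ[k] M)
    (q : P →ₗ[k] F) (hinj : ∀ x, p x = 0 → q x = 0 → x = 0)
    (hex : ∀ m x, f m = g x ↔ ∃ y, p y = m ∧ q y = x) (hsurj : ∀ n, ∃ m x, n = f m - g x) :
    Module.Finite k (LinearMap.ker f) ∧ Module.Finite k (N ⧸ LinearMap.range f) ∧
    (Module.finrank k (N ⧸ LinearMap.range f) : ℤ) - Module.finrank k (LinearMap.ker f) =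
      Module.finrank k F - Module.finrank k P := by
  have hcomm : ∀ y, f (p y) = g (q y) := fun y => (hex _ _).2 ⟨y, rfl, rfl⟩
  let e₁ : LinearMap.ker q ≃ₗ[k] LinearMap.ker f :=
    LinearEquiv.ofBijective (p.restrict (p := LinearMap.ker q) (q := LinearMap.ker f) (by
      intro y hy
      rw [LinearMap.mem_ker] at hy ⊢
      rw [hcomm, hy, map_zero])) (by
      constructor
      · rw [injective_iff_map_eq_zero]
        rintro ⟨y, hy⟩ h
        exact Subtype.ext (hinj y (congrArg Subtype.val h) hy)
      · rintro ⟨m, hm⟩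
        obtain ⟨y, rfl, hy⟩ := (hex m 0).1 (by rw [map_zero]; exact hm)
        exact ⟨⟨y, hy⟩, rfl⟩)
  let e₂ : (F ⧸ LinearMap.range q) ≃ₗ[k] N ⧸ LinearMap.range f :=
    LinearEquiv.ofBijective (Submodule.mapQ _ _ g (by
      rintro _ ⟨y, rfl⟩
      exact ⟨p y, hcomm y⟩)) (by
      constructor
      · rw [injective_iff_map_eq_zero]
        intro x hx
        obtain ⟨x, rfl⟩ := Submodule.Quotient.mk_surjective _ x
        rw [Submodule.mapQ_apply, Submodule.Quotient.mk_eq_zero] at hx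
        obtain ⟨m, hm⟩ := hx
        obtain ⟨y, -, rfl⟩ := (hex m x).1 hm
        rw [Submodule.Quotient.mk_eq_zero]
        exact ⟨y, rfl⟩
      · intro n
        obtain ⟨n, rfl⟩ := Submodule.Quotient.mk_surjective _ n
        obtain ⟨m, x, rfl⟩ := hsurj n
        refine ⟨Submodule.Quotient.mk (-x), ?_⟩
        rw [Submodule.mapQ_apply, Submodule.Quotient.eq]
        exact ⟨-m, by rw [map_neg, map_neg]; abel⟩)
  refine ⟨Module.Finite.equiv e₁, Module.Finite.equiv e₂, ?_⟩
  rw [← e₁.finrank_eq, ← e₂.finrank_eq]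
  have h1 := LinearMap.finrank_range_add_finrank_ker q
  have h2 := Submodule.finrank_quotient_add_finrank (LinearMap.range q)
  omega

/-- The Euler characteristic of a map of torsion-free modules over a principal ideal domain, with
finite kernel and cokernel, is the same at all points. -/
theorem exists_euler_eq {A : Type u} {M N : Type v} [CommRing A] [IsDomain A]
    [IsPrincipalIdealRing A] [AddCommGroup M] [AddCommGroup N] [Module A M] [Module A N]
    [Module.Flat A M] [Module.Flat A N] (f : M →ₗ[A] N) [Module.Finite A (LinearMap.ker f)]
    [Module.Finite A (N ⧸ LinearMap.range f)] :
    ∃ c : ℤ, ∀ (k : Type w) [Field k] [Algebra A k],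
      Module.Finite k (LinearMap.ker (f.baseChange k)) ∧
      Module.Finite k ((k ⊗[A] N) ⧸ LinearMap.range (f.baseChange k)) ∧
      (Module.finrank k ((k ⊗[A] N) ⧸ LinearMap.range (f.baseChange k)) : ℤ) -
        Module.finrank k (LinearMap.ker (f.baseChange k)) = c := by
  obtain ⟨n, g₀, hg₀⟩ := Module.Finite.exists_fin' A (N ⧸ LinearMap.range f)
  obtain ⟨g, hg⟩ := Module.projective_lifting_property (LinearMap.range f).mkQ g₀
    (Submodule.mkQ_surjective _)
  -- The kernel of `h` is the pullback of `f` and the lift `g` of generators of the cokernel. As `h`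
  -- is surjective, the square is also a pushout.
  let h : M × (Fin n → A) →ₗ[A] N := f ∘ₗ LinearMap.fst A _ _ - g ∘ₗ LinearMap.snd A _ _
  have hh : Function.Surjective h := by
    intro y
    obtain ⟨x, hx⟩ := hg₀ ((LinearMap.range f).mkQ y)
    rw [← hg, LinearMap.comp_apply, Submodule.mkQ_apply, Submodule.mkQ_apply,
      Submodule.Quotient.eq] at hx
    obtain ⟨m, hm⟩ := hx
    exact ⟨(-m, -x), by simp [h, hm]⟩
  let P := LinearMap.ker h
  have hP : Module.Finite A P := by
    -- Projected to `A^n`, the module `P` has a finitely generated image, and the kernel of the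
    -- projection is a copy of `ker f`.
    refine Module.Finite.iff_fg.2 (Submodule.fg_of_fg_map_of_fg_inf_ker (LinearMap.snd A _ _) ?_ ?_)
    · exact IsNoetherian.noetherian _
    · have : P ⊓ LinearMap.ker (LinearMap.snd A M (Fin n → A)) =
          (LinearMap.ker f).map (LinearMap.inl A M (Fin n → A)) := by
        ext ⟨m, x⟩
        simp only [Submodule.mem_inf, LinearMap.mem_ker, LinearMap.snd_apply, Submodule.mem_map,
          LinearMap.inl_apply, Prod.mk.injEq, P, h, LinearMap.sub_apply, LinearMap.comp_apply,
          LinearMap.fst_apply]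
        constructor
        · rintro ⟨h1, rfl⟩
          exact ⟨m, by simpa using h1, rfl, rfl⟩
        · rintro ⟨m, h1, rfl, rfl⟩
          exact ⟨by simp [h1], rfl⟩
      rw [this]
      exact Submodule.FG.map _ (Module.Finite.iff_fg.1 inferInstance)
  have hPtf : Module.IsTorsionFree A P := inferInstance
  have hPfree : Module.Free A P := inferInstance
  have hexA : Function.Exact P.subtype h := LinearMap.exact_subtype_ker_map h
  refine ⟨(n : ℤ) - Module.finrank A P, fun k _ _ => ?_⟩
  -- Flatness of `N` keeps `0 → P → M × A^n → N → 0` exact after base change, so the square stays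
  -- bicartesian; the rank of the free module `P` does not depend on the field.
  have hinj := LinearMap.lTensor_injective_of_exact_of_flat h hh P.subtype P.subtype_injective
    hexA k
  have hex := lTensor_exact k hexA hh
  have hsur := LinearMap.lTensor_surjective k hh
  let e := TensorProduct.prodRight A k k M (Fin n → A)
  have he1 : LinearMap.fst k _ _ ∘ₗ e.toLinearMap =
      (LinearMap.fst A M (Fin n → A)).baseChange k := by
    apply TensorProduct.AlgebraTensorModule.ext
    intro x y
    simp [e]
  have he2 : LinearMap.snd k _ _ ∘ₗ e.toLinearMap =
      (LinearMap.snd A M (Fin n → A)).baseChange k := by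
    apply TensorProduct.AlgebraTensorModule.ext
    intro x y
    simp [e]
  have hp : ∀ y, ((LinearMap.fst A M (Fin n → A)) ∘ₗ P.subtype).baseChange k y =
      (e (P.subtype.baseChange k y)).1 := fun y => by
    rw [LinearMap.baseChange_comp, LinearMap.comp_apply, ← he1]; rfl
  have hq : ∀ y, ((LinearMap.snd A M (Fin n → A)) ∘ₗ P.subtype).baseChange k y =
      (e (P.subtype.baseChange k y)).2 := fun y => by
    rw [LinearMap.baseChange_comp, LinearMap.comp_apply, ← he2]; rfl
  have hz : ∀ z, h.baseChange k z = f.baseChange k (e z).1 - g.baseChange k (e z).2 := fun z => by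
    rw [LinearMap.baseChange_sub, LinearMap.baseChange_comp, LinearMap.baseChange_comp, ← he1,
      ← he2]
    rfl
  have := euler_of_bicartesian (f.baseChange k) (g.baseChange k)
    ((LinearMap.fst A _ _ ∘ₗ P.subtype).baseChange k)
    ((LinearMap.snd A _ _ ∘ₗ P.subtype).baseChange k) ?_ ?_ ?_
  · rwa [Module.finrank_baseChange, Module.finrank_baseChange, Module.finrank_fin_fun] at this
  · intro y h1 h2
    rw [hp] at h1
    rw [hq] at h2
    exact (map_eq_zero_iff (P.subtype.baseChange k) hinj).1 (e.map_eq_zero_iff.1 (Prod.ext h1 h2))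
  · intro m x
    obtain ⟨z, hmx⟩ := e.surjective (m, x)
    have h1 : f.baseChange k m = g.baseChange k x ↔ h.baseChange k z = 0 := by
      rw [hz, hmx, sub_eq_zero]
    rw [h1]
    refine (hex z).trans ⟨?_, ?_⟩
    · rintro ⟨y, hy⟩
      have hy : P.subtype.baseChange k y = z := hy
      exact ⟨y, by rw [hp, hy, hmx], by rw [hq, hy, hmx]⟩
    · rintro ⟨y, h2, h3⟩
      rw [hp] at h2
      rw [hq] at h3
      exact ⟨y, e.injective ((Prod.ext h2 h3).trans hmx.symm)⟩
  · intro y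
    obtain ⟨z, hy⟩ := hsur y
    exact ⟨(e z).1, (e z).2, by rw [← hz]; exact hy.symm⟩

end EulerCharacteristic

/-! ### Finite-dimensionality via the support, and conductors -/

section FiniteDimensional

variable {k : Type*} {B : Type u} [Field k] [CommRing B] [Algebra k B]

lemma finite_quotient_of_le {I J : Ideal B} (h : I ≤ J) [Module.Finite k (B ⧸ I)] :
    Module.Finite k (B ⧸ J) :=
  Module.Finite.of_surjective (Ideal.Quotient.factorₐ k h).toLinearMap
    (Ideal.Quotient.factor_surjective h)

/-- A closed subscheme all of whose points have finite residue rings is finite. -/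
lemma finite_quotient_of_forall_prime [IsNoetherianRing B] (I : Ideal B)
    (h : ∀ p : Ideal B, p.IsPrime → I ≤ p → Module.Finite k (B ⧸ p)) :
    Module.Finite k (B ⧸ I) := by
  revert h
  refine WellFoundedGT.induction (motive := fun I : Ideal B =>
    (∀ p : Ideal B, p.IsPrime → I ≤ p → Module.Finite k (B ⧸ p)) → Module.Finite k (B ⧸ I)) I ?_
  intro I ih h
  by_cases hI : I.IsPrime
  · exact h I hI le_rfl
  by_cases htop : I = ⊤
  · subst htop
    have : Subsingleton (B ⧸ (⊤ : Ideal B)) := Ideal.Quotient.subsingleton_iff.2 rfl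
    infer_instance
  obtain ⟨a, ha, b, hb, hab⟩ : ∃ a, a ∉ I ∧ ∃ b, b ∉ I ∧ a * b ∈ I := by
    by_contra! H
    exact hI ⟨htop, fun {a b} hab => by
      by_contra! H'
      exact H a H'.1 b H'.2 hab⟩
  let I₁ := I ⊔ Ideal.span {a}
  let I₂ : Ideal B := I.colon {a}
  have h₁ : I < I₁ := lt_of_le_of_ne le_sup_left fun h => ha (by
    rw [h]; exact Ideal.mem_sup_right (Ideal.mem_span_singleton_self a))
  have hI₂ : ∀ x, x ∈ I₂ ↔ a * x ∈ I := fun x => by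
    rw [Submodule.mem_colon_singleton, smul_eq_mul, mul_comm]
  have h₂ : I < I₂ := lt_of_le_of_ne (fun x hx => (hI₂ x).2 (I.mul_mem_left a hx)) fun h => hb (by
    rw [h, hI₂]; exact hab)
  have f₁ := ih I₁ h₁ fun p hp hle => h p hp (h₁.le.trans hle)
  have f₂ := ih I₂ h₂ fun p hp hle => h p hp (h₂.le.trans hle)
  -- Noetherian induction along `0 → B/(I : a) → B/I → B/(I + (a)) → 0`, whose outer ideals are
  -- strictly larger than `I` as `a, b ∉ I` and `a * b ∈ I`.
  let f : (B ⧸ I₂) →ₗ[B] B ⧸ I := Submodule.mapQ I₂ I (LinearMap.mulLeft B a) fun x hx =>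
    (hI₂ x).1 hx
  let g : (B ⧸ I) →ₗ[B] B ⧸ I₁ := Submodule.mapQ I I₁ LinearMap.id h₁.le
  refine (finite_and_finrank_of_exact (f := f.restrictScalars k) (g := g.restrictScalars k)
    ?_ ?_ ?_).1
  · rw [injective_iff_map_eq_zero]
    intro x hx
    obtain ⟨x, rfl⟩ := Submodule.Quotient.mk_surjective _ x
    rw [Submodule.Quotient.mk_eq_zero, hI₂]
    exact (Submodule.Quotient.mk_eq_zero _).1 hx
  · intro y
    obtain ⟨y, rfl⟩ := Submodule.Quotient.mk_surjective _ y
    change (Submodule.Quotient.mk y : B ⧸ I₁) = 0 ↔ _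
    rw [Submodule.Quotient.mk_eq_zero]
    constructor
    · intro hy
      obtain ⟨i, hi, _, hj, rfl⟩ := Submodule.mem_sup.1 hy
      obtain ⟨c, rfl⟩ := Ideal.mem_span_singleton'.1 hj
      refine ⟨Submodule.Quotient.mk c, ?_⟩
      change (Submodule.Quotient.mk (a * c) : B ⧸ I) = _
      rw [Submodule.Quotient.eq]
      convert I.neg_mem hi using 1
      ring
    · rintro ⟨c, hc⟩
      obtain ⟨c, rfl⟩ := Submodule.Quotient.mk_surjective _ c
      change (Submodule.Quotient.mk (a * c) : B ⧸ I) = _ at hc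
      rw [Submodule.Quotient.eq] at hc
      have : y = a * c - (a * c - y) := by ring
      rw [this]
      exact sub_mem (Ideal.mul_mem_right _ _ (Ideal.mem_sup_right
        (Ideal.mem_span_singleton_self a))) (Ideal.mem_sup_left hc)
  · intro y
    obtain ⟨y, rfl⟩ := Submodule.Quotient.mk_surjective _ y
    exact ⟨Submodule.Quotient.mk y, rfl⟩

lemma isMaximal_of_finite_quotient (p : Ideal B) [p.IsPrime] [Module.Finite k (B ⧸ p)] :
    p.IsMaximal := by
  have : Algebra.IsIntegral k (B ⧸ p) := inferInstance
  exact Ideal.Quotient.maximal_of_isField p (isField_of_isIntegral_of_isField' (Field.toIsField k))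

variable {M : Type v} [AddCommGroup M] [Module k M] [Module B M] [IsScalarTower k B M]

variable (k) in
/-- A finite module is finite-dimensional if all points of its support have finite residue
rings. -/
lemma finite_of_forall_prime [IsNoetherianRing B] [Module.Finite B M]
    (h : ∀ p : Ideal B, p.IsPrime → (∃ x : M, ∀ a, a • x = 0 → a ∈ p) → Module.Finite k (B ⧸ p)) :
    Module.Finite k M := by
  suffices H : ∀ N : Submodule B M, N.FG → (N.restrictScalars k).FG by
    exact ⟨H ⊤ Module.Finite.fg_top⟩
  intro N hN
  induction N, hN using Submodule.fg_induction with
  | singleton x =>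
    have h1 : Module.Finite k (B ⧸ LinearMap.ker (LinearMap.toSpanSingleton B M x)) :=
      finite_quotient_of_forall_prime _ fun p hp hle =>
        h p hp ⟨x, fun a ha => hle (by simpa using ha)⟩
    have e := (LinearMap.quotKerEquivRange (LinearMap.toSpanSingleton B M x)).restrictScalars k
    have h2 := Module.Finite.equiv e
    rw [LinearMap.range_toSpanSingleton] at h2
    exact Module.Finite.iff_fg.1 h2
  | sup N₁ N₂ _ _ h₁ h₂ => 
    have : (N₁ ⊔ N₂).restrictScalars k = N₁.restrictScalars k ⊔ N₂.restrictScalars k := by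
      ext x
      simp [Submodule.mem_sup]
    rw [this]
    exact h₁.sup h₂

variable (k B M) in
-- Modulo the annihilator, `B` embeds into the finite-dimensional algebra of `k`-linear
-- endomorphisms of `M`.
lemma finite_quotient_annihilator [Module.Finite k M] :
    Module.Finite k (B ⧸ Module.annihilator B M) := by
  let f : B →ₗ[k] Module.End k M := (Algebra.lsmul k k M).toLinearMap
  have hf : ∀ x, f x = 0 ↔ x ∈ Module.annihilator B M := fun x => by
    rw [Module.mem_annihilator]
    exact LinearMap.ext_iff
  have h1 : Module.Finite k (LinearMap.range f) := inferInstance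
  have e : (B ⧸ LinearMap.ker f) ≃ₗ[k] LinearMap.range f := f.quotKerEquivRange
  have h2 := Module.Finite.equiv e.symm
  let g : (B ⧸ LinearMap.ker f) →ₗ[k] B ⧸ Module.annihilator B M :=
    Submodule.liftQ _ (Ideal.Quotient.mkₐ k (Module.annihilator B M)).toLinearMap fun x hx =>
      Ideal.Quotient.eq_zero_iff_mem.2 ((hf x).1 hx)
  refine Module.Finite.of_surjective g fun y => ?_
  obtain ⟨y, rfl⟩ := Ideal.Quotient.mk_surjective y
  exact ⟨Submodule.Quotient.mk y, rfl⟩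

variable {E : Type v} [CommRing E] [Algebra B E] [Algebra k E] [IsScalarTower k B E]

variable (k B E) in
/-- If kernel and cokernel of `B → E` are finite-dimensional, an ideal of finite codimension
kills both. -/
lemma exists_conductor [Module.Finite k (LinearMap.ker (Algebra.linearMap B E))]
    [Module.Finite k (E ⧸ LinearMap.range (Algebra.linearMap B E))] :
    ∃ c : Ideal B, Module.Finite k (B ⧸ c) ∧
      (∀ s ∈ c, ∀ x, algebraMap B E x = 0 → s * x = 0) ∧
      ∀ s ∈ c, ∀ y : E, ∃ r, algebraMap B E s * y = algebraMap B E r := by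
  have h₁ := finite_quotient_annihilator k B (LinearMap.ker (Algebra.linearMap B E))
  have h₂ := finite_quotient_annihilator k B (E ⧸ LinearMap.range (Algebra.linearMap B E))
  set I := Module.annihilator B (LinearMap.ker (Algebra.linearMap B E))
  set J := Module.annihilator B (E ⧸ LinearMap.range (Algebra.linearMap B E))
  refine ⟨I ⊓ J, ?_, ?_, ?_⟩
  · let g : (B ⧸ (I ⊓ J)) →ₐ[k] (B ⧸ I) × (B ⧸ J) :=
      AlgHom.prod (Ideal.Quotient.factorₐ k inf_le_left) (Ideal.Quotient.factorₐ k inf_le_right)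
    refine Module.Finite.of_injective g.toLinearMap ((injective_iff_map_eq_zero g).2 fun x hx => ?_)
    obtain ⟨x, rfl⟩ := Ideal.Quotient.mk_surjective x
    rw [Ideal.Quotient.eq_zero_iff_mem]
    exact ⟨Ideal.Quotient.eq_zero_iff_mem.1 (congrArg Prod.fst hx),
      Ideal.Quotient.eq_zero_iff_mem.1 (congrArg Prod.snd hx)⟩
  · intro s hs x hx
    exact congrArg Subtype.val (Module.mem_annihilator.1 hs.1 ⟨x, hx⟩)
  · intro s hs y
    have := Module.mem_annihilator.1 hs.2 (Submodule.Quotient.mk y)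
    rw [← Submodule.Quotient.mk_smul, Submodule.Quotient.mk_eq_zero] at this
    obtain ⟨r, hr⟩ := this
    exact ⟨r, by rw [← Algebra.smul_def]; exact hr.symm⟩

end FiniteDimensional

/-- No nonzero element of the `B`-module `M` is killed by a maximal ideal of `B`. -/
def SocleFree (B : Type u) (M : Type v) [CommRing B] [AddCommGroup M] [Module B M] : Prop :=
  ∀ m : Ideal B, m.IsMaximal → ∀ y : M, (∀ a ∈ m, a • y = 0) → y = 0

/-- For `x ≠ 0` the module `B x` has an associated prime, which contains the annihilator of `x` and
is therefore maximal; an element with this annihilator is a nonzero socle element. Thus vanishing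
need only be checked at non-maximal primes. -/
lemma SocleFree.eq_zero {B : Type u} {M : Type v} [CommRing B] [IsNoetherianRing B]
    [AddCommGroup M] [Module B M] (h : SocleFree B M) {x : M}
    (hx : ∀ p : Ideal B, p.IsPrime → (∀ a, a • x = 0 → a ∈ p) → p.IsMaximal) : x = 0 := by
  by_contra hx0
  let S := Submodule.span B {x}
  have hne : (⟨x, Submodule.mem_span_singleton_self x⟩ : S) ≠ 0 := fun h0 =>
    hx0 (congrArg Subtype.val h0)
  obtain ⟨p, hp, hle⟩ := exists_le_isAssociatedPrime_of_isNoetherianRing B _ hne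
  obtain ⟨hpp, ⟨y, hy⟩, hpy⟩ := isAssociatedPrime_iff.1 hp
  have hpy : ∀ a, a ∈ p ↔ a • y = 0 := fun a => by
    rw [hpy, Submodule.mem_colon_singleton, Submodule.mem_bot, Subtype.ext_iff]
    rfl
  have hpm := hx p hpp fun a ha => hle (by
    rw [Submodule.mem_colon_singleton, Submodule.mem_bot, Subtype.ext_iff]
    exact ha)
  have hy0 := h p hpm y fun a ha => (hpy a).1 ha
  exact hpp.ne_top ((Ideal.eq_top_iff_one p).2 ((hpy 1).2 (by rw [hy0, smul_zero])))

/-- Freeness from the socle descends along integral extensions. -/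
lemma SocleFree.of_isIntegral {B : Type u} {E : Type v} [CommRing B] [CommRing E] [Algebra B E]
    [Algebra.IsIntegral B E] [IsNoetherianRing E] (h : SocleFree E E) : SocleFree B E := by
  intro m hm y hy
  refine h.eq_zero fun p hp hle => ?_
  have h1 : m ≤ p.comap (algebraMap B E) := fun a ha => hle _ (by
    rw [smul_eq_mul, ← Algebra.smul_def]; exact hy a ha)
  have h2 := hm.eq_of_le (hp.comap (algebraMap B E)).ne_top h1
  have : (p.comap (algebraMap B E)).IsMaximal := h2 ▸ hm
  exact Ideal.isMaximal_of_isIntegral_of_isMaximal_comap p this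

/-! ### Modifications of positive depth: reducedness, normalization, birationality -/

section Modification

variable {k : Type*} {B : Type u} {E : Type v} [Field k] [CommRing B] [CommRing E] [Algebra B E]
  [Algebra k B] [Algebra k E] [IsScalarTower k B E]

/-- A modification of a ring with finite residue rings at its non-normal points is reduced if it
has positive depth. -/
lemma isReduced_of_socleFree [IsNoetherianRing B]
    [Module.Finite k (LinearMap.ker (Algebra.linearMap B E))]
    [Module.Finite k (E ⧸ LinearMap.range (Algebra.linearMap B E))]
    (hB : ∀ p : PrimeSpectrum B, ¬ IsNormalAt p → Module.Finite k (B ⧸ p.asIdeal))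
    (hE : SocleFree B E) : IsReduced E := by
  obtain ⟨c, hc, hc₁, hc₂⟩ := exists_conductor k B E
  refine ⟨fun x ⟨n, hx⟩ => hE.eq_zero fun p hp hle => ?_⟩
  suffices Module.Finite k (B ⧸ p) from isMaximal_of_finite_quotient (k := k) p
  -- Only primes with finite residue ring can support `x`: at a normal point outside the conductor
  -- locus, some `s ∉ p` identifies `E` with `B` locally, and the local ring of `B` there has no
  -- nilpotents.
  by_cases hcp : c ≤ p
  · exact finite_quotient_of_le hcp
  by_cases hn : IsNormalAt (⟨p, hp⟩ : PrimeSpectrum B)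
  · exfalso
    obtain ⟨s, hs, hsp⟩ := Set.not_subset.1 hcp
    obtain ⟨r, hr⟩ := hc₂ s hs x
    have h1 : s * r ^ n = 0 := hc₁ s hs _ (by rw [map_pow, ← hr, mul_pow, hx, mul_zero])
    have h2 : ∀ n, ∀ s ∉ p, s * r ^ n = 0 → ∃ u ∉ p, u * r = 0 := by
      intro n
      induction n with
      | zero =>
        intro s hs h
        rw [pow_zero, mul_one] at h
        exact absurd (h ▸ p.zero_mem) hs
      | succ n ih =>
        intro s hs h
        rw [pow_succ, ← mul_assoc] at h
        rcases hn.eq_zero_or_eq_zero h with ⟨u, hu, h⟩ | h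
        · exact ih (u * s) (hp.mul_notMem hu hs) (by rw [mul_assoc]; exact h)
        · exact h
    obtain ⟨u, hu, h⟩ := h2 n s hsp h1
    refine hp.mul_notMem hu hsp (hle _ ?_)
    rw [Algebra.smul_def, map_mul, mul_assoc, hr, ← map_mul, h, map_zero]
  · exact hB _ hn

/-- Over a normal point at which `B → E` is an isomorphism, the normalization of `E` does not
change anything. -/
lemma IsNormalization.exists_mul_mem_range [IsReduced E] [Algebra.IsIntegral B E]
    {N : Type w} [CommRing N] [Algebra E N] [Algebra B N] [IsScalarTower B E N]
    (hN : IsNormalization E N) {p : PrimeSpectrum B} (hn : IsNormalAt p) {s : B}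
    (hsp : s ∉ p.asIdeal) (hc₁ : ∀ x, algebraMap B E x = 0 → s * x = 0)
    (hc₂ : ∀ y : E, ∃ r, algebraMap B E s * y = algebraMap B E r) (y : N) :
    ∃ u ∉ p.asIdeal, ∃ e : E, algebraMap B N u * y = algebraMap E N e := by
  have hp := p.2
  have hinj : ∀ e : E, algebraMap E N e = 0 → e = 0 := fun e he => by
    rw [hN.algebraMap_eq_zero_iff] at he
    exact IsNilpotent.eq_zero he
  obtain ⟨b, hb, a, hba⟩ := hN.exists_mul_eq y
  have hbE := mem_redRegular_iff_of_isReduced.1 hb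
  have hbN := hN.algebraMap_mem _ hb
  obtain ⟨a', ha'⟩ := hc₂ a
  obtain ⟨b', hb'⟩ := hc₂ b
  have hint : IsIntegral B y := by
    have := hN.isIntegral
    exact isIntegral_trans y (Algebra.IsIntegral.isIntegral (R := E) y)
  obtain ⟨F, hF, hroot⟩ := hint
  have hmap : ∀ z : B, algebraMap B N z = algebraMap E N (algebraMap B E z) := fun z =>
    IsScalarTower.algebraMap_apply B E N z
  -- Up to the factor `s`, numerator and denominator of `y` come from `B`. An integral equation of
  -- `y` over `B` then becomes one for `a' / b'`, to which the normality of `B` at `p` applies.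
  have hb'y : algebraMap B N b' * y = algebraMap B N a' := by
    rw [hmap, hmap, ← hb', ← ha', map_mul, map_mul, mul_assoc, hba]
  have hz : algebraMap B E ((F.scaleRoots b').eval a') = 0 := by
    apply hinj
    rw [← hmap, ← Polynomial.eval₂_hom, ← hb'y, Polynomial.scaleRoots_eval₂_mul, hroot, mul_zero]
  have hsz := hc₁ _ hz
  by_cases hdeg : F.natDegree = 0
  · rw [hF.natDegree_eq_zero.1 hdeg, Polynomial.eval₂_one] at hroot
    exact ⟨1, fun h => hp.ne_top ((Ideal.eq_top_iff_one _).2 h), 0, by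
      rw [← mul_one (algebraMap B N 1 * y), hroot, mul_zero, map_zero]⟩
  obtain ⟨n, hn'⟩ := Nat.exists_eq_succ_of_ne_zero hdeg
  -- The equation holds in `B` up to an element of the kernel, which `s` kills; the required factor
  -- `s` arises from scaling the roots, the degree being positive.
  have hs0 : (F.scaleRoots (b' * s)).eval (s * a') = 0 := by
    rw [Polynomial.scaleRoots_mul, Polynomial.scaleRoots_eval_mul, Polynomial.natDegree_scaleRoots,
      hn', pow_succ, mul_assoc, hsz, mul_zero]
  have hb's : ∀ u ∉ p.asIdeal, u * (b' * s) ≠ 0 := by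
    intro u hu h0
    have h1 : algebraMap B E (u * s * s) = 0 := by
      refine (mul_right_mem_nonZeroDivisors_eq_zero_iff hbE).1 ?_
      have := congrArg (algebraMap B E) h0
      rw [map_mul, map_mul, ← hb', map_zero] at this
      rw [map_mul, map_mul, ← this]
      ring
    have h2 := hc₁ _ h1
    exact hp.mul_notMem hsp (hp.mul_notMem (hp.mul_notMem hu hsp) hsp) (h2 ▸ p.asIdeal.zero_mem)
  obtain ⟨u, hu, d, hud⟩ := hn.exists_mul_eq hb's hF hs0
  refine ⟨s * (u * s), hp.mul_notMem hsp (hp.mul_notMem hu hsp),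
    algebraMap B E (s * (s * d)), ?_⟩
  rw [← sub_eq_zero]
  refine (mul_right_mem_nonZeroDivisors_eq_zero_iff hbN).1 ?_
  have h1 := congrArg (algebraMap B N) hud
  have hbN' : algebraMap B N b' = algebraMap B N s * algebraMap E N b := by
    rw [hmap, hmap, ← map_mul, hb']
  rw [← hmap]
  simp only [map_mul] at h1 ⊢
  rw [← hb'y, hbN'] at h1
  linear_combination h1

/-- The normalization of such a modification has finite-dimensional cokernel. -/
lemma IsNormalization.finite_of_surjective [IsNoetherianRing B] [Algebra.IsIntegral B E]
    [IsReduced E] [Module.Finite k (LinearMap.ker (Algebra.linearMap B E))]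
    [Module.Finite k (E ⧸ LinearMap.range (Algebra.linearMap B E))]
    (hB : ∀ p : PrimeSpectrum B, ¬ IsNormalAt p → Module.Finite k (B ⧸ p.asIdeal))
    {N : Type w} [CommRing N] [Algebra E N] [Algebra B N] [IsScalarTower B E N] [Module.Finite B N]
    (hN : IsNormalization E N) {V : Type*} [AddCommGroup V] [Module B V] [Module k V]
    [IsScalarTower k B V] (π : N →ₗ[B] V) (hπ : Function.Surjective π)
    (hπ₀ : ∀ e : E, π (algebraMap E N e) = 0) : Module.Finite k V := by
  obtain ⟨c, hc, hc₁, hc₂⟩ := exists_conductor k B E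
  have hfin : Module.Finite B V := Module.Finite.of_surjective π hπ
  refine finite_of_forall_prime (B := B) k fun p hp ⟨x, hx⟩ => ?_
  by_cases hcp : c ≤ p
  · exact finite_quotient_of_le hcp
  by_cases hn : IsNormalAt (⟨p, hp⟩ : PrimeSpectrum B)
  swap
  · exact hB _ hn
  exfalso
  obtain ⟨s, hs, hsp⟩ := Set.not_subset.1 hcp
  obtain ⟨y, rfl⟩ := hπ x
  obtain ⟨u, hu, e, h⟩ := hN.exists_mul_mem_range hn hsp (hc₁ s hs) (hc₂ s hs) y
  refine hu (hx u ?_)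
  rw [← map_smul, Algebra.smul_def, h, hπ₀]

/-- A reduced ring is normal if and only if it coincides with its normalization. -/
lemma IsNormalization.surjective_iff {E : Type v} {N : Type w} [CommRing E] [IsNoetherianRing E]
    [IsReduced E] [CommRing N] [Algebra E N] (hN : IsNormalization E N) :
    Function.Surjective (algebraMap E N) ↔ IsNormalRing E := by
  have hinj : Function.Injective (algebraMap E N) := by
    rw [injective_iff_map_eq_zero]
    intro e he
    rw [hN.algebraMap_eq_zero_iff] at he
    exact IsNilpotent.eq_zero he
  constructor
  · intro h
    exact hN.isNormalRing.of_ringEquiv (RingEquiv.ofBijective _ ⟨hinj, h⟩).symm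
  · intro hE
    have hEE : IsNormalization E E := by
      refine ⟨inferInstance, hE.isIntegrallyClosed, fun x => ?_, fun b hb => ?_, fun s => ?_⟩
      · rw [nilradical_eq_zero]; rfl
      · exact mem_redRegular_iff_of_isReduced.1 hb
      · exact ⟨1, one_mem _, s, by simp⟩
    obtain ⟨e₁⟩ := hEE.nonempty_algEquiv
    obtain ⟨e₂⟩ := hN.nonempty_algEquiv
    intro y
    obtain ⟨x, hx⟩ := (e₁.symm.trans e₂).surjective y
    exact ⟨x, by rw [← hx]; exact ((e₁.symm.trans e₂).commutes x).symm⟩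

/-- A modification of positive depth which is surjective on spectra is birational. -/
lemma isBirational_of_socleFree [Algebra.IsIntegral B E] [IsNoetherianRing E]
    [Module.Finite k (LinearMap.ker (Algebra.linearMap B E))]
    [Module.Finite k (E ⧸ LinearMap.range (Algebra.linearMap B E))]
    (hE : SocleFree B E)
    (hsurj : ∀ p : Ideal B, p.IsPrime → ∃ q : Ideal E, q.IsPrime ∧ q.comap (algebraMap B E) = p) :
    IsBirational (algebraMap B E) := by
  obtain ⟨c, hc, hc₁, hc₂⟩ := exists_conductor k B E
  set f := algebraMap B E
  -- If a minimal prime of `E` contained the conductor, its contraction would be maximal. A minimal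
  -- prime is the annihilator of some element, which would then be a nonzero socle element.
  have hcq : ∀ q ∈ minimalPrimes E, ∃ s ∈ c, f s ∉ q := by
    intro q hq
    by_contra! h
    have hqp : q.IsPrime := hq.1.1
    have : Module.Finite k (B ⧸ q.comap f) := finite_quotient_of_le h
    have hmax := isMaximal_of_finite_quotient (k := k) (q.comap f)
    have hqa : q ∈ associatedPrimes E E := by
      have := Module.associatedPrimes.minimalPrimes_annihilator_subset_associatedPrimes E E
      refine this ?_
      rwa [Module.annihilator_eq_bot.2 inferInstance]
    obtain ⟨z, hz⟩ := exists_ne_zero_of_mem_associatedPrimes hqa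
    have hz0 := hE _ hmax z fun a ha => by
      rw [Algebra.smul_def]
      exact (hz _).1 ha
    exact hqp.ne_top ((Ideal.eq_top_iff_one q).2 ((hz 1).2 (by rw [hz0, mul_zero])))
  -- Outside the conductor locus, multiplication by `s` moves elements of `E` into the image of `B`,
  -- so inclusions between contracted primes lift.
  have hle : ∀ q₁ q₂ : Ideal E, q₁.IsPrime → q₂ ∈ minimalPrimes E →
      q₁.comap f ≤ q₂.comap f → q₁ = q₂ := by
    intro q₁ q₂ h₁ h₂ h
    obtain ⟨s, hs, hsq⟩ := hcq q₂ h₂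
    have hqp : q₂.IsPrime := h₂.1.1
    have h3 : q₁ ≤ q₂ := by
      intro x hx
      obtain ⟨r, hr⟩ := hc₂ s hs x
      have h4 : r ∈ q₁.comap f := by
        rw [Ideal.mem_comap, ← hr]
        exact Ideal.mul_mem_left _ _ hx
      have h5 : f s * x ∈ q₂ := by
        rw [hr]
        exact h h4
      exact (hqp.mem_or_mem h5).resolve_left hsq
    exact le_antisymm h3 (h₂.2 ⟨h₁, bot_le⟩ h3)
  refine ⟨⟨fun q hq => ?_, fun q₁ h₁ q₂ h₂ h => hle q₁ q₂ h₁.1.1 h₂ h.le, fun p hp => ?_⟩,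
    fun q hq => ?_⟩
  · have hqp : q.IsPrime := hq.1.1
    refine ⟨⟨inferInstance, bot_le⟩, fun p ⟨hp, _⟩ hpq => ?_⟩
    obtain ⟨q', hq', rfl⟩ := hsurj p hp
    rw [hle q' q hq' hq hpq]
  · have hpp : p.IsPrime := hp.1.1
    obtain ⟨q, hq, rfl⟩ := hsurj p hpp
    obtain ⟨q', hq', hle'⟩ := Ideal.exists_minimalPrimes_le (I := ⊥) (J := q) bot_le
    have hqp : q'.IsPrime := hq'.1.1
    exact ⟨q', hq', le_antisymm (Ideal.comap_mono hle')
      (hp.2 ⟨inferInstance, bot_le⟩ (Ideal.comap_mono hle'))⟩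
  · obtain ⟨s, hs, hsq⟩ := hcq _ hq
    refine localRingHom_bijective f q.asIdeal (fun x hx => ⟨s, hsq, hc₁ s hs x hx⟩)
      (fun y => ⟨s, hsq, hc₂ s hs y⟩) fun w y hw hwy => ?_
    obtain ⟨w', hw'⟩ := hc₂ s hs w
    refine ⟨w', ?_, ?_⟩
    · rw [← hw']
      exact q.2.mul_notMem hsq hw
    · rw [← hw', mul_assoc, hwy, mul_zero]

end Modification

/-! ### The delta invariant of a modification of positive depth -/

section Modification

variable {k : Type*} {B : Type u} {E : Type v} [Field k] [CommRing B] [CommRing E] [Algebra B E]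
  [Algebra k B] [Algebra k E] [IsScalarTower k B E]

/-- Multiplication by a regular denominator carries a socle element of `N` to one of `E`, without
killing it. -/
lemma IsNormalization.socleFree {N : Type w} [CommRing N] [Algebra E N] [Algebra B N]
    [IsScalarTower B E N] [IsReduced E] (hN : IsNormalization E N) (hE : SocleFree B E) :
    SocleFree B N := by
  have hinj : ∀ e : E, algebraMap E N e = 0 → e = 0 := fun e he => by
    rw [hN.algebraMap_eq_zero_iff] at he
    exact IsNilpotent.eq_zero he
  intro m hm y hy
  obtain ⟨b, hb, a, hba⟩ := hN.exists_mul_eq y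
  refine (mul_left_mem_nonZeroDivisors_eq_zero_iff (hN.algebraMap_mem _ hb)).1 ?_
  rw [hba, hE m hm a fun r hr => hinj _ ?_, map_zero]
  rw [Algebra.smul_def, map_mul, ← hba, ← IsScalarTower.algebraMap_apply, mul_left_comm,
    ← Algebra.smul_def r y, hy r hr, mul_zero]

/-- The delta invariant of `B` is the Euler characteristic of a modification `B → E` of positive
depth plus the delta invariant of `E`, which vanishes if and only if `E` is normal. -/
lemma IsNormalization.exists_delta_eq [IsNoetherianRing B] [Module.Finite B E]
    [Module.Finite k (LinearMap.ker (Algebra.linearMap B E))]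
    [Module.Finite k (E ⧸ LinearMap.range (Algebra.linearMap B E))]
    (hB : ∀ p : PrimeSpectrum B, ¬ IsNormalAt p → Module.Finite k (B ⧸ p.asIdeal))
    (hE : SocleFree B E) {N : Type w} [CommRing N] [Algebra E N] [Module.Finite E N]
    (hN : IsNormalization E N) :
    DeltaFinite k B ∧ ∃ d : ℕ, delta k B =
      (Module.finrank k (E ⧸ LinearMap.range (Algebra.linearMap B E)) : ℤ) -
        Module.finrank k (LinearMap.ker (Algebra.linearMap B E)) + d ∧
      (d = 0 ↔ IsNormalRing E) := by
  have hred : IsReduced E := isReduced_of_socleFree (k := k) hB hE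
  have hinj : ∀ e : E, algebraMap E N e = 0 → e = 0 := fun e he => by
    rw [hN.algebraMap_eq_zero_iff] at he
    exact IsNilpotent.eq_zero he
  let _ : Algebra B N := ((algebraMap E N).comp (algebraMap B E)).toAlgebra
  let _ : Algebra k N := ((algebraMap B N).comp (algebraMap k B)).toAlgebra
  have hBEN : IsScalarTower B E N := IsScalarTower.of_algebraMap_eq fun _ => rfl
  have hkBN : IsScalarTower k B N := IsScalarTower.of_algebraMap_eq fun _ => rfl
  have hBN : Module.Finite B N := Module.Finite.trans E N
  have hNE : IsNoetherianRing E := IsNoetherianRing.of_finite B E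
  let g : E →ₗ[B] N := (IsScalarTower.toAlgHom B E N).toLinearMap
  have hfinV : Module.Finite k (N ⧸ LinearMap.range g) :=
    hN.finite_of_surjective hB (LinearMap.range g).mkQ (Submodule.mkQ_surjective _)
      fun e => by
        rw [Submodule.mkQ_apply, Submodule.Quotient.mk_eq_zero]
        exact ⟨e, rfl⟩
  have hker : LinearMap.ker (Algebra.linearMap B N) = LinearMap.ker (Algebra.linearMap B E) := by
    ext x
    simp only [LinearMap.mem_ker, Algebra.linearMap_apply]
    exact ⟨fun h => hinj _ h, fun h => by
      rw [IsScalarTower.algebraMap_apply B E N, h, map_zero]⟩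
  have hle : LinearMap.range (Algebra.linearMap B E) ≤
      (LinearMap.range (Algebra.linearMap B N)).comap g := by
    rintro _ ⟨b, rfl⟩
    exact ⟨b, rfl⟩
  have hle' : LinearMap.range (Algebra.linearMap B N) ≤ LinearMap.range g := by
    rintro _ ⟨b, rfl⟩
    exact ⟨algebraMap B E b, rfl⟩
  -- The exact sequence `0 → E/B → N/B → N/E → 0`, with `B` standing for its images; the kernels of
  -- `B → E` and `B → N` agree since `E` embeds into `N`.
  let i := (Submodule.mapQ _ _ g hle).restrictScalars k
  let j := (Submodule.factor hle').restrictScalars k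
  have hi : Function.Injective i := by
    rw [injective_iff_map_eq_zero]
    intro x hx
    obtain ⟨e, rfl⟩ := Submodule.Quotient.mk_surjective _ x
    obtain ⟨b, hb⟩ := (Submodule.Quotient.mk_eq_zero _).1 hx
    rw [Submodule.Quotient.mk_eq_zero]
    refine ⟨b, sub_eq_zero.1 (hinj _ ?_)⟩
    rw [map_sub, sub_eq_zero]
    exact hb
  have hj : Function.Surjective j := by
    intro x
    obtain ⟨y, rfl⟩ := Submodule.Quotient.mk_surjective _ x
    exact ⟨Submodule.Quotient.mk y, rfl⟩
  have hij : Function.Exact i j := by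
    intro x
    obtain ⟨y, rfl⟩ := Submodule.Quotient.mk_surjective _ x
    constructor
    · intro hy
      obtain ⟨e, rfl⟩ := (Submodule.Quotient.mk_eq_zero _).1 hy
      exact ⟨Submodule.Quotient.mk e, rfl⟩
    · rintro ⟨e, he⟩
      obtain ⟨e, rfl⟩ := Submodule.Quotient.mk_surjective _ e
      rw [← he]
      exact (Submodule.Quotient.mk_eq_zero _).2 ⟨e, rfl⟩
  obtain ⟨hfin, hrank⟩ := finite_and_finrank_of_exact hi hij hj
  have hker' : Module.Finite k (LinearMap.ker (Algebra.linearMap B N)) := by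
    rw [hker]
    infer_instance
  have hEN : Algebra.IsIntegral B N := inferInstance
  obtain ⟨h₁, h₂⟩ := deltaFinite_and_delta_eq (k := k) (B := B) (D := N) hN.isNormalRing
    (hN.socleFree hE)
  refine ⟨h₁, Module.finrank k (N ⧸ LinearMap.range g), ?_, ?_⟩
  · rw [h₂, hrank, hker]
    push_cast
    ring
  · rw [← hN.surjective_iff, Module.finrank_eq_zero_iff_of_free,
      Submodule.Quotient.subsingleton_iff, LinearMap.range_eq_top]
    rfl

end Modification

/-! ### Fibre rings: elements, primes, finiteness -/

section Fibres

variable {A : Type u} [CommRing A] (t : PrimeSpectrum A) (S : Type v) [CommRing S] [Algebra A S]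

/-- The restriction of functions to the fibre. -/
noncomputable def toFibre : S →ₐ[A] FibreRing t S := Algebra.TensorProduct.includeRight

variable {S}

lemma fibreMap_toFibre {T : Type v} [CommRing T] [Algebra A T] (φ : S →ₐ[A] T) (s : S) :
    fibreMap t φ (toFibre t S s) = toFibre t T (φ s) := by
  simp [fibreMap, toFibre]

lemma exists_smul_eq_toFibre (z : FibreRing t S) :
    ∃ r ∉ t.asIdeal, ∃ s, algebraMap A (FibreRing t S) r * z = toFibre t S s := by
  obtain ⟨r, hr, s, h⟩ := Ideal.Fiber.exists_smul_eq_one_tmul t.asIdeal z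
  exact ⟨r, hr, s, by rw [← Algebra.smul_def, h]; rfl⟩

lemma isUnit_algebraMap_fibreRing {r : A} (hr : r ∉ t.asIdeal) :
    IsUnit (algebraMap A (FibreRing t S) r) := by
  rw [IsScalarTower.algebraMap_apply A t.asIdeal.ResidueField (FibreRing t S)]
  refine (IsUnit.mk0 _ ?_).map _
  rwa [Ne, Ideal.algebraMap_residueField_eq_zero]

lemma toFibre_injective [IsDomain A] [Module.Flat A S] (ht : t.asIdeal = ⊥) :
    Function.Injective (toFibre t S) := by
  have h : Function.Injective (algebraMap A t.asIdeal.ResidueField) := by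
    rw [injective_iff_map_eq_zero]
    intro a ha
    rwa [Ideal.algebraMap_residueField_eq_zero, ht, Ideal.mem_bot] at ha
  exact Algebra.TensorProduct.includeRight_injective h

lemma toFibre_surjective (ht : t.asIdeal.IsMaximal) : Function.Surjective (toFibre t S) := by
  intro z
  induction z using TensorProduct.induction_on with
  | zero => exact ⟨0, map_zero _⟩
  | add x y hx hy =>
    obtain ⟨a, rfl⟩ := hx
    obtain ⟨b, rfl⟩ := hy
    exact ⟨a + b, map_add _ _ _⟩
  | tmul c s =>
    obtain ⟨a, rfl⟩ := Ideal.algebraMap_residueField_surjective t.asIdeal c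
    exact ⟨a • s, by simp [toFibre, Algebra.algebraMap_eq_smul_one, TensorProduct.smul_tmul']⟩

/-- Over a maximal ideal the residue field is `A ⧸ t`, so the fibre is `S ⧸ π S`. -/
lemma toFibre_eq_zero_iff (ht : t.asIdeal.IsMaximal) {π : A} (hπ : t.asIdeal = Ideal.span {π})
    {s : S} : toFibre t S s = 0 ↔ ∃ y, s = π • y := by
  let e₀ : (A ⧸ t.asIdeal) ≃ₗ[A] t.asIdeal.ResidueField :=
    (AlgEquiv.ofBijective (Ideal.Quotient.liftₐ t.asIdeal (Algebra.ofId A t.asIdeal.ResidueField)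
      fun a ha => by simpa using ha) ?_).toLinearEquiv
  swap
  · exact Ideal.bijective_algebraMap_quotient_residueField t.asIdeal
  let e := (LinearEquiv.rTensor S e₀).symm ≪≫ₗ TensorProduct.quotTensorEquivQuotSMul S t.asIdeal
  have he : e (toFibre t S s) = Submodule.Quotient.mk s := by
    have h1 : (LinearEquiv.rTensor S e₀).symm (toFibre t S s) = 1 ⊗ₜ s := by
      rw [LinearEquiv.symm_apply_eq]
      simp [toFibre, e₀]
    rw [LinearEquiv.trans_apply, h1]
    exact TensorProduct.quotTensorEquivQuotSMul_mk_tmul t.asIdeal 1 s |>.trans (by rw [one_smul])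
  rw [← e.map_eq_zero_iff, he, Submodule.Quotient.mk_eq_zero, hπ,
    Submodule.ideal_span_singleton_smul, Submodule.mem_smul_pointwise_iff_exists]
  exact ⟨fun ⟨y, _, h⟩ => ⟨y, h.symm⟩, fun ⟨y, h⟩ => ⟨y, trivial, h.symm⟩⟩

lemma comap_comap_toFibre (q : Ideal (FibreRing t S)) [q.IsPrime] :
    (q.comap (toFibre t S)).comap (algebraMap A S) = t.asIdeal := by
  have := ((PrimeSpectrum.preimageEquivFiber A S t).symm ⟨q, inferInstance⟩).2
  exact congrArg PrimeSpectrum.asIdeal this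

lemma exists_comap_toFibre_eq (q : Ideal S) [q.IsPrime]
    (hq : q.comap (algebraMap A S) = t.asIdeal) :
    ∃ q' : Ideal (FibreRing t S), q'.IsPrime ∧ q'.comap (toFibre t S) = q := by
  let Q : PrimeSpectrum.comap (algebraMap A S) ⁻¹' {t} := ⟨⟨q, inferInstance⟩, PrimeSpectrum.ext hq⟩
  refine ⟨(PrimeSpectrum.preimageEquivFiber A S t Q).asIdeal,
    (PrimeSpectrum.preimageEquivFiber A S t Q).2, ?_⟩
  exact congrArg (fun x => x.1.asIdeal)
    ((PrimeSpectrum.preimageEquivFiber A S t).symm_apply_apply Q)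

lemma eq_of_comap_toFibre_eq {p q : Ideal (FibreRing t S)} [p.IsPrime] [q.IsPrime]
    (h : p.comap (toFibre t S) = q.comap (toFibre t S)) : p = q := by
  have : (PrimeSpectrum.preimageEquivFiber A S t).symm ⟨p, inferInstance⟩ =
      (PrimeSpectrum.preimageEquivFiber A S t).symm ⟨q, inferInstance⟩ :=
    Subtype.ext (PrimeSpectrum.ext h)
  exact congrArg PrimeSpectrum.asIdeal
    ((PrimeSpectrum.preimageEquivFiber A S t).symm.injective this)

/-- The residue field is essentially of finite type over `A`, hence so is the fibre over `S`. -/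
lemma isNoetherianRing_fibreRing [IsNoetherianRing S] : IsNoetherianRing (FibreRing t S) := by
  let e := Algebra.TensorProduct.comm A S t.asIdeal.ResidueField
  have h : Algebra.EssFiniteType A t.asIdeal.ResidueField := inferInstance
  have h' : Algebra.EssFiniteType S (S ⊗[A] t.asIdeal.ResidueField) :=
    Algebra.EssFiniteType.baseChange A t.asIdeal.ResidueField S
  have := Algebra.EssFiniteType.isNoetherianRing S (S ⊗[A] t.asIdeal.ResidueField)
  exact isNoetherianRing_of_ringEquiv _ e.toRingEquiv

variable {T : Type v} [CommRing T] [Algebra A T] (φ : S →ₐ[A] T)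

lemma finite_fibreMap (hφ : φ.toRingHom.Finite) : (fibreMap t φ).Finite := by
  let _ := φ.toRingHom.toAlgebra
  let _ := (fibreMap t φ).toAlgebra
  have hfin : Module.Finite S T := hφ
  obtain ⟨s, hs⟩ := hfin.fg_top
  classical
  refine ⟨⟨s.image (toFibre t T), ?_⟩⟩
  rw [eq_top_iff]
  have h : ∀ y : T, toFibre t T y ∈ Submodule.span (FibreRing t S)
      (s.image (toFibre t T) : Set (FibreRing t T)) := by
    intro y
    have hy : y ∈ Submodule.span S (s : Set T) := hs ▸ trivial
    induction hy using Submodule.span_induction with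
    | mem x hx => exact Submodule.subset_span (by simpa using ⟨x, hx, rfl⟩)
    | zero => rw [map_zero]; exact zero_mem _
    | add x y _ _ hx hy => rw [map_add]; exact add_mem hx hy
    | smul a x _ hx =>
      have : toFibre t T (a • x) = toFibre t S a • toFibre t T x := by
        rw [Algebra.smul_def, Algebra.smul_def, map_mul]
        exact congrArg (· * toFibre t T x) (fibreMap_toFibre t φ a).symm
      rw [this]
      exact Submodule.smul_mem _ _ hx
  rintro z -
  obtain ⟨r, hr, y, hz⟩ := exists_smul_eq_toFibre t z
  obtain ⟨u, hu⟩ := (isUnit_algebraMap_fibreRing (S := S) t hr).exists_left_inv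
  have h1 : fibreMap t φ (algebraMap A (FibreRing t S) r) = algebraMap A (FibreRing t T) r :=
    AlgHom.commutes ((Algebra.TensorProduct.map (AlgHom.id A t.asIdeal.ResidueField) φ)) r
  have : z = u • toFibre t T y := by
    rw [← hz, ← h1, Algebra.smul_def]
    change z = fibreMap t φ u * (fibreMap t φ _ * z)
    rw [← mul_assoc, ← map_mul, hu, map_one, one_mul]
  rw [this]
  exact Submodule.smul_mem _ _ (h y)

/-- A finite map with nilpotent kernel is surjective on the spectra of the fibres. -/
lemma exists_comap_fibreMap_eq (hφ : φ.toRingHom.IsIntegral)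
    (hker : ∀ x, φ x = 0 → x ∈ nilradical S) (p : Ideal (FibreRing t S)) (hp : p.IsPrime) :
    ∃ q : Ideal (FibreRing t T), q.IsPrime ∧ q.comap (fibreMap t φ) = p := by
  let _ := φ.toRingHom.toAlgebra
  have hint : Algebra.IsIntegral S T := ⟨hφ⟩
  have hle : RingHom.ker (algebraMap S T) ≤ p.comap (toFibre t S) := fun x hx =>
    nilradical_le_prime _ (hker x hx)
  obtain ⟨Q, -, hQ, hQp⟩ := Ideal.exists_ideal_over_prime_of_isIntegral
    (p.comap (toFibre t S)) (⊥ : Ideal T) hle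
  have hc : ∀ I : Ideal T, (I.comap (algebraMap S T)).comap (algebraMap A S) =
      I.comap (algebraMap A T) := fun I => by
    rw [Ideal.comap_comap]
    congr 1
    exact φ.comp_algebraMap
  obtain ⟨q, hq, hqQ⟩ := exists_comap_toFibre_eq t Q (by
    rw [← hc, hQp, comap_comap_toFibre])
  refine ⟨q, hq, eq_of_comap_toFibre_eq t ?_⟩
  rw [← hQp, ← hqQ]
  ext x
  simp only [Ideal.mem_comap]
  rw [fibreMap_toFibre]
  rfl

end Fibres

/-- The Euler characteristic concerns the `k`-linear base change of `φ`, the delta invariant the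
`B`-linear structure map. The underlying kernels and cokernels coincide. -/
lemma finite_and_finrank_of_eq_algebraMap {k : Type*} {B : Type u} {E : Type v} [Field k]
    [CommRing B] [CommRing E] [Algebra B E] [Algebra k B] [Algebra k E] [IsScalarTower k B E]
    (g : B →ₗ[k] E) (hg : ∀ x, g x = algebraMap B E x) [Module.Finite k (LinearMap.ker g)]
    [Module.Finite k (E ⧸ LinearMap.range g)] :
    Module.Finite k (LinearMap.ker (Algebra.linearMap B E)) ∧
      Module.Finite k (E ⧸ LinearMap.range (Algebra.linearMap B E)) ∧
      Module.finrank k (LinearMap.ker (Algebra.linearMap B E)) =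
        Module.finrank k (LinearMap.ker g) ∧
      Module.finrank k (E ⧸ LinearMap.range (Algebra.linearMap B E)) =
        Module.finrank k (E ⧸ LinearMap.range g) := by
  obtain rfl : g = (Algebra.linearMap B E).restrictScalars k := LinearMap.ext hg
  let e₁ : LinearMap.ker ((Algebra.linearMap B E).restrictScalars k) ≃ₗ[k]
      LinearMap.ker (Algebra.linearMap B E) :=
    { toFun := fun x => ⟨x.1, x.2⟩
      invFun := fun x => ⟨x.1, x.2⟩
      map_add' := fun _ _ => rfl
      map_smul' := fun _ _ => rfl }
  let e₂ : (E ⧸ LinearMap.range ((Algebra.linearMap B E).restrictScalars k)) ≃ₗ[k]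
      E ⧸ LinearMap.range (Algebra.linearMap B E) :=
    Submodule.Quotient.restrictScalarsEquiv k (LinearMap.range (Algebra.linearMap B E))
  exact ⟨Module.Finite.equiv e₁, Module.Finite.equiv e₂, e₁.symm.finrank_eq, e₂.symm.finrank_eq⟩

/-! ### Delta invariants and birationality of fibres via a finite modification -/

section FibreDelta

variable {A : Type u} [CommRing A] {R N : Type v} [CommRing R] [CommRing N] [Algebra A R]
  [Algebra A N]

lemma isScalarTower_fibreMap (φ : R →ₐ[A] N) (t : PrimeSpectrum A) :
    @IsScalarTower t.asIdeal.ResidueField (FibreRing t R) (FibreRing t N) _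
      (fibreMap t φ).toAlgebra.toSMul _ := by
  let _ : Algebra (FibreRing t R) (FibreRing t N) := (fibreMap t φ).toAlgebra
  refine IsScalarTower.of_algebraMap_eq (R := t.asIdeal.ResidueField) (S := FibreRing t R)
    (A := FibreRing t N) fun x => ?_
  rw [RingHom.algebraMap_toAlgebra]
  simp [fibreMap, Algebra.TensorProduct.algebraMap_apply]

variable [IsDomain A] [IsPrincipalIdealRing A] [Module.Flat A R] [Module.Flat A N]

/-- A finite modification `R → N` over a principal ideal domain computes the delta invariants of
the fibres, up to a constant. -/
theorem exists_fibreDelta_eq [IsNoetherianRing R] (φ : R →ₐ[A] N) (hφ : φ.toRingHom.Finite)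
    [Module.Finite A (LinearMap.ker φ.toLinearMap)]
    [Module.Finite A (N ⧸ LinearMap.range φ.toLinearMap)] :
    ∃ c : ℤ, ∀ t : PrimeSpectrum A,
      (∀ p : PrimeSpectrum (FibreRing t R), ¬ IsNormalAt p →
        Module.Finite t.asIdeal.ResidueField (FibreRing t R ⧸ p.asIdeal)) →
      SocleFree (FibreRing t N) (FibreRing t N) →
      (IsReduced (FibreRing t N) → Module.Finite (FibreRing t N) (Normalization (FibreRing t N))) →
      DeltaFinite t.asIdeal.ResidueField (FibreRing t R) ∧
        ∃ d : ℕ, fibreDelta A R t = c + d ∧ (d = 0 ↔ IsNormalRing (FibreRing t N)) := by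
  obtain ⟨c, hc⟩ := exists_euler_eq φ.toLinearMap
  refine ⟨c, fun t hB hsoc hfinN => ?_⟩
  obtain ⟨h₁, h₂, h₃⟩ := hc t.asIdeal.ResidueField
  let _ : Algebra (FibreRing t R) (FibreRing t N) := (fibreMap t φ).toAlgebra
  have htower : IsScalarTower t.asIdeal.ResidueField (FibreRing t R) (FibreRing t N) :=
    isScalarTower_fibreMap φ t
  have hfin : Module.Finite (FibreRing t R) (FibreRing t N) := finite_fibreMap t φ hφ
  have hR := isNoetherianRing_fibreRing t (S := R)
  have hN : IsNoetherianRing (FibreRing t N) := IsNoetherianRing.of_finite (FibreRing t R) _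
  obtain ⟨h₄, h₅, h₆, h₇⟩ := finite_and_finrank_of_eq_algebraMap
    (B := FibreRing t R) (E := FibreRing t N)
    (φ.toLinearMap.baseChange t.asIdeal.ResidueField) (fun _ => rfl)
  have hsoc' : SocleFree (FibreRing t R) (FibreRing t N) := hsoc.of_isIntegral
  have hred : IsReduced (FibreRing t N) :=
    isReduced_of_socleFree (k := t.asIdeal.ResidueField) hB hsoc'
  have := hfinN hred
  obtain ⟨h₈, d, h₉, h₁₀⟩ := (isNormalization_normalization (FibreRing t N)).exists_delta_eq
    (k := t.asIdeal.ResidueField) hB hsoc'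
  refine ⟨h₈, d, ?_, h₁₀⟩
  rw [fibreDelta, h₉, h₆, h₇, h₃]

/-- A finite modification `R → N` over a principal ideal domain is birational on the fibres, if
the fibres of `N` have positive depth. -/
theorem isBirational_fibreMap [IsNoetherianRing R] (φ : R →ₐ[A] N) (hφ : φ.toRingHom.Finite)
    [Module.Finite A (LinearMap.ker φ.toLinearMap)]
    [Module.Finite A (N ⧸ LinearMap.range φ.toLinearMap)] (t : PrimeSpectrum A)
    (hsoc : SocleFree (FibreRing t N) (FibreRing t N)) (hker : ∀ x, φ x = 0 → x ∈ nilradical R) :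
    IsBirational (fibreMap t φ) := by
  obtain ⟨c, hc⟩ := exists_euler_eq φ.toLinearMap
  obtain ⟨h₁, h₂, -⟩ := hc t.asIdeal.ResidueField
  let _ : Algebra (FibreRing t R) (FibreRing t N) := (fibreMap t φ).toAlgebra
  have htower : IsScalarTower t.asIdeal.ResidueField (FibreRing t R) (FibreRing t N) :=
    isScalarTower_fibreMap φ t
  have hfin : Module.Finite (FibreRing t R) (FibreRing t N) := finite_fibreMap t φ hφ
  have hR := isNoetherianRing_fibreRing t (S := R)
  have hN : IsNoetherianRing (FibreRing t N) := IsNoetherianRing.of_finite (FibreRing t R) _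
  obtain ⟨h₄, h₅, -⟩ := finite_and_finrank_of_eq_algebraMap
    (B := FibreRing t R) (E := FibreRing t N)
    (φ.toLinearMap.baseChange t.asIdeal.ResidueField) (fun _ => rfl)
  exact isBirational_of_socleFree (k := t.asIdeal.ResidueField) hsoc.of_isIntegral
    (exists_comap_fibreMap_eq t φ hφ.to_isIntegral hker)

end FibreDelta

/-- A normal local ring of dimension at least two has depth at least two. -/
lemma dvd_of_forall_mem_maximalIdeal {O : Type u} [CommRing O] [IsDomain O] [IsLocalRing O]
    [IsNoetherianRing O] [IsIntegrallyClosed O] (h2 : 2 ≤ (IsLocalRing.maximalIdeal O).height)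
    {π x : O} (hπ : π ≠ 0) (h : ∀ a ∈ IsLocalRing.maximalIdeal O, π ∣ a * x) : π ∣ x := by
  by_contra hx
  have hx0 : x ≠ 0 := fun h0 => hx (h0 ▸ dvd_zero π)
  let K := FractionRing O
  have hπK : algebraMap O K π ≠ 0 := fun h0 =>
    hπ (IsFractionRing.injective O K (by rw [h0, map_zero]))
  -- The fraction `x / π` multiplies the maximal ideal into `O`. Either it maps the ideal into
  -- itself and is integral, hence in `O`; or some `a * x / π` is a unit, the maximal ideal is
  -- generated by `a`, and its height is at most one.
  by_cases hc : ∀ a ∈ IsLocalRing.maximalIdeal O, ∃ b ∈ IsLocalRing.maximalIdeal O, a * x = π * b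
  · have hint : IsIntegral O (algebraMap O K x / algebraMap O K π) := by
      refine isIntegral_of_smul_mem_submodule (A := K) (M := K)
        (Submodule.map (Algebra.linearMap O K) (IsLocalRing.maximalIdeal O)) ?_ ?_ _ ?_
      · intro hbot
        have h0 : IsLocalRing.maximalIdeal O = ⊥ := by
          rw [eq_bot_iff]
          intro a ha
          have : algebraMap O K a ∈ Submodule.map (Algebra.linearMap O K)
            (IsLocalRing.maximalIdeal O) :=
            ⟨a, ha, rfl⟩
          rw [hbot, Submodule.mem_bot] at this
          exact IsFractionRing.injective O K (by rw [this, map_zero])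
        rw [h0, Ideal.height_bot] at h2
        exact absurd h2 (by norm_num)
      · exact (IsNoetherian.noetherian (IsLocalRing.maximalIdeal O)).map _
      · rintro _ ⟨a, ha, rfl⟩
        obtain ⟨b, hb, hab⟩ := hc a ha
        refine ⟨b, hb, ?_⟩
        rw [Algebra.linearMap_apply, Algebra.linearMap_apply, smul_eq_mul, div_mul_eq_mul_div,
          eq_div_iff hπK, ← map_mul, ← map_mul, mul_comm x, hab, mul_comm]
    obtain ⟨y, hy⟩ := IsIntegrallyClosed.isIntegral_iff.1 hint
    refine hx ⟨y, IsFractionRing.injective O K ?_⟩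
    rw [map_mul, hy, mul_div_cancel₀ _ hπK]
  · push Not at hc
    obtain ⟨a, ha, hab⟩ := hc
    obtain ⟨u, hu⟩ := h a ha
    have hunit : IsUnit u := by
      by_contra hn
      exact hab u ((IsLocalRing.mem_maximalIdeal u).2 hn) hu
    obtain ⟨u, rfl⟩ := hunit
    have hspan : IsLocalRing.maximalIdeal O = Ideal.span {a} := by
      refine le_antisymm (fun b hb => ?_) ((Ideal.span_singleton_le_iff_mem _).2 ha)
      obtain ⟨c, hc⟩ := h b hb
      rw [Ideal.mem_span_singleton]
      refine ⟨↑u⁻¹ * c, mul_right_cancel₀ hx0 ?_⟩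
      have : π = a * x * ↑u⁻¹ := by rw [hu, mul_assoc, Units.mul_inv, mul_one]
      rw [hc]
      nth_rewrite 1 [this]
      ring
    have : (IsLocalRing.maximalIdeal O).IsPrincipal := ⟨a, hspan⟩
    have h1 := Ideal.height_le_one_of_isPrincipal_of_mem_minimalPrimes
      (IsLocalRing.maximalIdeal O) (IsLocalRing.maximalIdeal O)
      ⟨⟨inferInstance, le_rfl⟩, fun q hq _ => hq.2⟩
    exact absurd (h2.trans h1) (by norm_num)

/-- A Noetherian domain of dimension at least two over a principal ideal domain has a nonzero prime
lying over the generic point. -/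
lemma exists_isPrime_comap_eq_bot {A : Type u} {D : Type v} [CommRing A] [IsDomain A]
    [IsPrincipalIdealRing A] [CommRing D] [IsDomain D] [IsNoetherianRing D] [Algebra A D]
    (hinj : Function.Injective (algebraMap A D)) (hdim : 1 < ringKrullDim D) :
    ∃ q : Ideal D, q.IsPrime ∧ q ≠ ⊥ ∧ q.comap (algebraMap A D) = ⊥ := by
  obtain ⟨l, hl⟩ : ∃ l : LTSeries (PrimeSpectrum D), 1 < l.length := by
    obtain ⟨l, hl⟩ := lt_iSup_iff.1 hdim
    exact ⟨l, by exact_mod_cast hl⟩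
  obtain ⟨p₀, p₁, p₂, h₀₁, h₁₂⟩ : ∃ p₀ p₁ p₂ : PrimeSpectrum D, p₀ < p₁ ∧ p₁ < p₂ :=
    ⟨l.toFun ⟨0, by omega⟩, l.toFun ⟨1, by omega⟩, l.toFun ⟨2, by omega⟩,
      l.strictMono (by simp [Fin.lt_def]), l.strictMono (by simp [Fin.lt_def])⟩
  have h₀ : p₁.asIdeal ≠ ⊥ := ((bot_le : ⊥ ≤ p₀.asIdeal).trans_lt h₀₁).ne'
  by_cases hp₂ : p₂.asIdeal.comap (algebraMap A D) = ⊥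
  · exact ⟨p₂.asIdeal, p₂.2, ((bot_le : ⊥ ≤ p₁.asIdeal).trans_lt h₁₂).ne', hp₂⟩
  obtain ⟨π, hπ, hπ0⟩ := Submodule.exists_mem_ne_zero_of_ne_bot hp₂
  set a := algebraMap A D π
  have ha0 : a ≠ 0 := fun h => hπ0 (hinj (by rw [map_zero]; exact h))
  have hone : ∀ q q' : Ideal D, q.IsPrime → q' ∈ (Ideal.span {a}).minimalPrimes →
    q < q' → q = ⊥ := by
    intro q q' hq hq' hlt
    by_contra hne
    have := hq'.1.1
    have h1 := Ideal.height_le_one_of_isPrincipal_of_mem_minimalPrimes _ _ hq'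
    have h2 := Ideal.height_strict_mono_of_isPrime (I := (⊥ : Ideal D)) (bot_lt_iff_ne_bot.2 hne)
    have h3 := Ideal.height_strict_mono_of_isPrime hlt
    rw [Ideal.height_bot] at h2
    have h4 : q.height < 1 := h3.trans_le h1
    rw [Order.lt_one_iff] at h4
    exact h2.ne' h4
  -- The prime `p₂` has height at least two, so it is in none of the height-one primes minimal over
  -- `a`. A prime `q ⊆ p₂` minimal over an `x` avoiding them will be the required one.
  obtain ⟨x, hx, hxa⟩ : ∃ x ∈ p₂.asIdeal, ∀ q ∈ (Ideal.span {a}).minimalPrimes, x ∉ q := by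
    by_contra! hcon
    have := (Ideal.subset_union_prime_finite (f := id) (I := p₂.asIdeal)
      (Ideal.finite_minimalPrimes_of_isNoetherianRing D (Ideal.span {a})) ⊤ ⊤
      (fun q hq _ _ => hq.1.1)).1 (fun x hx => by
        obtain ⟨q, hq, hxq⟩ := hcon x hx
        exact Set.mem_biUnion hq hxq)
    obtain ⟨q, hq, hle⟩ := this
    exact h₀ (hone _ _ p₁.2 hq ((show p₁.asIdeal < p₂.asIdeal from h₁₂).trans_le hle))
  obtain ⟨q, hq, hqp⟩ := Ideal.exists_minimalPrimes_le (I := Ideal.span {x}) (J := p₂.asIdeal)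
    ((Ideal.span_singleton_le_iff_mem _).2 hx)
  have hqprime := hq.1.1
  have hxq : x ∈ q := hq.1.2 (Ideal.mem_span_singleton_self x)
  obtain ⟨q', hq', hle'⟩ := Ideal.exists_minimalPrimes_le (I := Ideal.span {a}) (J := p₂.asIdeal)
    ((Ideal.span_singleton_le_iff_mem _).2 hπ)
  refine ⟨q, hqprime, ?_, ?_⟩
  · rintro rfl
    rw [Ideal.mem_bot] at hxq
    exact hxa q' hq' (hxq ▸ q'.zero_mem)
  by_contra hne
  -- Otherwise `q` lies over the same maximal ideal of `A` as `p₂` and contains `a`. Having height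
  -- at most one, it would be minimal over `a`, contrary to the choice of `x`.
  have hmax : (q.comap (algebraMap A D)).IsMaximal :=
    IsPrime.to_maximal_ideal hne
  have heq := hmax.eq_of_le (J := p₂.asIdeal.comap (algebraMap A D))
    (Ideal.IsPrime.ne_top inferInstance) (Ideal.comap_mono hqp)
  have haq : a ∈ q := by
    have : π ∈ q.comap (algebraMap A D) := heq ▸ hπ
    exact this
  obtain ⟨q₁, hq₁, hle₁⟩ := Ideal.exists_minimalPrimes_le (I := Ideal.span {a}) (J := q)
    ((Ideal.span_singleton_le_iff_mem _).2 haq)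
  have hq₁p := hq₁.1.1
  have hq₁0 : q₁ ≠ ⊥ := by
    rintro rfl
    exact ha0 (hq₁.1.2 (Ideal.mem_span_singleton_self a))
  have h1 := Ideal.height_le_one_of_isPrincipal_of_mem_minimalPrimes _ _ hq
  rcases eq_or_lt_of_le hle₁ with h | h
  · exact hxa q₁ hq₁ (h ▸ hxq)
  · have h2 := Ideal.height_strict_mono_of_isPrime (I := (⊥ : Ideal D)) (bot_lt_iff_ne_bot.2 hq₁0)
    have h3 := Ideal.height_strict_mono_of_isPrime h
    rw [Ideal.height_bot] at h2
    have h4 : q₁.height < 1 := h3.trans_le h1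
    rw [Order.lt_one_iff] at h4
    exact h2.ne' h4

/-! ### Positive depth of the closed fibres -/

section Depth

variable {A : Type u} [CommRing A] {N : Type v} [CommRing N] [Algebra A N] [Module.Flat A N]

lemma algebraMap_mem_nonZeroDivisors_of_flat [IsDomain A] {π : A} (hπ : π ≠ 0) :
    algebraMap A N π ∈ N⁰ := by
  have h := Module.Flat.isSMulRegular_of_nonZeroDivisors (M := N)
    (mem_nonZeroDivisors_of_ne_zero hπ)
  refine mem_nonZeroDivisors_iff_right.2 fun x hx => h ?_
  change π • x = π • 0
  rw [smul_zero, Algebra.smul_def, mul_comm, hx]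

/-- The closed fibres of a normal scheme have positive depth at the points of codimension at least
two. -/
lemma socleFree_fibreRing_of_isMaximal [IsDomain A] [IsPrincipalIdealRing A]
    [IsNoetherianRing N] (hN : IsNormalRing N)
    (hdim : ∀ n : Ideal N, n.IsMaximal → n.comap (algebraMap A N) ≠ ⊥ → 2 ≤ n.height)
    (t : PrimeSpectrum A) (ht : t.asIdeal ≠ ⊥) :
    SocleFree (FibreRing t N) (FibreRing t N) := by
  have htm : t.asIdeal.IsMaximal := IsPrime.to_maximal_ideal ht
  obtain ⟨π, hπ⟩ := IsPrincipalIdealRing.principal t.asIdeal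
  have hπ0 : π ≠ 0 := by
    rintro rfl
    exact ht (by simpa using hπ)
  have hsurj := toFibre_surjective (S := N) t htm
  intro m hm z hz
  obtain ⟨x, rfl⟩ := hsurj z
  have hn : (m.comap (toFibre t N)).IsMaximal := Ideal.comap_isMaximal_of_surjective _ hsurj
  set n := m.comap (toFibre t N) with hndef
  have hnπ : algebraMap A N π ∈ n := by
    have : π ∈ n.comap (algebraMap A N) := by
      rw [hndef, comap_comap_toFibre, hπ]
      exact Ideal.mem_span_singleton_self π
    exact this
  have h2 := hdim n hn (by rw [hndef, comap_comap_toFibre]; exact ht)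
  by_contra hx
  let O := Localization.AtPrime n
  obtain ⟨hO₁, hO₂⟩ := hN ⟨n, hn.isPrime⟩
  have hO₁ : IsDomain O := hO₁
  have hO₂ : IsIntegrallyClosed O := hO₂
  have hO₃ : IsNoetherianRing O := IsLocalization.isNoetherianRing n.primeCompl O inferInstance
  -- A socle element of `N/π` lifts to `x` with `n * x ⊆ π N`; depth two of the local ring at `n`
  -- makes `x` divisible by `π` there.
  have hdvd : algebraMap N O (algebraMap A N π) ∣ algebraMap N O x := by
    refine dvd_of_forall_mem_maximalIdeal ?_ ?_ fun a ha => ?_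
    · rw [← WithBot.coe_le_coe, IsLocalRing.maximalIdeal_height_eq_ringKrullDim,
        IsLocalization.AtPrime.ringKrullDim_eq_height n O]
      exact WithBot.coe_le_coe.2 h2
    · intro h0
      obtain ⟨⟨s, hs⟩, h⟩ := (IsLocalization.map_eq_zero_iff n.primeCompl O _).1 h0
      have := (mul_right_mem_nonZeroDivisors_eq_zero_iff
        (algebraMap_mem_nonZeroDivisors_of_flat (N := N) hπ0)).1 h
      exact hs (by rw [show s = 0 from this]; exact n.zero_mem)
    · obtain ⟨⟨b, s⟩, hbs⟩ := IsLocalization.surj n.primeCompl a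
      have hs := IsLocalization.map_units O s
      have hb : b ∈ n := by
        rw [← IsLocalization.AtPrime.to_map_mem_maximal_iff O n, ← hbs]
        exact Ideal.mul_mem_right _ _ ha
      have h1 : toFibre t N (b * x) = 0 := by
        rw [map_mul]
        exact hz _ hb
      obtain ⟨y, hy⟩ := (toFibre_eq_zero_iff t htm hπ).1 h1
      rw [← hs.dvd_mul_right, mul_right_comm, hbs, ← map_mul, hy, Algebra.smul_def, map_mul]
      exact dvd_mul_right _ _
  obtain ⟨c, hc⟩ := hdvd
  obtain ⟨⟨y, s⟩, hys⟩ := IsLocalization.surj n.primeCompl c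
  have h3 : algebraMap N O (x * s) = algebraMap N O (algebraMap A N π * y) := by
    rw [map_mul, hc, mul_assoc, hys, map_mul]
  obtain ⟨u, hu⟩ := (IsLocalization.eq_iff_exists n.primeCompl O).1 h3
  have h4 : toFibre t N (u * s : N) * toFibre t N x = 0 := by
    rw [← map_mul, toFibre_eq_zero_iff t htm hπ]
    refine ⟨u * y, ?_⟩
    rw [Algebra.smul_def, mul_assoc, mul_comm (s : N), hu]
    ring
  -- The denominator `u * s` is invertible modulo `n`, and `n` kills the class of `x`, so vanishing
  -- after multiplication by `u * s` suffices.
  obtain ⟨r, i, hi, hri⟩ := hn.exists_inv (u * s).2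
  have h5 : toFibre t N i * toFibre t N x = 0 := hz _ hi
  apply hx
  rw [← one_mul (toFibre t N x), ← map_one (toFibre t N), ← hri, map_add, add_mul, h5, add_zero,
    map_mul, mul_assoc]
  exact (congrArg (toFibre t N r * ·) h4).trans (mul_zero _)

end Depth

/-! ### Positive depth of the generic fibre -/

section Generic

variable {A : Type u} [CommRing A] {B : Type w} {N : Type v}
  [CommRing B] [CommRing N] [Algebra A B] [Algebra A N] [Algebra B N] [IsScalarTower A B N]

lemma le_of_comap_toFibre_le {S : Type v} [CommRing S] [Algebra A S] (t : PrimeSpectrum A)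
    {p q : Ideal (FibreRing t S)} [q.IsPrime]
    (h : p.comap (toFibre t S) ≤ q.comap (toFibre t S)) : p ≤ q := by
  intro z hz
  obtain ⟨r, hr, s, hrs⟩ := exists_smul_eq_toFibre t z
  have h1 : s ∈ p.comap (toFibre t S) := by
    rw [Ideal.mem_comap, ← hrs]
    exact Ideal.mul_mem_left _ _ hz
  have h2 : algebraMap A (FibreRing t S) r * z ∈ q := hrs ▸ h h1
  exact (Ideal.unit_mul_mem_iff_mem q (isUnit_algebraMap_fibreRing t hr)).1 h2

/-- The generic fibre of the normalization has positive depth if all components have dimension at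
least two. -/
lemma IsNormalization.socleFree_fibreRing [IsDomain A] [IsPrincipalIdealRing A]
    [IsNoetherianRing B] [IsReduced B] [Module.Flat A N]
    (hN : IsNormalization B N) (hdim : ∀ p ∈ minimalPrimes B, 1 < ringKrullDim (B ⧸ p))
    (t : PrimeSpectrum A) (ht : t.asIdeal = ⊥) :
    SocleFree (FibreRing t N) (FibreRing t N) := by
  have hinjB : ∀ b : B, algebraMap B N b = 0 → b = 0 := fun e he => by
    rw [hN.algebraMap_eq_zero_iff] at he
    exact IsNilpotent.eq_zero he
  intro m hm z hz
  obtain ⟨r, hr, x, hrx⟩ := exists_smul_eq_toFibre t z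
  by_contra hz0
  have hx0 : x ≠ 0 := by
    rintro rfl
    rw [map_zero, (isUnit_algebraMap_fibreRing t hr).mul_right_eq_zero] at hrx
    exact hz0 hrx
  set P := m.comap (toFibre t N) with hP
  have hPA : P.comap (algebraMap A N) = ⊥ := by rw [hP, comap_comap_toFibre, ht]
  have hPx : ∀ y ∈ P, y * x = 0 := by
    intro y hy
    refine toFibre_injective t ht ?_
    have := hz _ hy
    rw [smul_eq_mul] at this
    rw [map_mul, map_zero, ← hrx, mul_left_comm, this, mul_zero]
  obtain ⟨b, hb, a, hba⟩ := hN.exists_mul_eq x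
  have ha0 : a ≠ 0 := by
    rintro rfl
    rw [map_zero] at hba
    exact hx0 ((mul_left_mem_nonZeroDivisors_eq_zero_iff (hN.algebraMap_mem _ hb)).1 hba)
  set p := P.comap (algebraMap B N) with hp
  have hpa : ∀ y ∈ p, y * a = 0 := by
    intro y hy
    apply hinjB
    rw [map_mul, ← hba, mul_left_comm, hPx _ hy, mul_zero]
  -- The contraction `p` of the socle prime kills `a ≠ 0`. In a reduced ring some minimal prime
  -- misses `a`, so it contains `p`, and `p` is itself minimal.
  obtain ⟨q, hq, haq⟩ : ∃ q ∈ minimalPrimes B, a ∉ q := by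
    by_contra! hcon
    have : a ∈ sInf (⊥ : Ideal B).minimalPrimes := by
      rw [Submodule.mem_sInf]
      exact hcon
    rw [Ideal.sInf_minimalPrimes] at this
    exact ha0 (IsNilpotent.eq_zero this)
  have hqp := hq.1.1
  have hpq : p = q := by
    have hle : p ≤ q := fun y hy => (hqp.mem_or_mem (by
      rw [hpa y hy]; exact q.zero_mem)).resolve_right haq
    exact le_antisymm hle (hq.2 ⟨inferInstance, bot_le⟩ hle)
  have hpA : p.comap (algebraMap A B) = ⊥ := by
    rw [hp, Ideal.comap_comap, ← IsScalarTower.algebraMap_eq, hPA]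
  have hinj : Function.Injective (algebraMap A (B ⧸ p)) := by
    rw [injective_iff_map_eq_zero]
    intro c hc
    have : c ∈ p.comap (algebraMap A B) := Ideal.Quotient.eq_zero_iff_mem (I := p).1 hc
    rwa [hpA] at this
  -- The component `B ⧸ p` has dimension greater than one. A nonzero prime of it over the generic
  -- point lifts to a prime of the generic fibre strictly above `m`, contradicting maximality.
  obtain ⟨Q', hQ', hne, hQA⟩ := exists_isPrime_comap_eq_bot hinj (hdim p (hpq ▸ hq))
  have := hN.isIntegral
  have hle : P.comap (algebraMap B N) ≤ Q'.comap (Ideal.Quotient.mk p) := by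
    intro y hy
    rw [Ideal.mem_comap, Ideal.Quotient.eq_zero_iff_mem.2 hy]
    exact Q'.zero_mem
  obtain ⟨Q, hPQ, hQ, hQc⟩ := Ideal.exists_ideal_over_prime_of_isIntegral
    (Q'.comap (Ideal.Quotient.mk p)) P hle
  obtain ⟨m', hm', hm'Q⟩ := exists_comap_toFibre_eq t Q (by
    rw [IsScalarTower.algebraMap_eq A B N, ← Ideal.comap_comap, hQc, Ideal.comap_comap, ht]
    exact hQA)
  have hmm' : m ≤ m' := le_of_comap_toFibre_le t (by rw [hm'Q]; exact hPQ)
  have heq := hm.eq_of_le hm'.ne_top hmm'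
  refine hne (eq_bot_iff.2 fun y hy => ?_)
  obtain ⟨y, rfl⟩ := Ideal.Quotient.mk_surjective y
  have h1 : y ∈ p := by
    rw [hp, hP, heq, hm'Q, hQc]
    exact hy
  exact Ideal.Quotient.eq_zero_iff_mem.2 h1

end Generic

/-! ### Finiteness of normalizations over a Nagata ring -/

section Finiteness

lemma isNormalization_integralClosure (D : Type u) [CommRing D] [IsReduced D] :
    IsNormalization D (integralClosure D (FractionRing D)) := by
  refine ⟨inferInstance, (isIntegrallyClosed_iff_isIntegrallyClosedIn (FractionRing D)).2
    inferInstance, fun x => ?_, fun b hb => ?_, fun y => ?_⟩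
  · rw [nilradical_eq_zero, Ideal.zero_eq_bot, Ideal.mem_bot,
      ← map_eq_zero_iff _ (IsFractionRing.injective D (FractionRing D))]
    exact Subtype.ext_iff
  · rw [mem_redRegular_iff_of_isReduced] at hb
    rw [mem_nonZeroDivisors_iff_right]
    intro z hz
    have h1 : (z : FractionRing D) * algebraMap _ _ b = 0 := congrArg Subtype.val hz
    exact Subtype.ext (((IsLocalization.map_units _ (⟨_, hb⟩ : D⁰)).mul_left_eq_zero).1 h1)
  · obtain ⟨⟨a, d⟩, h⟩ := IsLocalization.surj D⁰ (y : FractionRing D)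
    exact ⟨d, mem_redRegular_iff_of_isReduced.2 d.2, a, Subtype.ext (by rw [mul_comm]; exact h)⟩

/-- The normalization of a finite domain extension of a Nagata ring is finite. -/
lemma IsNagata.exists_finite_normalization {R D : Type v} [CommRing R] (hR : IsNagata R)
    [CommRing D] [IsDomain D] (g : R →+* D) (hg : g.Finite) :
    ∃ (C : Type v) (_ : CommRing C) (_ : Algebra D C), IsNormalization D C ∧ Module.Finite D C := by
  have hker : (RingHom.ker g).IsPrime := RingHom.ker_isPrime g
  have hN2 := hR.2 ⟨RingHom.ker g, hker⟩
  simp only at hN2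
  set q := RingHom.ker g
  let _ : Algebra R D := g.toAlgebra
  let _ : Algebra (R ⧸ q) D := (Ideal.Quotient.lift q g fun x hx => hx).toAlgebra
  have htower : IsScalarTower R (R ⧸ q) D := .of_algebraMap_eq fun x => rfl
  have hRD : Module.Finite R D := hg
  have hfin : Module.Finite (R ⧸ q) D := Module.Finite.of_restrictScalars_finite R _ _
  have hinj : Function.Injective (algebraMap (R ⧸ q) D) := RingHom.kerLift_injective g
  have hfaith : FaithfulSMul (R ⧸ q) D := (faithfulSMul_iff_algebraMap_injective _ _).2 hinj
  let L := FractionRing D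
  let _ : Algebra (FractionRing (R ⧸ q)) L := FractionRing.liftAlgebra (R ⧸ q) L
  have hst : IsScalarTower (R ⧸ q) (FractionRing (R ⧸ q)) L :=
    FractionRing.isScalarTower_liftAlgebra (R ⧸ q) L
  have hfd : FiniteDimensional (FractionRing (R ⧸ q)) L := .of_isLocalization (R ⧸ q) D (R ⧸ q)⁰
  have hC : Module.Finite (R ⧸ q) (integralClosure (R ⧸ q) L) := hN2 L
  refine ⟨integralClosure D L, inferInstance, inferInstance, isNormalization_integralClosure D, ?_⟩
  -- `D` is integral over `R ⧸ q`, so both have the same integral closure in `L`, and the N-2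
  -- property for the finite extension `L` applies.
  have hle : ∀ x : L, IsIntegral D x → IsIntegral (R ⧸ q) x := fun x hx =>
    isIntegral_trans (R := R ⧸ q) x hx
  let e : integralClosure (R ⧸ q) L →ₗ[R ⧸ q] integralClosure D L :=
    { toFun := fun x => ⟨x.1, x.2.tower_top⟩
      map_add' := fun _ _ => rfl
      map_smul' := fun _ _ => rfl }
  have he : Function.Surjective e := fun x => ⟨⟨x.1, hle _ x.2⟩, rfl⟩
  have : Module.Finite (R ⧸ q) (integralClosure D L) := Module.Finite.of_surjective e he
  exact Module.Finite.of_restrictScalars_finite (R ⧸ q) D _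

lemma IsNormalization.exists_of_ringEquiv {D : Type u} {D' : Type v} {C : Type w} [CommRing D]
    [CommRing D'] [CommRing C] [Algebra D' C] (h : IsNormalization D' C) [Module.Finite D' C]
    (e : D ≃+* D') : ∃ _ : Algebra D C, IsNormalization D C ∧ Module.Finite D C := by
  have hnil : ∀ x, e x ∈ nilradical D' ↔ x ∈ nilradical D := fun x =>
    IsNilpotent.map_iff e.injective
  have hreg : ∀ x, e x ∈ redRegular D' ↔ x ∈ redRegular D := fun x => by
    simp only [mem_redRegular_iff, e.surjective.forall, ← map_mul, hnil]
  let _ : Algebra D C := ((algebraMap D' C).comp e.toRingHom).toAlgebra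
  have hmap : ∀ x, algebraMap D C x = algebraMap D' C (e x) := fun _ => rfl
  refine ⟨inferInstance, ⟨⟨fun y => ?_⟩, h.isIntegrallyClosed, fun x => ?_, fun b hb => ?_,
    fun s => ?_⟩, ?_⟩
  · exact ((RingHom.finite_algebraMap.2 ‹_›).comp e.finite).to_isIntegral y
  · rw [hmap, h.algebraMap_eq_zero_iff, hnil]
  · exact h.algebraMap_mem _ ((hreg b).2 hb)
  · obtain ⟨b, hb, r, hbr⟩ := h.exists_mul_eq s
    obtain ⟨b, rfl⟩ := e.surjective b
    obtain ⟨r, rfl⟩ := e.surjective r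
    exact ⟨b, (hreg b).1 hb, r, hbr⟩
  · exact (RingHom.finite_algebraMap.2 ‹_›).comp e.finite

/-- The normalization is finite if the normalizations of all irreducible components are. -/
lemma IsNormalization.finite {B : Type u} [CommRing B] [IsNoetherianRing B] [IsReduced B]
    {N : Type v} [CommRing N] [Algebra B N] (hN : IsNormalization B N)
    (h : ∀ p ∈ minimalPrimes B, ∃ (C : Type w) (_ : CommRing C) (_ : Algebra (B ⧸ p) C),
      IsNormalization (B ⧸ p) C ∧ Module.Finite (B ⧸ p) C) : Module.Finite B N := by
  have key : ∀ p : minimalPrimes B, ∃ (C : Type w) (_ : CommRing C) (_ : Algebra B C)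
      (ρ : N →ₐ[B] C), Module.Finite B C ∧ ∀ b, algebraMap B C b = 0 → b ∈ p.1 := by
    rintro ⟨p, hp⟩
    have hpp : p.IsPrime := hp.1.1
    obtain ⟨C, _, _, hC, hfin⟩ := h p hp
    let _ : Algebra B C := ((algebraMap (B ⧸ p) C).comp (Ideal.Quotient.mk p)).toAlgebra
    have htower : IsScalarTower B (B ⧸ p) C := .of_algebraMap_eq fun x => rfl
    obtain ⟨ρ, -⟩ := hN.exists_quotient_algHom hC hpp.isRadical fun d hd => by
      rw [mem_redRegular_iff_of_isReduced] at hd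
      refine mem_nonZeroDivisors_of_ne_zero fun h0 => ?_
      rw [Ideal.Quotient.eq_zero_iff_mem] at h0
      exact notMem_nonZeroDivisors_of_mem_mem_minimalPrimes h0 hp hd
    refine ⟨C, inferInstance, inferInstance, ρ, Module.Finite.trans (B ⧸ p) C, fun b hb => ?_⟩
    have := (hC.algebraMap_eq_zero_iff (Ideal.Quotient.mk p b)).1 hb
    rwa [nilradical_eq_zero, Ideal.zero_eq_bot, Ideal.mem_bot,
      Ideal.Quotient.eq_zero_iff_mem] at this
  choose C _ _ ρ hfin hρ using key
  have hfinite : Finite (minimalPrimes B) :=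
    (minimalPrimes.finite_of_isNoetherianRing B).to_subtype
  -- `N` embeds into the finite product of the normalizations of the components: the numerator of an
  -- element of the kernel lies in all minimal primes.
  let f : N →ₗ[B] ∀ p, C p := LinearMap.pi fun p => (ρ p).toLinearMap
  refine Module.Finite.of_injective f ?_
  rw [injective_iff_map_eq_zero]
  intro x hx
  obtain ⟨b, hb, a, hba⟩ := hN.exists_mul_eq x
  have ha : a = 0 := by
    have : a ∈ sInf (⊥ : Ideal B).minimalPrimes := by
      rw [Submodule.mem_sInf]
      intro p hp
      refine hρ ⟨p, hp⟩ a ?_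
      rw [← (ρ ⟨p, hp⟩).commutes, ← hba, map_mul]
      have : ρ ⟨p, hp⟩ x = 0 := congrFun hx ⟨p, hp⟩
      rw [this, mul_zero]
    rw [Ideal.sInf_minimalPrimes] at this
    exact IsNilpotent.eq_zero this
  rw [ha, map_zero] at hba
  exact (mul_left_mem_nonZeroDivisors_eq_zero_iff (hN.algebraMap_mem _ hb)).1 hba

end Finiteness

/-! ### Finite normalization for closed subschemes and fibres -/

section Finiteness

/-- Over a Nagata ring, the normalization of a closed subscheme is finite. -/
lemma IsNagata.finite_of_isNormalization {R : Type v} [CommRing R] (hR : IsNagata R) {I : Ideal R}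
    [IsReduced (R ⧸ I)] {N : Type w} [CommRing N] [Algebra (R ⧸ I) N]
    (hN : IsNormalization (R ⧸ I) N) : Module.Finite (R ⧸ I) N := by
  have := hR.1
  refine hN.finite fun p hp => ?_
  have hpp : p.IsPrime := hp.1.1
  exact hR.exists_finite_normalization ((Ideal.Quotient.mk p).comp (Ideal.Quotient.mk I))
    ((RingHom.Finite.of_surjective _ Ideal.Quotient.mk_surjective).comp
      (RingHom.Finite.of_surjective _ Ideal.Quotient.mk_surjective))

variable {A : Type u} [CommRing A] {N : Type v} [CommRing N] [Algebra A N] (t : PrimeSpectrum A)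

/-- The normalization of a reduced closed fibre is finite. -/
lemma IsNagata.finite_normalization_fibreRing {R : Type v} [CommRing R] (hR : IsNagata R)
    (g : R →+* N) (hg : g.Finite) (ht : t.asIdeal.IsMaximal) [IsReduced (FibreRing t N)] :
    Module.Finite (FibreRing t N) (Normalization (FibreRing t N)) := by
  have := hR.1
  let _ := g.toAlgebra
  have hfin : Module.Finite R N := hg
  have hN : IsNoetherianRing N := IsNoetherianRing.of_finite R N
  have hE := isNoetherianRing_fibreRing t (S := N)
  refine (isNormalization_normalization (FibreRing t N)).finite fun p hp => ?_
  have hpp : p.IsPrime := hp.1.1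
  have hpc : (p.comap (toFibre t N)).IsPrime := inferInstance
  -- A component of a closed fibre is a quotient of `N`, hence a domain finite over `R`.
  obtain ⟨C, _, _, hC, hCfin⟩ := hR.exists_finite_normalization
    ((Ideal.Quotient.mk (p.comap (toFibre t N))).comp g)
    ((RingHom.Finite.of_surjective _ Ideal.Quotient.mk_surjective).comp hg)
  let h : N ⧸ p.comap (toFibre t N) →+* FibreRing t N ⧸ p :=
    Ideal.quotientMap p (toFibre t N).toRingHom le_rfl
  have hinj : Function.Injective h := Ideal.quotientMap_injective' le_rfl
  have hsurj : Function.Surjective h := Ideal.quotientMap_surjective (toFibre_surjective t ht)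
  let e : (FibreRing t N ⧸ p) ≃+* N ⧸ p.comap (toFibre t N) :=
    (RingEquiv.ofBijective h ⟨hinj, hsurj⟩).symm
  obtain ⟨_, h₁, h₂⟩ := hC.exists_of_ringEquiv e
  exact ⟨C, inferInstance, inferInstance, h₁, h₂⟩

/-- The generic fibre of a normal scheme is normal. -/
lemma IsNormalRing.fibreRing_of_eq_bot [IsDomain A] [Module.Flat A N] (hN : IsNormalRing N)
    (ht : t.asIdeal = ⊥) : IsNormalRing (FibreRing t N) := by
  let _ : Algebra N (FibreRing t N) := (toFibre t N).toRingHom.toAlgebra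
  have hmap : ∀ a, algebraMap N (FibreRing t N) (algebraMap A N a) =
      algebraMap A (FibreRing t N) a := (toFibre t N).commutes
  have : IsLocalization (Algebra.algebraMapSubmonoid N A⁰) (FibreRing t N) := by
    constructor
    refine ⟨?_, ?_, ?_⟩
    · rintro ⟨_, a, ha, rfl⟩
      simp only [hmap]
      refine isUnit_algebraMap_fibreRing t ?_
      rw [ht]
      exact nonZeroDivisors.ne_zero ha
    · intro z
      obtain ⟨r, hr, s, h⟩ := exists_smul_eq_toFibre t z
      rw [ht] at hr
      refine ⟨⟨s, algebraMap A N r, r, mem_nonZeroDivisors_of_ne_zero hr, rfl⟩, ?_⟩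
      simp only [hmap]
      rw [mul_comm, h]
      rfl
    · intro x y h
      exact ⟨1, by rw [toFibre_injective t ht h]⟩
  exact hN.of_isLocalization (Algebra.algebraMapSubmonoid N A⁰)

lemma IsNormalRing.finite_normalization {E : Type u} [CommRing E] [IsNoetherianRing E]
    (hE : IsNormalRing E) : Module.Finite E (Normalization E) := by
  have := hE.isReduced
  exact Module.Finite.of_surjective (Algebra.linearMap E (Normalization E))
    ((isNormalization_normalization E).surjective_iff.2 hE)

end Finiteness

/-! ### The components of dimension greater than `i` -/

section PartGT

variable {R : Type v} [CommRing R] (i : ℕ)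

lemma mem_idealGT {x : R} : x ∈ idealGT i R ↔
    ∀ p ∈ minimalPrimes R, (i : WithBot ℕ∞) < ringKrullDim (R ⧸ p) → x ∈ p := by
  rw [idealGT, Submodule.mem_sInf]
  exact ⟨fun h p hp hd => h p ⟨hp, hd⟩, fun h p hp => h p hp.1 hp.2⟩

lemma isRadical_idealGT : (idealGT i R).IsRadical := by
  rintro x ⟨n, hx⟩
  rw [mem_idealGT] at hx ⊢
  intro p hp hdim
  have := hp.1.1
  exact this.mem_of_pow_mem n (hx p hp hdim)

instance isReduced_partGT : IsReduced (PartGT i R) :=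
  (Ideal.isRadical_iff_quotient_reduced _).1 (isRadical_idealGT i)

lemma mk_mem_nonZeroDivisors_partGT {d : R} (hd : ∀ p ∈ minimalPrimes R, d ∉ p) :
    Ideal.Quotient.mk (idealGT i R) d ∈ (PartGT i R)⁰ := by
  rw [mem_nonZeroDivisors_iff_right]
  intro x hx
  obtain ⟨x, rfl⟩ := Ideal.Quotient.mk_surjective x
  rw [← map_mul, Ideal.Quotient.eq_zero_iff_mem, mem_idealGT] at hx
  rw [Ideal.Quotient.eq_zero_iff_mem, mem_idealGT]
  intro p hp hdim
  have := hp.1.1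
  exact (this.mem_or_mem (hx p hp hdim)).resolve_right (hd p hp)

lemma notMem_of_mem_redRegular {d : R} (hd : d ∈ redRegular R) {p : Ideal R}
    (hp : p ∈ minimalPrimes R) : d ∉ p := by
  intro h
  have hp' : p ∈ (nilradical R).minimalPrimes := by
    rw [nilradical, Ideal.radical_minimalPrimes]
    exact hp
  obtain ⟨y, hy, hdy⟩ := Ideal.exists_mul_mem_of_mem_minimalPrimes hp' h
  exact hy (mem_redRegular_iff.1 hd y (by rwa [mul_comm]))

lemma algebraMap_notMem_of_mem_minimalPrimes {A : Type u} [CommRing A] [IsDomain A] [Algebra A R]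
    [Module.Flat A R] {a : A} (ha : a ≠ 0) {p : Ideal R} (hp : p ∈ minimalPrimes R) :
    algebraMap A R a ∉ p := fun h =>
  notMem_nonZeroDivisors_of_mem_mem_minimalPrimes h hp (algebraMap_mem_nonZeroDivisors_of_flat ha)

lemma flat_of_algebraMap_mem_nonZeroDivisors {A : Type u} {N : Type v} [CommRing A] [IsDomain A]
    [IsPrincipalIdealRing A] [CommRing N] [Algebra A N]
    (h : ∀ a : A, a ≠ 0 → algebraMap A N a ∈ N⁰) : Module.Flat A N := by
  have : Module.IsTorsionFree A N := by
    refine ⟨fun a ha x y hxy => ?_⟩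
    have h1 : (x - y) * algebraMap A N a = 0 := by
      rw [mul_comm, ← Algebra.smul_def, smul_sub, sub_eq_zero]
      exact hxy
    exact sub_eq_zero.1 ((mul_right_mem_nonZeroDivisors_eq_zero_iff (h a ha.ne_zero)).1 h1)
  infer_instance

instance flat_partGT {A : Type u} [CommRing A] [IsDomain A] [IsPrincipalIdealRing A] [Algebra A R]
    [Module.Flat A R] : Module.Flat A (PartGT i R) :=
  flat_of_algebraMap_mem_nonZeroDivisors fun _ ha =>
    mk_mem_nonZeroDivisors_partGT i fun _ hp => algebraMap_notMem_of_mem_minimalPrimes ha hp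

/-- The irreducible components of `R^{>i}` have dimension greater than `i`. -/
lemma lt_ringKrullDim_of_mem_minimalPrimes_partGT [IsNoetherianRing R] {p : Ideal (PartGT i R)}
    (hp : p ∈ minimalPrimes (PartGT i R)) : (i : WithBot ℕ∞) < ringKrullDim (PartGT i R ⧸ p) := by
  have hpp : p.IsPrime := hp.1.1
  have hfin : {p | p ∈ minimalPrimes R ∧ (i : WithBot ℕ∞) < ringKrullDim (R ⧸ p)}.Finite :=
    (minimalPrimes.finite_of_isNoetherianRing R).subset fun _ h => h.1
  obtain ⟨p₀, ⟨hp₀, hdim⟩, hle⟩ : ∃ p₀ ∈ {p | p ∈ minimalPrimes R ∧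
      (i : WithBot ℕ∞) < ringKrullDim (R ⧸ p)}, p₀ ≤ p.comap (Ideal.Quotient.mk (idealGT i R)) := by
    -- The intersection defining `idealGT` is finite, so a prime containing it contains one of the
    -- intersected primes.
    have hle : hfin.toFinset.inf id ≤ p.comap (Ideal.Quotient.mk (idealGT i R)) := by
      intro x hx
      have : x ∈ idealGT i R := (mem_idealGT i).2 fun q hq hd =>
        Finset.inf_le (f := id) (hfin.mem_toFinset.2 ⟨hq, hd⟩) hx
      rw [Ideal.mem_comap, Ideal.Quotient.eq_zero_iff_mem.2 this]
      exact p.zero_mem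
    obtain ⟨q, hq, h⟩ := (Ideal.IsPrime.inf_le' (hpp.comap _)).1 hle
    exact ⟨q, hfin.mem_toFinset.1 hq, h⟩
  have hp₀p : p₀.IsPrime := hp₀.1.1
  have hI : idealGT i R ≤ p₀ := fun x hx => (mem_idealGT i).1 hx p₀ hp₀ hdim
  have hcomap : (p₀.map (Ideal.Quotient.mk (idealGT i R))).comap (Ideal.Quotient.mk _) = p₀ := by
    rw [Ideal.comap_map_of_surjective _ Ideal.Quotient.mk_surjective, ← RingHom.ker_eq_comap_bot,
      Ideal.mk_ker, sup_eq_left.2 hI]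
  have hprime : (p₀.map (Ideal.Quotient.mk (idealGT i R))).IsPrime :=
    Ideal.map_isPrime_of_surjective Ideal.Quotient.mk_surjective (by rwa [Ideal.mk_ker])
  have hle' : p₀.map (Ideal.Quotient.mk (idealGT i R)) ≤ p := Ideal.map_le_iff_le_comap.2 hle
  have heq : p.comap (Ideal.Quotient.mk (idealGT i R)) = p₀ := by
    rw [← hcomap, le_antisymm hle' (hp.2 ⟨hprime, bot_le⟩ hle')]
  subst heq
  rwa [← ringKrullDim_eq_of_ringEquiv (RingEquiv.ofBijective
    (Ideal.quotientMap p (Ideal.Quotient.mk (idealGT i R)) le_rfl)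
    ⟨Ideal.quotientMap_injective' le_rfl,
      Ideal.quotientMap_surjective Ideal.Quotient.mk_surjective⟩)]

end PartGT

/-! ### Flat families with normal fibres are integrally closed -/

section IntegrallyClosed

/-- The integral equation of `a / b` is used with cleared denominators; in this form it passes along
ring maps, such as the one to the generic fibre. -/
lemma IsNormalRing.exists_eq_mul {D : Type u} [CommRing D] (hD : IsNormalRing D) {a b : D}
    (hb : b ∈ D⁰) {F : Polynomial D} (hF : F.Monic) (h : (F.scaleRoots b).eval a = 0) :
    ∃ c, a = b * c := by
  have := mem_of_forall_prime (I := (Ideal.span {b}).colon {a}) ?_ 1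
  · rw [Submodule.mem_colon_singleton, one_smul, Ideal.mem_span_singleton] at this
    exact this
  · intro p
    obtain ⟨s, hs, c, hc⟩ := (hD p).exists_mul_eq (a := a) (b := b) (fun s hs h0 => hs (by
      rw [(mul_right_mem_nonZeroDivisors_eq_zero_iff hb).1 h0]; exact p.asIdeal.zero_mem)) hF h
    refine ⟨s, hs, ?_⟩
    rw [Submodule.mem_colon_singleton, smul_eq_mul, hc]
    exact Ideal.mul_mem_right _ _ (Ideal.mem_span_singleton_self b)

variable {A : Type u} [CommRing A] [IsDomain A] [IsPrincipalIdealRing A] {S : Type v} [CommRing S]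
  [Algebra A S] [Module.Flat A S]

/-- Elements of the generic fibre which are integral over `S` belong to `S`, if the closed fibres
are reduced. -/
lemma exists_eq_algebraMap_of_isIntegral (hred : ∀ t : PrimeSpectrum A, IsReduced (FibreRing t S))
    {Q : Type w} [CommRing Q] [Algebra S Q] [IsFractionRing S Q] {r : A} (hr : r ≠ 0) :
    ∀ (z : Q) (y : S), IsIntegral S z → algebraMap S Q (algebraMap A S r) * z = algebraMap S Q y →
      ∃ s, z = algebraMap S Q s := by
  induction r using WfDvdMonoid.induction_on_irreducible with
  | zero => exact absurd rfl hr
  | unit u hu =>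
    intro z y _ h
    obtain ⟨v, hv⟩ := ((hu.map (algebraMap A S)).map (algebraMap S Q)).exists_left_inv
    obtain ⟨w, hw⟩ := (hu.map (algebraMap A S)).exists_left_inv
    refine ⟨w * y, ?_⟩
    rw [map_mul, ← h, ← mul_assoc, ← map_mul, hw, map_one, one_mul]
  | mul r π hr0 hπ ih =>
    intro z y hz h
    obtain ⟨F, hF, hroot⟩ : IsIntegral S (algebraMap S Q (algebraMap A S r) * z) :=
      isIntegral_algebraMap.mul hz
    set w := algebraMap S Q (algebraMap A S r) * z
    have hπw : algebraMap S Q (algebraMap A S π) * w = algebraMap S Q y := by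
      rw [← h, map_mul, map_mul, mul_assoc]
    let t : PrimeSpectrum A := ⟨Ideal.span {π}, (Ideal.span_singleton_prime hπ.ne_zero).2 hπ.prime⟩
    have ht : t.asIdeal.IsMaximal := PrincipalIdealRing.isMaximal_of_irreducible hπ
    have hev : (F.scaleRoots (algebraMap A S π)).eval y = 0 := by
      apply IsFractionRing.injective S Q
      rw [map_zero, ← Polynomial.eval₂_hom, ← hπw, Polynomial.scaleRoots_eval₂_mul, hroot, mul_zero]
    have hπ0 : toFibre t S (algebraMap A S π) = 0 :=
      (toFibre_eq_zero_iff t ht rfl).2 ⟨1, by rw [Algebra.smul_def, mul_one]⟩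
    -- Here `y = π w` with `w` integral, and modulo `π` the scaled equation has only its leading
    -- term left. Reducedness of the fibre then makes `y` divisible by `π`, and a prime factor of
    -- the denominator can be removed.
    have hnil : toFibre t S y ^ F.natDegree = 0 := by
      have := congrArg (toFibre t S) hev
      rw [Polynomial.eval_eq_sum_range, Polynomial.natDegree_scaleRoots, Finset.sum_range_succ,
        map_add, map_sum, Finset.sum_eq_zero, zero_add, map_zero, Polynomial.coeff_scaleRoots,
        hF.coeff_natDegree, Nat.sub_self, pow_zero, one_mul, one_mul, map_pow] at this
      · exact this
      · intro i hi
        rw [Polynomial.coeff_scaleRoots, map_mul, map_mul, map_pow, hπ0,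
          zero_pow (Nat.sub_ne_zero_of_lt (Finset.mem_range.1 hi)), mul_zero, zero_mul]
    have hy := hred t
    obtain ⟨s, hs⟩ := (toFibre_eq_zero_iff t ht rfl).1 (IsNilpotent.eq_zero ⟨_, hnil⟩)
    refine ih hr0 z s hz ?_
    have hunit : IsUnit (algebraMap S Q (algebraMap A S π)) := IsLocalization.map_units Q
      (⟨_, algebraMap_mem_nonZeroDivisors_of_flat hπ.ne_zero⟩ : S⁰)
    refine hunit.mul_left_cancel ?_
    rw [hπw, hs, Algebra.smul_def, map_mul]

/-- A flat family with normal fibres is integrally closed. -/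
lemma isIntegrallyClosed_of_fibres
    (h : ∀ t : PrimeSpectrum A, IsNormalRing (FibreRing t S)) : IsIntegrallyClosed S := by
  have hred : ∀ t : PrimeSpectrum A, IsReduced (FibreRing t S) := fun t => (h t).isReduced
  rw [isIntegrallyClosed_iff (FractionRing S)]
  intro z hz
  obtain ⟨a, ⟨d, hd⟩, rfl⟩ := IsLocalization.exists_mk'_eq S⁰ z
  obtain ⟨F, hF, hroot⟩ := id hz
  have hev : (F.scaleRoots d).eval a = 0 := by
    apply IsFractionRing.injective S (FractionRing S)
    rw [map_zero, ← Polynomial.eval₂_hom]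
    have h2 := Polynomial.scaleRoots_eval₂_mul (p := F) (algebraMap S (FractionRing S))
      (IsLocalization.mk' _ a ⟨d, hd⟩) d
    rwa [IsLocalization.mk'_spec'_mk, hroot, mul_zero] at h2
  let t : PrimeSpectrum A := ⟨⊥, Ideal.isPrime_bot⟩
  have hdt : toFibre t S d ∈ (FibreRing t S)⁰ := by
    rw [mem_nonZeroDivisors_iff_right]
    intro x hx
    obtain ⟨r, hr, s, hrs⟩ := exists_smul_eq_toFibre t x
    have h1 : toFibre t S (s * d) = 0 := by
      rw [map_mul, ← hrs, mul_assoc, hx, mul_zero]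
    have h2 := toFibre_injective t rfl (h1.trans (map_zero _).symm)
    rw [(mul_right_mem_nonZeroDivisors_eq_zero_iff hd).1 h2, map_zero] at hrs
    exact ((isUnit_algebraMap_fibreRing t hr).mul_right_eq_zero).1 hrs
  -- Normality of the generic fibre gives `a = d * c` there. Hence `a / d` has a denominator from
  -- `A`, which reducedness of the closed fibres removes.
  obtain ⟨c, hc⟩ := (h t).exists_eq_mul hdt (hF.map (toFibre t S).toRingHom)
    (a := toFibre t S a) (by
    rcases subsingleton_or_nontrivial (FibreRing t S) with _ | _
    · exact Subsingleton.elim _ _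
    have := congrArg (toFibre t S).toRingHom hev
    rw [map_zero, ← Polynomial.eval_map_apply, Polynomial.map_scaleRoots] at this
    · exact this
    · rw [hF.leadingCoeff, map_one]
      exact one_ne_zero)
  obtain ⟨r, hr, y, hry⟩ := exists_smul_eq_toFibre t c
  have h1 : algebraMap A S r * a = d * y := by
    refine toFibre_injective t rfl ?_
    rw [map_mul, map_mul, hc, AlgHom.commutes, ← hry]
    ring
  obtain ⟨s, hs⟩ := exists_eq_algebraMap_of_isIntegral hred (Q := FractionRing S) hr
    (IsLocalization.mk' _ a ⟨d, hd⟩) y hz (by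
      rw [← IsLocalization.mk'_one (M := S⁰) (FractionRing S) (algebraMap A S r),
        ← IsLocalization.mk'_mul, h1, IsLocalization.mk'_eq_iff_eq_mul]
      simp [mul_comm])
  exact ⟨s, hs.symm⟩

end IntegrallyClosed

/-! ### Fiberwise normalizations are normalizations -/

section GenericFibre

variable {A : Type u} [CommRing A] {R : Type v} [CommRing R] [Algebra A R]
  {t : PrimeSpectrum A}

lemma comap_toFibre_mem_minimalPrimes (ht : t.asIdeal = ⊥) {q : Ideal (FibreRing t R)}
    (hq : q ∈ minimalPrimes (FibreRing t R)) : q.comap (toFibre t R) ∈ minimalPrimes R := by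
  have hqp : q.IsPrime := hq.1.1
  refine ⟨⟨inferInstance, bot_le⟩, fun p ⟨hp, _⟩ hle => ?_⟩
  obtain ⟨p', hp', rfl⟩ := exists_comap_toFibre_eq t p (by
    rw [ht, eq_bot_iff, ← ht, ← comap_comap_toFibre t q]
    exact Ideal.comap_mono hle)
  exact Ideal.comap_mono (hq.2 ⟨hp', bot_le⟩ (le_of_comap_toFibre_le t hle))

/-- By flatness nonzero elements of `A` are regular in `R`, so every minimal prime of `R` lies over
the generic point. -/
lemma exists_mem_minimalPrimes_fibreRing [IsDomain A] [Module.Flat A R] (ht : t.asIdeal = ⊥)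
    {p : Ideal R}
    (hp : p ∈ minimalPrimes R) :
    ∃ q ∈ minimalPrimes (FibreRing t R), q.comap (toFibre t R) = p := by
  have hpp : p.IsPrime := hp.1.1
  obtain ⟨q, hq, rfl⟩ := exists_comap_toFibre_eq t p (by
    rw [ht, eq_bot_iff]
    intro a ha
    by_contra ha0
    exact algebraMap_notMem_of_mem_minimalPrimes ha0 hp ha)
  refine ⟨q, ⟨⟨hq, bot_le⟩, fun q' ⟨hq', _⟩ hle => ?_⟩, rfl⟩
  exact le_of_comap_toFibre_le t (hp.2 ⟨inferInstance, bot_le⟩ (Ideal.comap_mono hle))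

/-- A finite birational map is an isomorphism near the generic points. -/
lemma IsBirational.exists_mul_eq {B : Type u} {E : Type v} [CommRing B] [CommRing E]
    {f : B →+* E} (hf : IsBirational f) (hfin : f.IsIntegral)
    {p : Ideal B} (hp : p ∈ minimalPrimes B)
    (y : E) : ∃ b ∉ p, ∃ a, f b * y = f a := by
  have hpp : p.IsPrime := hp.1.1
  obtain ⟨q, hq, rfl⟩ := hf.1.surjOn hp
  have hqp : q.IsPrime := hq.1.1
  obtain ⟨x, hx⟩ := (hf.2 ⟨q, hqp⟩ hq).2 (algebraMap E _ y)
  simp only at x hx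
  obtain ⟨⟨a, b, hb⟩, hab⟩ := IsLocalization.surj (q.comap f).primeCompl x
  have h1 := congrArg (Localization.localRingHom (q.comap f) q f rfl) hab
  rw [map_mul, hx, Localization.localRingHom_to_map,
    Localization.localRingHom_to_map, ← map_mul] at h1
  obtain ⟨⟨u, hu⟩, h2⟩ := (IsLocalization.eq_iff_exists q.primeCompl _).1 h1
  simp only at h2
  let _ := f.toAlgebra
  have hint : Algebra.IsIntegral B E := ⟨hfin⟩
  -- The relation for `y` holds after multiplication by some `u ∉ q`, but the multiplier must come
  -- from `B`. If none did, some prime over `p` would contain the annihilator of the error term;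
  -- birationality and incomparability identify this prime with `q`, which misses `u`.
  by_cases hJ : (Ideal.span {y * f b - f a}).annihilator.comap f ≤ q.comap f
  · exfalso
    obtain ⟨q₂, hle, hq₂, hq₂q⟩ := Ideal.exists_ideal_over_prime_of_isIntegral (S := E) (q.comap f)
      (Ideal.span {y * f b - f a}).annihilator hJ
    obtain ⟨q₁, hq₁, hle₁⟩ := Ideal.exists_minimalPrimes_le (I := ⊥) (J := q₂) bot_le
    have hq₁p : q₁.IsPrime := hq₁.1.1
    have h3 : q₁.comap f = q.comap f :=
      le_antisymm ((Ideal.comap_mono hle₁).trans hq₂q.le)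
        (hp.2 ⟨inferInstance, bot_le⟩ ((Ideal.comap_mono hle₁).trans hq₂q.le))
    obtain rfl := hf.1.injOn hq₁ hq h3
    have h4 : q₁ = q₂ := by
      by_contra hne
      have := Ideal.IsIntegral.comap_lt_comap (R := B) (lt_of_le_of_ne hle₁ hne)
      exact this.ne (h3.trans hq₂q.symm)
    refine hu (h4 ▸ hle ((Submodule.mem_annihilator_span_singleton _ _).2 ?_))
    rw [smul_eq_mul, mul_sub, h2, sub_self]
  · obtain ⟨v, hv, hvp⟩ := Set.not_subset.1 hJ
    refine ⟨v * b, hpp.mul_notMem hvp hb, v * a, ?_⟩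
    have h5 := (Submodule.mem_annihilator_span_singleton _ _).1 hv
    rw [smul_eq_mul] at h5
    rw [map_mul, map_mul]
    linear_combination h5

variable [IsDomain A] [IsPrincipalIdealRing A] {S : Type v} [CommRing S] [Algebra A S]

/-- A fiberwise normalization of a flat morphism is a normalization. -/
lemma IsFiberwiseNormalization.isNormalization [IsNoetherianRing R] [Module.Flat A R] [Algebra R S]
    [IsScalarTower A R S] (h : IsFiberwiseNormalization (IsScalarTower.toAlgHom A R S)) :
    IsNormalization R S := by
  obtain ⟨hfin, hflat, hnormal, hbir⟩ := h
  have hRS : Module.Finite R S := RingHom.finite_algebraMap.1 hfin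
  have hmap : ∀ x, IsScalarTower.toAlgHom A R S x = algebraMap R S x := fun _ => rfl
  let t : PrimeSpectrum A := ⟨⊥, Ideal.isPrime_bot⟩
  have hfint := (finite_fibreMap t _ hfin).to_isIntegral
  have hinjR := toFibre_injective (S := R) t rfl
  have hinjS := toFibre_injective (S := S) t rfl
  have hredS : IsReduced S := by
    have := (hnormal t).isReduced
    exact isReduced_of_injective (toFibre t S) hinjS
  have hSN : IsNoetherianRing S := IsNoetherianRing.of_finite R S
  have hES := isNoetherianRing_fibreRing t (S := S)
  -- An empty generic fibre means `R = 0`, since minimal primes of a flat algebra lie over the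
  -- generic point.
  by_cases htR : t ∈ Set.range (PrimeSpectrum.comap (algebraMap A R))
  swap
  · have hsub : Subsingleton R := by
      by_contra hne
      rw [not_subsingleton_iff_nontrivial] at hne
      obtain ⟨p, hp⟩ := Ideal.nonempty_minimalPrimes (I := (⊥ : Ideal R)) bot_ne_top
      have hpp : p.IsPrime := hp.1.1
      refine htR ⟨⟨p, hpp⟩, PrimeSpectrum.ext (eq_bot_iff.2 fun a ha => ?_)⟩
      by_contra ha0
      exact algebraMap_notMem_of_mem_minimalPrimes ha0 hp ha
    have hsubS : Subsingleton S := (algebraMap R S).codomain_trivial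
    exact ⟨inferInstance, isIntegrallyClosed_of_fibres hnormal,
      fun x => ⟨fun _ => Subsingleton.elim 0 x ▸ zero_mem _, fun _ => Subsingleton.elim _ _⟩,
      fun _ _ => mem_nonZeroDivisors_iff_right.2 fun _ _ => Subsingleton.elim _ _,
      fun _ => ⟨1, one_mem _, 0, Subsingleton.elim _ _⟩⟩
  have hb := hbir t htR
  refine ⟨inferInstance, isIntegrallyClosed_of_fibres hnormal,
    fun x => ⟨fun hx => ?_, fun hx => ?_⟩,
    fun b hb' => ?_, fun s => ?_⟩
  · have : x ∈ sInf (⊥ : Ideal R).minimalPrimes := by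
      rw [Submodule.mem_sInf]
      intro p hp
      obtain ⟨p', hp', rfl⟩ := exists_mem_minimalPrimes_fibreRing (t := t) rfl hp
      obtain ⟨q, hq, rfl⟩ := hb.1.surjOn hp'
      rw [Ideal.mem_comap, Ideal.mem_comap, fibreMap_toFibre, hmap, hx, map_zero]
      exact q.zero_mem
    rwa [Ideal.sInf_minimalPrimes] at this
  · exact IsNilpotent.eq_zero (IsNilpotent.map hx (algebraMap R S))
  · rw [mem_nonZeroDivisors_iff_right]
    intro s hs
    have : s ∈ sInf (⊥ : Ideal S).minimalPrimes := by
      rw [Submodule.mem_sInf]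
      intro (p : Ideal S) hp
      have hpp : p.IsPrime := hp.1.1
      refine (hpp.mem_or_mem (hs ▸ p.zero_mem : s * algebraMap R S b ∈ p)).resolve_right
        fun hbp => ?_
      obtain ⟨q, hq, rfl⟩ := exists_mem_minimalPrimes_fibreRing (t := t) rfl hp
      have h1 := comap_toFibre_mem_minimalPrimes (t := t) rfl (hb.1.mapsTo hq)
      refine notMem_of_mem_redRegular hb' h1 ?_
      rw [Ideal.mem_comap, Ideal.mem_comap, fibreMap_toFibre]
      exact hbp
    rw [Ideal.sInf_minimalPrimes] at this
    exact IsNilpotent.eq_zero this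
  -- The ideal of denominators of `s` lies in no minimal prime, by birationality on the generic
  -- fibre. Prime avoidance yields one denominator outside all of them, and this is regular modulo
  -- nilpotents.
  · obtain ⟨d, hd, hdp⟩ : ∃ d ∈ (LinearMap.range (Algebra.linearMap R S)).comap
        (LinearMap.toSpanSingleton R S s), ∀ p ∈ minimalPrimes R, d ∉ p := by
      by_contra! hcon
      have := (Ideal.subset_union_prime_finite (f := id)
        (I := (LinearMap.range (Algebra.linearMap R S)).comap (LinearMap.toSpanSingleton R S s))
        (minimalPrimes.finite_of_isNoetherianRing R) ⊤ ⊤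
        (fun q hq _ _ => hq.1.1)).1 (fun x hx => by
          obtain ⟨q, hq, hxq⟩ := hcon x hx
          exact Set.mem_biUnion hq hxq)
      obtain ⟨p, hp, hle⟩ := this
      obtain ⟨p', hp', rfl⟩ := exists_mem_minimalPrimes_fibreRing (t := t) rfl hp
      have hpp' := hp'.1.1
      obtain ⟨b, hbp, a, hba⟩ := hb.exists_mul_eq hfint hp' (toFibre t S s)
      obtain ⟨r₁, hr₁, b₁, hb₁⟩ := exists_smul_eq_toFibre t b
      obtain ⟨r₂, hr₂, a₂, ha₂⟩ := exists_smul_eq_toFibre t a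
      have hr₂b : r₂ • b₁ ∈ p'.comap (toFibre t R) := by
        refine hle ⟨r₁ • a₂, hinjS ?_⟩
        have h1 : fibreMap t (IsScalarTower.toAlgHom A R S) (toFibre t R (r₂ • b₁)) *
          toFibre t S s =
            fibreMap t (IsScalarTower.toAlgHom A R S) (toFibre t R (r₁ • a₂)) := by
          rw [Algebra.smul_def, map_mul (toFibre t R), AlgHom.commutes, ← hb₁, Algebra.smul_def,
            map_mul (toFibre t R), AlgHom.commutes, ← ha₂]
          simp only [map_mul]
          linear_combination fibreMap t (IsScalarTower.toAlgHom A R S)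
            (algebraMap A (FibreRing t R) r₁) * fibreMap t (IsScalarTower.toAlgHom A R S)
            (algebraMap A (FibreRing t R) r₂) * hba
        rw [fibreMap_toFibre, fibreMap_toFibre, ← map_mul] at h1
        rw [LinearMap.toSpanSingleton_apply, Algebra.smul_def (r₂ • b₁) s]
        exact h1.symm
      rw [Ideal.mem_comap, Algebra.smul_def, map_mul, AlgHom.commutes, ← hb₁,
        Ideal.unit_mul_mem_iff_mem _ (isUnit_algebraMap_fibreRing t hr₂),
        Ideal.unit_mul_mem_iff_mem _ (isUnit_algebraMap_fibreRing t hr₁)] at hr₂b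
      exact hbp hr₂b
    obtain ⟨r, hr⟩ := hd
    refine ⟨d, mem_redRegular_iff.2 fun x hx => ?_, r, ?_⟩
    · have : x ∈ sInf (⊥ : Ideal R).minimalPrimes := by
        rw [Submodule.mem_sInf]
        intro (p : Ideal R) hp
        have hpp : p.IsPrime := hp.1.1
        exact (hpp.mem_or_mem (nilradical_le_prime p hx)).resolve_right (hdp p hp)
      rwa [Ideal.sInf_minimalPrimes] at this
    · rw [← Algebra.smul_def]
      exact hr.symm

end GenericFibre

/-! ### Passing normality of fibres to the normalization -/

section Criterion

variable {A : Type u} [CommRing A]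

/-- Base change preserves surjectivity and the idempotent generator of the kernel, so the fibre is
again a quotient of a normal ring by an idempotent. -/
lemma IsNormalRing.fibreRing_of_surjective {S N : Type v} [CommRing S] [CommRing N] [Algebra A S]
    [Algebra A N] {t : PrimeSpectrum A} (hS : IsNormalRing (FibreRing t S)) (ρ : S →ₐ[A] N)
    (hρ : Function.Surjective ρ) {e : S} (he : e * e = e) (hker : RingHom.ker ρ = Ideal.span {e}) :
    IsNormalRing (FibreRing t N) := by
  refine hS.of_surjective (fibreMap t ρ) ?_ (e := toFibre t S e) (by rw [← map_mul, he]) ?_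
  · exact Algebra.TensorProduct.map_surjective _ _ Function.surjective_id hρ
  · have := Algebra.TensorProduct.lTensor_ker (A := t.asIdeal.ResidueField) ρ hρ
    refine this.trans ?_
    rw [hker, Ideal.map_span, Set.image_singleton]
    rfl

variable [IsDomain A] [IsPrincipalIdealRing A] {R : Type v} [CommRing R] [IsNoetherianRing R]
  [Algebra A R] [Module.Flat A R]

lemma AdmitsFiberwiseNormalization.exists_isNormalization
    (h : AdmitsFiberwiseNormalization A R) : ∃ (S : Type v) (_ : CommRing S) (_ : Algebra A S)
      (_ : Algebra R S) (_ : IsScalarTower A R S), IsNormalization R S ∧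
      ∀ t : PrimeSpectrum A, IsNormalRing (FibreRing t S) := by
  obtain ⟨S, _, _, φ, hφ⟩ := h
  let _ : Algebra R S := φ.toRingHom.toAlgebra
  have htower : IsScalarTower A R S := .of_algebraMap_eq fun x => (φ.commutes x).symm
  have heq : IsScalarTower.toAlgHom A R S = φ := AlgHom.ext fun _ => rfl
  exact ⟨S, inferInstance, inferInstance, inferInstance, htower,
    IsFiberwiseNormalization.isNormalization (heq ▸ hφ), hφ.2.2.1⟩

/-- If a flat morphism admits a fiberwise normalization, then the fibres of the normalization are
normal. -/
lemma AdmitsFiberwiseNormalization.isNormalRing_fibreRing (h : AdmitsFiberwiseNormalization A R)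
    {N : Type v} [CommRing N] [Algebra R N] [Algebra A N] [IsScalarTower A R N]
    (hN : IsNormalization R N) (t : PrimeSpectrum A) : IsNormalRing (FibreRing t N) := by
  obtain ⟨S, _, _, _, _, hS, hSt⟩ := h.exists_isNormalization
  obtain ⟨e₁⟩ := hS.nonempty_algEquiv
  obtain ⟨e₂⟩ := hN.nonempty_algEquiv
  let e : S ≃ₐ[A] N := (e₁.symm.trans e₂).restrictScalars A
  refine (hSt t).fibreRing_of_surjective (e : S →ₐ[A] N) e.surjective (mul_zero (0 : S)) ?_
  rw [Ideal.span_singleton_eq_bot.2 rfl, ← RingHom.injective_iff_ker_eq_bot]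
  exact e.injective

/-- If a flat morphism admits a fiberwise normalization, then the fibres of the normalization of
a union of irreducible components are normal. -/
lemma AdmitsFiberwiseNormalization.isNormalRing_fibreRing_quotient
    (h : AdmitsFiberwiseNormalization A R) {I : Ideal R} (hI : I.IsRadical)
    (hnz : ∀ d ∈ redRegular R, Ideal.Quotient.mk I d ∈ (R ⧸ I)⁰) {N : Type v} [CommRing N]
    [Algebra (R ⧸ I) N] [Algebra R N] [Algebra A N] [IsScalarTower R (R ⧸ I) N]
    [IsScalarTower A R N] (hN : IsNormalization (R ⧸ I) N) (t : PrimeSpectrum A) :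
    IsNormalRing (FibreRing t N) := by
  obtain ⟨S, _, _, _, _, hS, hSt⟩ := h.exists_isNormalization
  obtain ⟨ρ, e, hρ, he, hker⟩ := hS.exists_quotient_algHom hN hI hnz
  exact (hSt t).fibreRing_of_surjective (ρ.restrictScalars A) hρ he hker

end Criterion

/-! ### Constancy of delta and normality of the fibres -/

section Main

lemma finite_quotient_of_finite_residueField {k : Type u} {B : Type v} [Field k] [CommRing B]
    [Algebra k B] (p : PrimeSpectrum B) (h : Module.Finite k p.asIdeal.ResidueField) :
    Module.Finite k (B ⧸ p.asIdeal) := by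
  refine Module.Finite.of_injective (Ideal.Quotient.liftₐ p.asIdeal
    (IsScalarTower.toAlgHom k B p.asIdeal.ResidueField) fun a ha => ?_).toLinearMap ?_
  · simpa using ha
  · exact Ideal.injective_algebraMap_quotient_residueField p.asIdeal

lemma finite_quotient_of_finitelyManyINNS {A : Type u} [CommRing A] {R : Type v} [CommRing R]
    [Algebra A R] (hFibre : ∀ t ∈ Set.range (PrimeSpectrum.comap (algebraMap A R)),
      FinitelyManyINNS t.asIdeal.ResidueField (FibreRing t R)) (t : PrimeSpectrum A)
    (p : PrimeSpectrum (FibreRing t R)) (hp : ¬ IsNormalAt p) :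
    Module.Finite t.asIdeal.ResidueField (FibreRing t R ⧸ p.asIdeal) := by
  have ht : t ∈ Set.range (PrimeSpectrum.comap (algebraMap A R)) :=
    ⟨⟨p.asIdeal.comap (toFibre t R), inferInstance⟩,
      PrimeSpectrum.ext (comap_comap_toFibre t p.asIdeal)⟩
  exact finite_quotient_of_finite_residueField p ((hFibre t ht).2 p hp).2

lemma IsNormalization.flat {A : Type u} [CommRing A] [IsDomain A] [IsPrincipalIdealRing A]
    {B N : Type v} [CommRing B] [IsReduced B] [Algebra A B] [Module.Flat A B]
    [CommRing N] [Algebra B N] [Algebra A N] [IsScalarTower A B N] (hN : IsNormalization B N) :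
    Module.Flat A N := by
  refine flat_of_algebraMap_mem_nonZeroDivisors fun a ha => ?_
  rw [IsScalarTower.algebraMap_apply A B N]
  exact hN.algebraMap_mem _ (mem_redRegular_iff_of_isReduced.2
    (algebraMap_mem_nonZeroDivisors_of_flat ha))

variable {A : Type u} [CommRing A] {R : Type v} [CommRing R] [Algebra A R] {N : Type v} [CommRing N]
  [Algebra (PartGT 1 R) N] [Algebra A N]

lemma IsNagata.finite_toAlgHom [Algebra R N] [IsScalarTower R (PartGT 1 R) N]
    [IsScalarTower A R N] (hR : IsNagata R) (hN : IsNormalization (PartGT 1 R) N) :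
    (IsScalarTower.toAlgHom A R N).toRingHom.Finite := by
  have := hR.finite_of_isNormalization hN
  have : Module.Finite R N := Module.Finite.trans (PartGT 1 R) N
  exact RingHom.finite_algebraMap.2 this

variable [IsDomain A] [IsPrincipalIdealRing A] [Module.Flat A R] [IsScalarTower A (PartGT 1 R) N]

/-- All fibres of the normalization of `R^{>1}` have positive depth. -/
lemma IsNagata.socleFree_fibreRing (hR : IsNagata R) (hN : IsNormalization (PartGT 1 R) N)
    (hdim : ∀ n : Ideal N, n.IsMaximal → n.comap (algebraMap A N) ≠ ⊥ → 2 ≤ n.height)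
    (t : PrimeSpectrum A) : SocleFree (FibreRing t N) (FibreRing t N) := by
  have := hR.1
  have hflat : Module.Flat A N := hN.flat
  have hfin := hR.finite_of_isNormalization hN
  have : IsNoetherianRing N := IsNoetherianRing.of_finite (PartGT 1 R) N
  by_cases ht : t.asIdeal = ⊥
  · refine hN.socleFree_fibreRing (fun p hp => ?_) t ht
    exact_mod_cast lt_ringKrullDim_of_mem_minimalPrimes_partGT 1 hp
  · exact socleFree_fibreRing_of_isMaximal hN.isNormalRing hdim t ht

variable [Algebra R N] [IsScalarTower R (PartGT 1 R) N] [IsScalarTower A R N]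

lemma IsNagata.finite_normalization_fibreRing_partGT (hR : IsNagata R)
    (hN : IsNormalization (PartGT 1 R) N) (t : PrimeSpectrum A) [IsReduced (FibreRing t N)] :
    Module.Finite (FibreRing t N) (Normalization (FibreRing t N)) := by
  have := hR.1
  have hflat : Module.Flat A N := hN.flat
  have hfin := hR.finite_of_isNormalization hN
  have : IsNoetherianRing N := IsNoetherianRing.of_finite (PartGT 1 R) N
  have := isNoetherianRing_fibreRing t (S := N)
  by_cases ht : t.asIdeal = ⊥
  · exact (hN.isNormalRing.fibreRing_of_eq_bot t ht).finite_normalization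
  · exact hR.finite_normalization_fibreRing t _ (hR.finite_toAlgHom (A := A) hN)
      (IsPrime.to_maximal_ideal ht)

/-- The delta invariants of the fibres differ from a constant by the delta invariants of the fibres
of the normalization of `R^{>1}`. -/
theorem IsNagata.exists_fibreDelta_eq (hR : IsNagata R) (hN : IsNormalization (PartGT 1 R) N)
    (hker : Module.Finite A (LinearMap.ker (IsScalarTower.toAlgHom A R N).toLinearMap))
    (hcok : Module.Finite A (N ⧸ LinearMap.range (IsScalarTower.toAlgHom A R N).toLinearMap))
    (hFibre : ∀ t ∈ Set.range (PrimeSpectrum.comap (algebraMap A R)),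
      FinitelyManyINNS t.asIdeal.ResidueField (FibreRing t R))
    (hdim : ∀ n : Ideal N, n.IsMaximal → n.comap (algebraMap A N) ≠ ⊥ → 2 ≤ n.height) :
    (∀ t : PrimeSpectrum A, DeltaFinite t.asIdeal.ResidueField (FibreRing t R)) ∧
    ((∃ d : ℤ, ∀ t : PrimeSpectrum A, fibreDelta A R t = d) ↔
      ∀ t : PrimeSpectrum A, IsNormalRing (FibreRing t N)) := by
  have := hR.1
  have hflat : Module.Flat A N := hN.flat
  obtain ⟨c, hc⟩ := DeltaInv.exists_fibreDelta_eq (IsScalarTower.toAlgHom A R N)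
    (hR.finite_toAlgHom hN)
  have hc := fun t => hc t (finite_quotient_of_finitelyManyINNS hFibre t)
    (hR.socleFree_fibreRing hN hdim t) fun _ => hR.finite_normalization_fibreRing_partGT hN t
  refine ⟨fun t => (hc t).1, fun ⟨d, hd⟩ t => ?_, fun h => ⟨c, fun t => ?_⟩⟩
  -- The generic fibre of `N` is normal, so the constant value is `c`; the correction term then
  -- vanishes at every other point.
  · let t₀ : PrimeSpectrum A := ⟨⊥, Ideal.isPrime_bot⟩
    obtain ⟨d₀, h₀, h₀'⟩ := (hc t₀).2
    obtain ⟨d₁, h₁, h₁'⟩ := (hc t).2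
    have hfin := hR.finite_of_isNormalization hN
    rw [h₀'.2 (hN.isNormalRing.fibreRing_of_eq_bot t₀ rfl), hd] at h₀
    rw [hd] at h₁
    exact h₁'.1 (by push_cast at h₀; omega)
  · obtain ⟨d, h₁, h₂⟩ := (hc t).2
    rw [h₁, h₂.2 (h t)]
    simp

end Main

/-! ### Absence of zero-dimensional components -/

section Dimension

variable {A : Type u} [CommRing A] [IsDomain A] {R : Type v} [CommRing R]
  [Algebra A R] [Module.Flat A R]

/-- A zero-dimensional component would be finite over `A`, so that `A` would be a field. -/
lemma idealGT_one_le_nilradical (hA : ¬ IsField A) (hI : Module.Finite A (idealGT 1 R))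
    (hdim : ∀ p ∈ minimalPrimes R, ringKrullDim (R ⧸ p) ≠ 1) : idealGT 1 R ≤ nilradical R := by
  have key : ∀ p ∈ minimalPrimes R, idealGT 1 R ≤ p := by
    intro p hp
    have hpp : p.IsPrime := hp.1.1
    by_contra hnot
    have hnotlt : ¬ ((1 : ℕ) : WithBot ℕ∞) < ringKrullDim (R ⧸ p) := fun hlt =>
      hnot fun x hx => (mem_idealGT 1).1 hx p hp hlt
    have hlt : ringKrullDim (R ⧸ p) < 1 := by
      refine lt_of_le_of_ne ?_ (hdim p hp)
      simpa using hnotlt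
    have hfield : IsField (R ⧸ p) := by
      have h0 : ringKrullDim (R ⧸ p) ≤ ((0 : ℕ) : WithBot ℕ∞) := by
        revert hlt
        generalize ringKrullDim (R ⧸ p) = d
        induction d with
        | bot => exact fun _ => bot_le
        | coe d =>
          intro h
          have h' : d < 1 := by exact_mod_cast h
          rw [Order.lt_one_iff] at h'
          rw [h']
          rfl
      have := Ring.krullDimLE_iff.2 h0
      exact Ring.KrullDimLE.isField_of_isDomain
    -- A minimal prime `p` not containing the ideal would have the field `R ⧸ p` as quotient. The
    -- nonzero image of the ideal fills this field, which is thus finite over `A` and contains it.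
    let f : idealGT 1 R →ₗ[A] R ⧸ p :=
      (Ideal.Quotient.mkₐ A p).toLinearMap ∘ₗ ((idealGT 1 R).subtype.restrictScalars A)
    have hf : Function.Surjective f := by
      obtain ⟨x, hx, hxp⟩ := Set.not_subset.1 hnot
      intro z
      have hx0 : Ideal.Quotient.mk p x ≠ 0 := fun h => hxp (Ideal.Quotient.eq_zero_iff_mem.1 h)
      obtain ⟨w, hw⟩ := hfield.mul_inv_cancel hx0
      obtain ⟨y, hy⟩ := Ideal.Quotient.mk_surjective (w * z)
      refine ⟨⟨x * y, Ideal.mul_mem_right _ _ hx⟩, ?_⟩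
      change Ideal.Quotient.mk p (x * y) = z
      rw [map_mul, hy, ← mul_assoc, hw, one_mul]
    have hfin : Module.Finite A (R ⧸ p) := Module.Finite.of_surjective f hf
    refine hA (isField_of_isIntegral_of_isField (R := A) (S := R ⧸ p) ?_ hfield)
    rw [injective_iff_map_eq_zero]
    intro a ha
    by_contra ha0
    exact algebraMap_notMem_of_mem_minimalPrimes ha0 hp (Ideal.Quotient.eq_zero_iff_mem.1 ha)
  intro x hx
  have : x ∈ sInf (⊥ : Ideal R).minimalPrimes := by
    rw [Submodule.mem_sInf]
    exact fun p hp => key p hp hx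
  rwa [Ideal.sInf_minimalPrimes] at this

end Dimension

/-! ### Finiteness of the cokernel for the higher-dimensional part -/

section Cokernel

variable {A : Type u} [CommRing A] {R : Type v} [CommRing R] [Algebra A R] {N N₀ : Type v}
  [CommRing N] [Algebra (PartGT 1 R) N] [Algebra A N] [Algebra R N]
  [IsScalarTower R (PartGT 1 R) N] [IsScalarTower A R N]
  [CommRing N₀] [Algebra A N₀] [Algebra R N₀] [IsScalarTower A R N₀]

/-- The normalization of `R^{>1}` is a quotient of that of `R` as an `R`-algebra, so finiteness of
the cokernel is inherited. -/
lemma finite_coker_of_isNormalization [IsNoetherianRing R] (hN : IsNormalization (PartGT 1 R) N)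
    (hN₀ : IsNormalization R N₀)
    (hcok : Module.Finite A (N₀ ⧸ LinearMap.range (Algebra.linearMap R N₀))) :
    Module.Finite A (N ⧸ LinearMap.range (IsScalarTower.toAlgHom A R N).toLinearMap) := by
  obtain ⟨ρ, e, hρ, -⟩ := hN₀.exists_quotient_algHom hN (isRadical_idealGT 1) fun d hd =>
    mk_mem_nonZeroDivisors_partGT 1 fun p hp => notMem_of_mem_redRegular hd hp
  let f : (N₀ ⧸ LinearMap.range (Algebra.linearMap R N₀)) →ₗ[R]
      N ⧸ LinearMap.range (Algebra.linearMap R N) :=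
    Submodule.mapQ _ _ ρ.toLinearMap (by
      rintro _ ⟨x, rfl⟩
      exact ⟨x, (ρ.commutes x).symm⟩)
  have hf : Function.Surjective f := by
    intro x
    obtain ⟨y, rfl⟩ := Submodule.Quotient.mk_surjective _ x
    obtain ⟨z, rfl⟩ := hρ y
    exact ⟨Submodule.Quotient.mk z, rfl⟩
  have h₁ : Module.Finite A (N ⧸ LinearMap.range (Algebra.linearMap R N)) :=
    Module.Finite.of_surjective (f.restrictScalars A) hf
  let e := Submodule.Quotient.restrictScalarsEquiv A (LinearMap.range (Algebra.linearMap R N))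
  have h₂ : Module.Finite A (N ⧸ (LinearMap.range (Algebra.linearMap R N)).restrictScalars A) :=
    Module.Finite.equiv e.symm
  have hle : (LinearMap.range (Algebra.linearMap R N)).restrictScalars A ≤
      LinearMap.range (IsScalarTower.toAlgHom A R N).toLinearMap := by
    rintro _ ⟨x, rfl⟩
    exact ⟨x, rfl⟩
  exact Module.Finite.of_surjective (Submodule.factor hle) (Submodule.factor_surjective hle)

end Cokernel

/-! ### The theorem for arbitrary models of the normalizations -/

section Main

variable {A : Type u} [CommRing A] [IsDomain A] [IsPrincipalIdealRing A]

/-- Of the four defining conditions only birationality needs an argument: it follows from positive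
depth and the nilpotent kernel. -/
lemma admitsFiberwiseNormalization_of_socleFree {B N : Type v} [CommRing B] [IsNoetherianRing B]
    [CommRing N] [Algebra A B] [Algebra A N] [Module.Flat A B] [Module.Flat A N] (φ : B →ₐ[A] N)
    (hφ : φ.toRingHom.Finite) (hker : Module.Finite A (LinearMap.ker φ.toLinearMap))
    (hcok : Module.Finite A (N ⧸ LinearMap.range φ.toLinearMap))
    (hnil : ∀ x, φ x = 0 → x ∈ nilradical B)
    (hsoc : ∀ t : PrimeSpectrum A, SocleFree (FibreRing t N) (FibreRing t N))
    (hnormal : ∀ t : PrimeSpectrum A, IsNormalRing (FibreRing t N)) :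
    AdmitsFiberwiseNormalization A B :=
  ⟨N, inferInstance, inferInstance, φ, hφ, inferInstance, hnormal, fun t _ =>
    isBirational_fibreMap φ hφ t (hsoc t) hnil⟩

variable {R : Type v} [CommRing R] [Algebra A R] [Module.Flat A R] {N N₀ : Type v} [CommRing N]
  [Algebra (PartGT 1 R) N] [Algebra A N] [IsScalarTower A (PartGT 1 R) N]
  [Algebra R N] [IsScalarTower R (PartGT 1 R) N] [IsScalarTower A R N]
  [CommRing N₀] [Algebra A N₀] [Algebra R N₀] [IsScalarTower A R N₀]

theorem fibreDelta_constant_iff (hR : IsNagata R) (hN : IsNormalization (PartGT 1 R) N)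
    (hN₀ : IsNormalization R N₀)
    (hcok : Module.Finite A (N₀ ⧸ LinearMap.range (Algebra.linearMap R N₀)))
    (hker : Module.Finite A (RingHom.ker (algebraMap R N)))
    (hFibre : ∀ t ∈ Set.range (PrimeSpectrum.comap (algebraMap A R)),
      FinitelyManyINNS t.asIdeal.ResidueField (FibreRing t R))
    (hdim : ∀ n : Ideal N, n.IsMaximal → n.comap (algebraMap A N) ≠ ⊥ → 2 ≤ n.height) :
    (∀ t : PrimeSpectrum A, DeltaFinite t.asIdeal.ResidueField (FibreRing t R)) ∧
    (AdmitsFiberwiseNormalization A R → ∃ d : ℤ, ∀ t : PrimeSpectrum A, fibreDelta A R t = d) ∧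
    ((∃ d : ℤ, ∀ t : PrimeSpectrum A, fibreDelta A R t = d) ↔
      AdmitsFiberwiseNormalization A (PartGT 1 R)) ∧
    (¬ IsField A → (∀ p ∈ minimalPrimes R, ringKrullDim (R ⧸ p) ≠ 1) →
      (AdmitsFiberwiseNormalization A R ↔
        ∃ d : ℤ, ∀ t : PrimeSpectrum A, fibreDelta A R t = d)) := by
  have := hR.1
  have hflat : Module.Flat A N := hN.flat
  have hcok' := finite_coker_of_isNormalization hN hN₀ hcok
  have hker' : Module.Finite A (LinearMap.ker (IsScalarTower.toAlgHom A R N).toLinearMap) := by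
    let e : RingHom.ker (algebraMap R N) →ₗ[A]
        LinearMap.ker (IsScalarTower.toAlgHom A R N).toLinearMap :=
      { toFun := fun x => ⟨x.1, x.2⟩
        map_add' := fun _ _ => rfl
        map_smul' := fun _ _ => rfl }
    exact Module.Finite.of_surjective e fun x => ⟨⟨x.1, x.2⟩, rfl⟩
  have hsoc := fun t : PrimeSpectrum A => hR.socleFree_fibreRing hN hdim t
  have hkerI : RingHom.ker (algebraMap R N) = idealGT 1 R := by
    ext x
    rw [RingHom.mem_ker, IsScalarTower.algebraMap_apply R (PartGT 1 R) N,
      hN.algebraMap_eq_zero_iff, nilradical_eq_zero, Ideal.zero_eq_bot, Ideal.mem_bot]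
    exact Ideal.Quotient.eq_zero_iff_mem
  obtain ⟨h₁, h₂⟩ := hR.exists_fibreDelta_eq hN hker' hcok' hFibre hdim
  have h₃ : AdmitsFiberwiseNormalization A R →
      ∃ d : ℤ, ∀ t : PrimeSpectrum A, fibreDelta A R t = d := fun h =>
    h₂.2 (h.isNormalRing_fibreRing_quotient (isRadical_idealGT 1) (fun d hd =>
      mk_mem_nonZeroDivisors_partGT 1 fun p hp => notMem_of_mem_redRegular hd hp) hN)
  refine ⟨h₁, h₃, ⟨fun h => ?_, fun h => h₂.2 (h.isNormalRing_fibreRing hN)⟩, fun hA hp =>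
    ⟨h₃, fun h => ?_⟩⟩
  -- `R^{>1}` embeds into `N`, and the cokernel of this embedding is a quotient of that of `R → N`.
  · have hinj : Function.Injective (IsScalarTower.toAlgHom A (PartGT 1 R) N) := by
      rw [injective_iff_map_eq_zero]
      intro x hx
      exact IsNilpotent.eq_zero ((hN.algebraMap_eq_zero_iff x).1 hx)
    have hk : LinearMap.ker (IsScalarTower.toAlgHom A (PartGT 1 R) N).toLinearMap = ⊥ :=
      LinearMap.ker_eq_bot.2 hinj
    refine admitsFiberwiseNormalization_of_socleFree (IsScalarTower.toAlgHom A (PartGT 1 R) N)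
      (RingHom.finite_algebraMap.2 (hR.finite_of_isNormalization hN)) ?_ ?_ ?_ hsoc (h₂.1 h)
    · rw [hk]
      infer_instance
    · have hle : LinearMap.range (IsScalarTower.toAlgHom A R N).toLinearMap ≤
          LinearMap.range (IsScalarTower.toAlgHom A (PartGT 1 R) N).toLinearMap := by
        rintro _ ⟨x, rfl⟩
        exact ⟨Ideal.Quotient.mk _ x, (IsScalarTower.algebraMap_apply R (PartGT 1 R) N x).symm⟩
      exact Module.Finite.of_surjective (Submodule.factor hle) (Submodule.factor_surjective hle)
    · intro x hx
      exact (hN.algebraMap_eq_zero_iff x).1 hx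
  -- The kernel of `R → N` is `p^{>1}`, which is nilpotent because the components not in `X^{>1}`
  -- could only be zero-dimensional, and these are excluded.
  · refine admitsFiberwiseNormalization_of_socleFree (IsScalarTower.toAlgHom A R N)
      (hR.finite_toAlgHom hN) hker' hcok' (fun x hx => ?_) hsoc (h₂.1 h)
    have hx' : x ∈ RingHom.ker (algebraMap R N) := hx
    rw [hkerI] at hx' hker
    exact idealGT_one_le_nilradical hA hker hp hx'

end Main
end DeltaInv

theorem theorem3p4 {A : Type*} {R : Type*} [CommRing A] [IsDomain A] [IsPrincipalIdealRing A]
    [CommRing R] [Algebra A R] [Module.Flat A R]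
    (hR : DeltaInv.IsNagata R)
    -- `Coker(ν)` and `Ker(ν^{>1})` are finite over `A`
    (hCoker : Module.Finite A (DeltaInv.NormalizationCoker R))
    (hKer : Module.Finite A
      (RingHom.ker (algebraMap R (DeltaInv.Normalization (DeltaInv.PartGT 1 R)))))
    -- each fibre has finitely many non-normal points, all isolated, with finite residue fields
    (hFibre : ∀ t ∈ Set.range (PrimeSpectrum.comap (algebraMap A R)),
      DeltaInv.FinitelyManyINNS t.asIdeal.ResidueField (DeltaInv.FibreRing t R))
    -- the normalization of `X^{>1}` has dimension `≥ 2` at its closed points over closed points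
    (hDim : ∀ n : Ideal (DeltaInv.Normalization (DeltaInv.PartGT 1 R)), n.IsMaximal →
      n.comap (algebraMap A (DeltaInv.Normalization (DeltaInv.PartGT 1 R))) ≠ ⊥ → 2 ≤ n.height) :
    (∀ t : PrimeSpectrum A, DeltaInv.DeltaFinite t.asIdeal.ResidueField
      (DeltaInv.FibreRing t R)) ∧
    (DeltaInv.AdmitsFiberwiseNormalization A R →
      ∃ d : ℤ, ∀ t : PrimeSpectrum A, DeltaInv.fibreDelta A R t = d) ∧
    ((∃ d : ℤ, ∀ t : PrimeSpectrum A, DeltaInv.fibreDelta A R t = d) ↔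
      DeltaInv.AdmitsFiberwiseNormalization A (DeltaInv.PartGT 1 R)) ∧
    (¬ IsField A → (∀ p ∈ minimalPrimes R, ringKrullDim (R ⧸ p) ≠ 1) →
      (DeltaInv.AdmitsFiberwiseNormalization A R ↔
        ∃ d : ℤ, ∀ t : PrimeSpectrum A, DeltaInv.fibreDelta A R t = d)) :=
  DeltaInv.fibreDelta_constant_iff hR (DeltaInv.isNormalization_normalization _)
    (DeltaInv.isNormalization_normalization R) hCoker hKer hFibre hDim
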